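/- **Theorem (relatively trace-class perturbations).** Let $\mathcal H$ be a complex separable Hilbert space, $H_0$ a self-adjoint operator on $\mathcal H$ bounded from below, $V$ a bounded operator on $\mathcal H$, and $H=H_0+V$ with domain $\mathcal D(H_0)$. Write $\sigma$, $\rho$ for spectrum and resolvent set, and let $D(\Omega)$, $D'(\Omega)$ be the smooth complex-valued functions with compact support in $\Omega$, and the distributions on $\Omega$. Let $I\subset\mathbb R$ be an open interval such that 1. $H$ has only finitely many non-real eigenvalues with real part in $I$; 2. there are $a,n,C>0$ such that every $z$ with $\operatorname{Re}z\in I$ and $0<|\operatorname{Im}z|<a$ lies in $\rho(H)$ and satisfies $\|(H-z)^{-1}\|\le C|\operatorname{Im}z|^{-1}\big(\langle \operatorname{Re}z\rangle/|\operatorname{Im}z|\big)^{n}$, where $\langle x\rangle=(1+x^2)^{1/2}$. Call $(c,m)$, with $c\in\mathbb R$ and $m\in\mathbb N$, $m\ge1$, *admissible* if $I\subset(-c,\infty)$; $-c\in\rho(H_0)$, and moreover $\sigma(H_0)\subset(-c,\infty)$ if $m$ is even; $\sigma(H+c)\subset(0,\infty)\,e^{i(-\frac{\pi}{2m},\frac{\pi}{2m})}$;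 and $(H+c)^{-m}-(H_0+c)^{-m}$ is of trace class. Assume that $(c,m)$ is admissible and set $X=(H+c)^{-m}$, $X_0=(H_0+c)^{-m}$ and $J=\{(\lambda+c)^{-m}:\lambda\in I\}$. For $L\in\{H,H_0,X,X_0\}$ and $f$ smooth with compact support, put $$f(L)=\frac1\pi\int_{\mathbb C}\partial_{\bar z}\tilde f(z)\,(L-z)^{-1}\,dx\,dy,\qquad \tilde f(x+iy)=\Big(\sum_{k=0}^N\frac{f^{(k)}(x)}{k!}(iy)^k\Big)\,\tau\big(y/\langle x\rangle\big),$$ where $\tau$ is a smooth compactly supported cut-off function, equal to $1$ near $0$, such that the support of $(x,y)\mapsto\tau(y/\langle x\rangle)$ contains no non-real point of $\sigma(L)$ with real part in the support of $f$, and $N$ is large; $f(L)$ is called well defined if such $\tau$ exist and, for all large $N$, the integral converges absolutely in operator norm for all such $\tau$, with one value independent of $\tau$ and $N$. Then: * **(Well-definedness.)** For all $f\in D(J)$, the operators $f(X)$ and $f(X_0)$ are well defined, $f(X)-f(X_0)$ is of trace class, and there is a distribution $\xi_{c,m}=\xi(\cdot\,;X,X_0)\in D'(J)$, unique up to an additive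 constant, with $\langle\xi_{c,m}',f\rangle=\operatorname{Tr}\big(f(X)-f(X_0)\big)$ for all $f\in D(J)$. Consequently $$\xi(\lambda;H,H_0):=\xi_{c,m}\big((\lambda+c)^{-m}\big),\qquad \lambda\in I,$$ is a well-defined distribution on $I$ up to an additive constant (the composition with the diffeomorphism $\lambda\mapsto(\lambda+c)^{-m}$ from $I$ onto $J$ being taken in the sense of distributions). * **(Trace formula.)** For all $f\in D(I)$, the operators $f(H)$ and $f(H_0)$ are well defined, $f(H)-f(H_0)$ is of trace class, and $$\operatorname{Tr}\big(f(H)-f(H_0)\big)=\langle \xi(\cdot\,;H,H_0),f'\rangle .$$ * **(Independence.)** Any other admissible pair $(c',m')$ gives the same $\xi(\cdot\,;H,H_0)$, as a class of distributions on $I$ modulo additive constants. * **(Uniqueness.)** If $G\subset I\cap\rho(H)\cap\rho(H_0)$ is a non-empty open interval (a spectral gap), exactly one distribution on $I$ satisfies the trace formula and vanishes on $G$, and it is a representative of $\xi(\cdot\,;H,H_0)$. -/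

import Mathlib

open Set MeasureTheory TopologicalSpace
open scoped Distributions ContDiff Topology

namespace SSF

noncomputable section

/-! ### Trace-class operators and the trace -/

section TraceClass

variable {E : Type*} [NormedAddCommGroup E] [InnerProductSpace ℂ E] [CompleteSpace E]

variable (E) in
/-- The index set of a fixed orthonormal (Hilbert) basis of `E`. -/
def basisIndex : Set E := (exists_hilbertBasis ℂ E).choose

variable (E) in
/-- A fixed orthonormal (Hilbert) basis of `E`. The two notions defined from it below do not
depend on it. -/
def basis : HilbertBasis (basisIndex E) ℂ E := (exists_hilbertBasis ℂ E).choose_spec.choose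

/-- `T` belongs to the Schatten class `𝓛₁`: `∑ i, ⟪e i, |T| e i⟫ < ∞`, with `|T| = (T* T)^(1/2)`. -/
def IsTraceClass (T : E →L[ℂ] E) : Prop :=
  Summable fun i => (inner ℂ (basis E i) (CFC.abs T (basis E i))).re

/-- `Tr T = ∑ i, ⟪e i, T e i⟫`, meaningful when `T` is of trace class. -/
def trace (T : E →L[ℂ] E) : ℂ :=
  ∑' i, inner ℂ (basis E i) (T (basis E i))

end TraceClass

/-! ### Spectrum and resolvent of an unbounded operator -/

section Resolvent

variable {E : Type*} [NormedAddCommGroup E] [NormedSpace ℂ E]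

/-- The bounded operator `R` is the two-sided inverse of `L - z : D(L) → E`. -/
def IsResolventAt (L : E →ₗ.[ℂ] E) (z : ℂ) (R : E →L[ℂ] E) : Prop :=
  (∀ u : E, ∃ h : R u ∈ L.domain, L ⟨R u, h⟩ - z • R u = u) ∧
    ∀ u : L.domain, R (L u - z • (u : E)) = u

/-- The resolvent set `ρ(L)`. -/
def resolventSet (L : E →ₗ.[ℂ] E) : Set ℂ := {z | ∃ R, IsResolventAt L z R}

/-- The spectrum `σ(L)`. -/
def spectrum (L : E →ₗ.[ℂ] E) : Set ℂ := (resolventSet L)ᶜ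

open Classical in
/-- The resolvent `(L - z)⁻¹` for `z ∈ ρ(L)` (and `0` for `z ∉ ρ(L)`). -/
def resolvent (L : E →ₗ.[ℂ] E) (z : ℂ) : E →L[ℂ] E :=
  if h : ∃ R, IsResolventAt L z R then h.choose else 0

theorem IsResolventAt.unique {L : E →ₗ.[ℂ] E} {z : ℂ} {R S : E →L[ℂ] E}
    (hR : IsResolventAt L z R) (hS : IsResolventAt L z S) : R = S := by
  ext u
  obtain ⟨h, hu⟩ := hR.1 u
  have := hS.2 ⟨R u, h⟩
  simpa [hu] using this.symm

theorem isResolventAt_resolvent {L : E →ₗ.[ℂ] E} {z : ℂ} (hz : z ∈ resolventSet L) :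
    IsResolventAt L z (resolvent L z) := by
  have hz' : ∃ R, IsResolventAt L z R := hz
  rw [resolvent, dif_pos hz']
  exact hz'.choose_spec

/-- The point spectrum (set of eigenvalues) `σ_p(L)`. -/
def pointSpectrum (L : E →ₗ.[ℂ] E) : Set ℂ :=
  {z | ∃ u : L.domain, (u : E) ≠ 0 ∧ L u = z • (u : E)}

/-- A bounded operator seen as an operator with domain the whole space. -/
def ofBounded (X : E →L[ℂ] E) : E →ₗ.[ℂ] E := X.toLinearMap.toPMap ⊤

/-- The bounded operator `(L + c)^(-m)`, for `-c ∈ ρ(L)`. -/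
def negPow (L : E →ₗ.[ℂ] E) (c : ℝ) (m : ℕ) : E →L[ℂ] E := resolvent L (-(c : ℂ)) ^ m

/-! ### The hypotheses on `H` over an interval -/

/-- `⟨x⟩ = (1 + x²)^(1/2)`. -/
def japaneseBracket (x : ℝ) : ℝ := Real.sqrt (1 + x ^ 2)

/-- `L` has only finitely many non-real eigenvalues whose real parts lie in `I`. -/
def FinitelyManyNonrealEigenvalues (L : E →ₗ.[ℂ] E) (I : Set ℝ) : Prop :=
  {z : ℂ | z ∈ pointSpectrum L ∧ z.im ≠ 0 ∧ z.re ∈ I}.Finite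

/-- There are `a, n, C > 0` such that the region `S = {Re z ∈ I, 0 < |Im z| < a}` is contained in
`ρ(L)` and `‖(L - z)⁻¹‖ ≤ C |Im z|⁻¹ (⟨Re z⟩ / |Im z|)ⁿ` for `z ∈ S`. -/
def PolynomialResolventBound (L : E →ₗ.[ℂ] E) (I : Set ℝ) : Prop :=
  ∃ a > (0 : ℝ), ∃ n > (0 : ℝ), ∃ C > (0 : ℝ), ∀ z : ℂ, z.re ∈ I → 0 < |z.im| → |z.im| < a →
    z ∈ resolventSet L ∧
      ‖resolvent L z‖ ≤ C * |z.im|⁻¹ * (japaneseBracket z.re / |z.im|) ^ n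

/-! ### Functional calculus by the Helffer–Sjöstrand formula -/

/-- The operator `∂/∂z̄ = (∂ₓ + i ∂_y) / 2`. -/
def dbar (F : ℂ → ℂ) (z : ℂ) : ℂ :=
  (1 / 2) * (fderiv ℝ F z 1 + Complex.I * fderiv ℝ F z Complex.I)

/-- The almost-analytic extension
`(∑ k ≤ N, f⁽ᵏ⁾(x) (i y)ᵏ / k!) τ(y / ⟨x⟩)` of order `N`, where `z = x + i y`. -/
def almostAnalyticExtension (f : ℝ → ℂ) (N : ℕ) (τ : ℝ → ℂ) (z : ℂ) : ℂ :=
  (∑ k ∈ Finset.range (N + 1),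
      iteratedDeriv k f z.re / (k.factorial : ℂ) * (Complex.I * (z.im : ℂ)) ^ k) *
    τ (z.im / japaneseBracket z.re)

/-- `τ` is a smooth compactly supported cut-off function, equal to `1` near `0`, such that the
support of `τ(y / ⟨x⟩)` over the support of `f` contains no non-real point of `σ(L)`. -/
structure IsAdmissibleCutoff (L : E →ₗ.[ℂ] E) (f : ℝ → ℂ) (τ : ℝ → ℂ) : Prop where
  smooth : ContDiff ℝ ∞ τ
  compact : HasCompactSupport τ
  eq_one : ∀ᶠ s in 𝓝 (0 : ℝ), τ s = 1
  avoids : ∀ z : ℂ, z.im ≠ 0 → z.re ∈ tsupport f →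
    z.im / japaneseBracket z.re ∈ tsupport τ → z ∈ resolventSet L

/-- `T = f(L)`: there is an admissible cut-off and, for all admissible cut-offs `τ` and all
sufficiently large orders `N`, the integral in
`T = π⁻¹ ∫ ∂f̃/∂z̄ (L - z)⁻¹ dx dy` converges (in operator norm) and has the value `T`. -/
def IsFunCalc (L : E →ₗ.[ℂ] E) (f : ℝ → ℂ) (T : E →L[ℂ] E) : Prop :=
  (∃ τ, IsAdmissibleCutoff L f τ) ∧
    ∃ N₀ : ℕ, ∀ N ≥ N₀, ∀ τ, IsAdmissibleCutoff L f τ →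
      Integrable (fun z : ℂ => dbar (almostAnalyticExtension f N τ) z • resolvent L z) ∧
        T = ((Real.pi : ℂ)⁻¹) •
          ∫ z : ℂ, dbar (almostAnalyticExtension f N τ) z • resolvent L z

theorem IsFunCalc.unique {L : E →ₗ.[ℂ] E} {f : ℝ → ℂ} {T S : E →L[ℂ] E}
    (hT : IsFunCalc L f T) (hS : IsFunCalc L f S) : T = S := by
  obtain ⟨⟨τ, hτ⟩, N₁, h₁⟩ := hT
  obtain ⟨-, N₂, h₂⟩ := hS
  rw [(h₁ _ (le_max_left N₁ N₂) τ hτ).2, (h₂ _ (le_max_right N₁ N₂) τ hτ).2]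

/-- `f(L)` is well defined. -/
def FunCalcDefined (L : E →ₗ.[ℂ] E) (f : ℝ → ℂ) : Prop := ∃ T, IsFunCalc L f T

open Classical in
/-- The operator `f(L)` (and `0` if it is not well defined). -/
def funCalc (L : E →ₗ.[ℂ] E) (f : ℝ → ℂ) : E →L[ℂ] E :=
  if h : FunCalcDefined L f then h.choose else 0

theorem isFunCalc_funCalc {L : E →ₗ.[ℂ] E} {f : ℝ → ℂ} (h : FunCalcDefined L f) :
    IsFunCalc L f (funCalc L f) := by
  rw [funCalc, dif_pos h]
  exact h.choose_spec

end Resolvent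

/-! ### Distributions on open subsets of the real line -/

/-- The space `D'(Ω)` of distributions: continuous linear forms on the space `D(Ω)` of smooth
complex-valued functions with compact support in `Ω`. -/
abbrev Distr (Ω : Opens ℝ) := 𝓓(Ω, ℂ) →L[ℂ] ℂ

/-- The derivative `f ↦ f'` on test functions. -/
def testDeriv {Ω : Opens ℝ} : 𝓓(Ω, ℂ) →L[ℂ] 𝓓(Ω, ℂ) := TestFunction.lineDerivCLM ℂ (1 : ℝ)

theorem testDeriv_apply {Ω : Opens ℝ} (f : 𝓓(Ω, ℂ)) (x : ℝ) : testDeriv f x = deriv f x := by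
  rw [testDeriv, TestFunction.lineDerivCLM_apply_of_le (by simp)]
  simp [lineDeriv, deriv_comp_const_add]

/-- The distributional derivative, `⟨ξ', f⟩ = -⟨ξ, f'⟩`. -/
def distrDeriv {Ω : Opens ℝ} (ξ : Distr Ω) : Distr Ω := -(ξ.comp testDeriv)

/-- `η = ξ + k` for some constant `k ∈ ℂ`. -/
def EqUpToConstant {Ω : Opens ℝ} (ξ η : Distr Ω) : Prop :=
  ∃ k : ℂ, ∀ f : 𝓓(Ω, ℂ), η f = ξ f + k * ∫ x, f x

/-- The spectral change of variables `φ(x) = (x + c)^(-m)`. -/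
def specMap (c : ℝ) (m : ℕ) (x : ℝ) : ℝ := ((x + c) ^ m)⁻¹

/-- For an open `I ⊆ (-c, ∞)` and `m ≥ 1`, the open set `φ(I)` with `φ(x) = (x + c)^(-m)`, written
through the inverse map `μ ↦ μ^(-1/m) - c`; for `I = (s₀, s₁)` it is
`((s₁ + c)^(-m), (s₀ + c)^(-m))`. -/
def specImage (c : ℝ) (m : ℕ) (I : Opens ℝ) : Opens ℝ where
  carrier := Ioi 0 ∩ (fun μ : ℝ => μ ^ (-(1 / (m : ℝ))) - c) ⁻¹' (I : Set ℝ)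
  is_open' := by
    refine ContinuousOn.isOpen_inter_preimage ?_ isOpen_Ioi I.isOpen
    refine ContinuousOn.sub (ContinuousOn.rpow_const continuousOn_id ?_) continuousOn_const
    intro x hx
    exact Or.inl (ne_of_gt hx)

theorem coe_specImage {c : ℝ} {m : ℕ} (hm : 1 ≤ m) {I : Opens ℝ} (hI : (I : Set ℝ) ⊆ Ioi (-c)) :
    (specImage c m I : Set ℝ) = specMap c m '' (I : Set ℝ) := by
  have hm0 : (m : ℝ) ≠ 0 := by positivity
  have hm1 : m ≠ 0 := by omega
  ext μ
  constructor
  · rintro ⟨hμ, hI'⟩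
    have hμ : (0 : ℝ) < μ := hμ
    refine ⟨_, hI', ?_⟩
    rw [specMap, sub_add_cancel, ← Real.rpow_natCast, ← Real.rpow_mul hμ.le]
    have : -(1 / (m : ℝ)) * m = -1 := by field_simp
    rw [this, Real.rpow_neg_one, inv_inv]
  · rintro ⟨x, hx, rfl⟩
    have hx' : 0 < x + c := by have := hI hx; simp only [mem_Ioi] at this; linarith
    refine ⟨by simp only [specMap, mem_Ioi]; positivity, ?_⟩
    have : (specMap c m x) ^ (-(1 / (m : ℝ))) = x + c := by
      rw [specMap, Real.rpow_neg (by positivity), Real.inv_rpow (by positivity), inv_inv, one_div,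
        Real.pow_rpow_inv_natCast hx'.le hm1]
    rw [mem_preimage, this, add_sub_cancel_right]
    exact hx

/-- `ξ(x) = η(φ(x))`, `φ(x) = (x + c)^(-m)`, as distributions on `I`:
`⟨η ∘ φ, g⟩ = ⟨η, h⟩` whenever `g(x) = |φ'(x)| h(φ(x))` on `I`. -/
def IsComposition (c : ℝ) (m : ℕ) {I : Opens ℝ} (ξ : Distr I)
    (η : Distr (specImage c m I)) : Prop :=
  ∀ (g : 𝓓(I, ℂ)) (h : 𝓓(specImage c m I, ℂ)),
    (∀ x ∈ I, g x = ((|deriv (specMap c m) x| : ℝ) : ℂ) * h (specMap c m x)) → ξ g = η h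

/-! ### Spectral shift functions -/

section Main

variable {E : Type*} [NormedAddCommGroup E] [InnerProductSpace ℂ E] [CompleteSpace E]

/-- For `f ∈ D(Ω)`: the operators `f(L)`, `f(L₀)` are well defined and `f(L) - f(L₀)` is of trace
class. -/
def TraceDifferenceDefined (L L₀ : E →ₗ.[ℂ] E) {Ω : Opens ℝ} (f : 𝓓(Ω, ℂ)) : Prop :=
  FunCalcDefined L f ∧ FunCalcDefined L₀ f ∧ IsTraceClass (funCalc L f - funCalc L₀ f)

/-- `ξ` is (a representative, modulo additive constants, of) the spectral shift function on `Ω` of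
the pair `(X, X₀)` of bounded operators: `⟨ξ', f⟩ = Tr (f(X) - f(X₀))` for all `f ∈ D(Ω)`. -/
def IsSSF (X X₀ : E →L[ℂ] E) (Ω : Opens ℝ) (ξ : Distr Ω) : Prop :=
  ∀ f : 𝓓(Ω, ℂ), TraceDifferenceDefined (ofBounded X) (ofBounded X₀) f ∧
    distrDeriv ξ f = trace (funCalc (ofBounded X) f - funCalc (ofBounded X₀) f)

/-- `ξ(x) = ξ((x + c)^(-m); (H + c)^(-m), (H₀ + c)^(-m))` on `I`, for some representative of the
spectral shift function of the pair `((H + c)^(-m), (H₀ + c)^(-m))` on `φ(I)`. -/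
def IsRelativeSSF (H H₀ : E →ₗ.[ℂ] E) (I : Opens ℝ) (c : ℝ) (m : ℕ) (ξ : Distr I) : Prop :=
  ∃ η : Distr (specImage c m I),
    IsSSF (negPow H c m) (negPow H₀ c m) (specImage c m I) η ∧ IsComposition c m ξ η

/-- The trace formula `Tr (f(H) - f(H₀)) = ∫ ξ f'` for all `f ∈ D(I)`. -/
def TraceFormula (H H₀ : E →ₗ.[ℂ] E) (I : Opens ℝ) (ξ : Distr I) : Prop :=
  ∀ f : 𝓓(I, ℂ), TraceDifferenceDefined H H₀ f ∧
    trace (funCalc H f - funCalc H₀ f) = ξ (testDeriv f)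

/-- The admissible pairs `(c, m)` of parameters for `(H, H₀)` and `I`: `m ≥ 1`, `I ⊆ (-c, ∞)`, the
operator `H₀ + c` is invertible (with positive spectrum if `m` is even, so that `(x + c)^m` takes
its values on `I` at no other point of `σ(H₀)`), the spectrum of `H + c` lies in the open sector
`(0, ∞) · exp(i (-π/(2m), π/(2m)))`, and `(H + c)^(-m) - (H₀ + c)^(-m)` is of trace class. -/
structure IsAdmissiblePair (H H₀ : E →ₗ.[ℂ] E) (I : Opens ℝ) (c : ℝ) (m : ℕ) : Prop where
  one_le : 1 ≤ m
  subset_Ioi : (I : Set ℝ) ⊆ Ioi (-c)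
  spectrum_unperturbed : ∀ z ∈ spectrum H₀, z + c ≠ 0 ∧ (Even m → -c < z.re)
  spectrum_perturbed : ∀ z ∈ spectrum H, z + c ≠ 0 ∧ |(z + c).arg| < Real.pi / (2 * m)
  traceClass : IsTraceClass (negPow H c m - negPow H₀ c m)

/-- A spectral gap in `I`: a non-empty open interval contained in `I ∩ ρ(H) ∩ ρ(H₀)`. -/
structure IsSpectralGap (H H₀ : E →ₗ.[ℂ] E) (I : Opens ℝ) (G : Set ℝ) : Prop where
  isOpen : IsOpen G
  ordConnected : G.OrdConnected
  nonempty : G.Nonempty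
  subset : G ⊆ I
  resolvent : ∀ x ∈ G, (x : ℂ) ∈ resolventSet H ∩ resolventSet H₀

end Main

end

end SSF

namespace SSF

/-! ### Green's formula for `∂/∂z̄` -/

/-! The functional calculus rests on Green's formula. Suppose an extension `G` of `f` satisfies
∂G/∂z̄ = O(|y|^N), and the resolvent is holomorphic and O(|y|^(-n)) off the real axis. Then the
Helffer–Sjöstrand integral converges for N ≥ n. Two extensions of `f` differ by a function that
vanishes on the axis and is therefore itself O(|y|^N) (`norm_le_of_dbar_flat`). For N ≥ n + 2 its
product with the resolvent is differentiable across the axis, and Green's formula makes the two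
integrals equal (`IsExtension.integral_eq`). So f(L) depends neither on the cut-off nor on the
order, and any extension with suitable support computes it (`isFunCalc_of_isExtension`).

For the bounded pair X, X₀ the second resolvent identity puts the trace-class factor X - X₀ between
two resolvents. The trace norm of the difference of resolvents is then O(|y|^(-2n)), and an
extension of order 2n + 2 bounds the trace norm of f(X) - f(X₀) by finitely many derivatives of f
(`exists_nuclearBound_funCalc`). Hence f ↦ Tr(f(X) - f(X₀)) is a distribution, and on an interval it
has a primitive, unique up to a constant.

The passage to H is the invariance f(H) = (f ∘ ψ)((H + c)^(-m)) with ψ(w) = w^(-1/m) - c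
(`funCalc_negPow`). With R = (H + c)⁻¹ and x = w^(1/m), one has R^m - w = (R - x)P, and the sector
condition makes P invertible by spectral mapping. It follows that (X - w)⁻¹ equals ψ'(w)(H - ψ(w))⁻¹
up to a holomorphic term, whose contribution Green's formula annihilates
(`exists_resolvent_negPow_eq`). Since ∂/∂z̄ of G ∘ ψ contributes the conjugate of ψ', the two
factors together form the Jacobian |ψ'|² of the substitution. The same argument applies to H₀, and
the trace formula follows from the chain rule.

The trace formula determines ξ' and does not involve (c, m), so its solutions are exactly the
relative spectral shift functions of any admissible pair; this is the independence. On a gap f(H) =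
f(H₀) = 0, so ξ is constant there and can be normalized to 0. -/

theorem integral_dbar_eq_zero {F : Type*} [NormedAddCommGroup F] [NormedSpace ℂ F]
    [CompleteSpace F] {w : ℂ → F} (hd : Differentiable ℝ w) (hc : HasCompactSupport w)
    (hi : Integrable fun z => fderiv ℝ w z 1 + Complex.I • fderiv ℝ w z Complex.I) :
    ∫ z, (fderiv ℝ w z 1 + Complex.I • fderiv ℝ w z Complex.I) = 0 := by
  obtain ⟨M₀, hM₀⟩ := hc.isCompact.isBounded.subset_closedBall (0 : ℂ)
  set M : ℝ := |M₀| + 1 with hM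
  have hMpos : 0 < M := by positivity
  have hz : ∀ z : ℂ, M ≤ |z.re| ∨ M ≤ |z.im| → z ∉ tsupport w := by
    intro z h hzs
    have h1 := hM₀ hzs
    rw [mem_closedBall_zero_iff] at h1
    have h2 := Complex.abs_re_le_norm z
    have h3 := Complex.abs_im_le_norm z
    have h4 := le_abs_self M₀
    rcases h with h | h <;> linarith
  have hw : ∀ z : ℂ, M ≤ |z.re| ∨ M ≤ |z.im| → w z = 0 := fun z h =>
    image_eq_zero_of_notMem_tsupport (hz z h)
  have hdw : ∀ z : ℂ, M ≤ |z.re| ∨ M ≤ |z.im| → fderiv ℝ w z = 0 := fun z h =>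
    image_eq_zero_of_notMem_tsupport fun h' => hz z h (tsupport_fderiv_subset ℝ h')
  have habs : |M| = M := abs_of_pos hMpos
  have key := Complex.integral_boundary_rect_of_differentiableOn_real w
    (-M + (-M : ℝ) * Complex.I) (M + M * Complex.I) hd.differentiableOn (by
      refine Integrable.integrableOn ?_
      convert hi.smul Complex.I using 1
      ext z
      simp [smul_add, smul_smul, sub_eq_add_neg])
  have e1 : ∀ x : ℝ, w (x + ((-M + (-M : ℝ) * Complex.I : ℂ)).im * Complex.I) = 0 := fun x =>
    hw _ (Or.inr (by simp [habs]))
  have e2 : ∀ x : ℝ, w (x + ((M + M * Complex.I : ℂ)).im * Complex.I) = 0 := fun x =>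
    hw _ (Or.inr (by simp [habs]))
  have e3 : ∀ y : ℝ, w (((M + M * Complex.I : ℂ)).re + y * Complex.I) = 0 := fun x =>
    hw _ (Or.inl (by simp [habs]))
  have e4 : ∀ y : ℝ, w (((-M + (-M : ℝ) * Complex.I : ℂ)).re + y * Complex.I) = 0 := fun x =>
    hw _ (Or.inl (by simp [habs]))
  simp only [e1, e2, e3, e4, intervalIntegral.integral_zero, smul_zero, sub_zero, add_zero] at key
  -- `g` is `Complex.I` times the integrand of the statement; this is the form in which Stokes'
  -- formula on a rectangle delivers it.
  set g : ℂ → F := fun z => Complex.I • fderiv ℝ w z 1 - fderiv ℝ w z Complex.I with hg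
  have hg0 : ∀ z : ℂ, M ≤ |z.re| ∨ M ≤ |z.im| → g z = 0 := fun z h => by simp [hg, hdw z h]
  have hint : Integrable g := by
    convert hi.smul Complex.I using 1
    ext z
    simp [hg, smul_add, smul_smul, sub_eq_add_neg]
  have hmp := Complex.volume_preserving_equiv_real_prod.symm
  have hint2 : Integrable (fun p : ℝ × ℝ => g (Complex.measurableEquivRealProd.symm p))
      (volume.prod volume) := (hmp.integrable_comp_emb
        Complex.measurableEquivRealProd.symm.measurableEmbedding).2 hint
  have hgtot : ∫ z, g z = 0 := by
    rw [← hmp.integral_comp Complex.measurableEquivRealProd.symm.measurableEmbedding,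
      Measure.volume_eq_prod, integral_prod _ hint2, key]
    have hre : ((-M + (-M : ℝ) * Complex.I : ℂ)).re = -M := by simp
    have him : ((-M + (-M : ℝ) * Complex.I : ℂ)).im = -M := by simp
    have hre' : ((M + M * Complex.I : ℂ)).re = M := by simp
    have him' : ((M + M * Complex.I : ℂ)).im = M := by simp
    have hin : ∀ x : ℝ, ∫ y : ℝ in (-M)..M, g (x + y * Complex.I) =
        ∫ y : ℝ, g (x + y * Complex.I) := by
      intro x
      refine intervalIntegral.integral_eq_integral_of_support_subset fun y hy => ?_
      by_contra hcon
      refine hy (hg0 _ (Or.inr ?_))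
      simp only [Complex.add_im, Complex.ofReal_im, Complex.mul_im, Complex.I_im, Complex.I_re,
        Complex.ofReal_re, mul_one, mul_zero, zero_add, add_zero]
      simp only [mem_Ioc, not_and_or, not_lt, not_le] at hcon
      rcases hcon with h | h
      · exact le_trans (by linarith) (neg_le_abs y)
      · exact h.le.trans (le_abs_self y)
    rw [hre, him, hre', him']
    change _ = ∫ x in (-M)..M, ∫ y in (-M)..M, g (x + y * Complex.I)
    simp only [hin]
    symm
    refine (intervalIntegral.integral_eq_integral_of_support_subset fun x hx => ?_).trans ?_
    · by_contra hcon
      refine hx ?_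
      have : ∀ y : ℝ, g (x + y * Complex.I) = 0 := by
        intro y
        refine hg0 _ (Or.inl ?_)
        simp only [Complex.add_re, Complex.ofReal_re, Complex.mul_re, Complex.I_im, Complex.I_re,
          Complex.ofReal_im, mul_one, mul_zero, sub_zero, add_zero]
        simp only [mem_Ioc, not_and_or, not_lt, not_le] at hcon
        rcases hcon with h | h
        · linarith [neg_le_abs x]
        · exact h.le.trans (le_abs_self x)
      simp [this]
    · refine integral_congr_ae (Filter.Eventually.of_forall fun x => ?_)
      refine integral_congr_ae (Filter.Eventually.of_forall fun y => ?_)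
      simp [Complex.measurableEquivRealProd_symm_apply, Complex.mk_eq_add_mul_I]
  have : (fun z => fderiv ℝ w z 1 + Complex.I • fderiv ℝ w z Complex.I) =
      fun z => (-Complex.I) • g z := by
    ext z
    simp [hg, smul_smul, sub_eq_add_neg]
  rw [this, integral_smul, hgtot, smul_zero]

/-! ### Functions flat on the real axis -/

/-- The derivative in the imaginary direction. -/
noncomputable def vderiv (u : ℂ → ℂ) (z : ℂ) : ℂ := fderiv ℝ u z Complex.I

/-- The derivative in the real direction. -/
noncomputable def hderiv (u : ℂ → ℂ) (z : ℂ) : ℂ := fderiv ℝ u z 1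

theorem contDiff_fderiv_apply {u : ℂ → ℂ} (hu : ContDiff ℝ ∞ u) (v : ℂ) :
    ContDiff ℝ ∞ fun z => fderiv ℝ u z v :=
  (hu.fderiv_right (m := ∞) (by simp)).clm_apply contDiff_const

theorem contDiff_vderiv {u : ℂ → ℂ} (hu : ContDiff ℝ ∞ u) : ContDiff ℝ ∞ (vderiv u) :=
  contDiff_fderiv_apply hu _

theorem contDiff_hderiv {u : ℂ → ℂ} (hu : ContDiff ℝ ∞ u) : ContDiff ℝ ∞ (hderiv u) :=
  contDiff_fderiv_apply hu _

theorem contDiff_iterate_vderiv {u : ℂ → ℂ} (hu : ContDiff ℝ ∞ u) (k : ℕ) :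
    ContDiff ℝ ∞ (vderiv^[k] u) := by
  induction k generalizing u with
  | zero => exact hu
  | succ k ih => exact ih (contDiff_vderiv hu)

theorem contDiff_dbar {u : ℂ → ℂ} (hu : ContDiff ℝ ∞ u) : ContDiff ℝ ∞ (dbar u) :=
  contDiff_const.mul ((contDiff_hderiv hu).add (contDiff_const.mul (contDiff_vderiv hu)))

theorem vderiv_hderiv_comm {u : ℂ → ℂ} (hu : ContDiff ℝ ∞ u) :
    vderiv (hderiv u) = hderiv (vderiv u) := by
  ext z
  have hd : DifferentiableAt ℝ (fderiv ℝ u) z :=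
    (hu.fderiv_right (m := ∞) (by simp)).differentiable (by simp) z
  have hs : IsSymmSndFDerivAt ℝ u z :=
    hu.contDiffAt.isSymmSndFDerivAt (by
      rw [minSmoothness_of_isRCLikeNormedField]; exact WithTop.coe_le_coe.2 le_top)
  have h1 : ∀ a b : ℂ, fderiv ℝ (fun z => fderiv ℝ u z a) z b = fderiv ℝ (fderiv ℝ u) z b a := by
    intro a b
    rw [fderiv_clm_apply hd (differentiableAt_const a)]
    simp
  exact (h1 1 Complex.I).trans (Eq.trans (hs _ _) (h1 Complex.I 1).symm)

theorem iterate_vderiv_hderiv_comm {u : ℂ → ℂ} (hu : ContDiff ℝ ∞ u) (k : ℕ) :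
    vderiv^[k] (hderiv u) = hderiv (vderiv^[k] u) := by
  induction k generalizing u with
  | zero => rfl
  | succ k ih =>
    rw [Function.iterate_succ_apply, vderiv_hderiv_comm hu, ih (contDiff_vderiv hu)]
    rfl

theorem iterate_vderiv_add_smul {u v : ℂ → ℂ} (hu : ContDiff ℝ ∞ u) (hv : ContDiff ℝ ∞ v) (a b : ℂ)
    (k : ℕ) : vderiv^[k] (fun z => a * u z + b * v z) =
      fun z => a * (vderiv^[k] u) z + b * (vderiv^[k] v) z := by
  induction k generalizing u v with
  | zero => rfl
  | succ k ih =>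
    simp only [Function.iterate_succ_apply]
    rw [← ih (contDiff_vderiv hu) (contDiff_vderiv hv)]
    congr 1
    ext z
    have h1 := (hu.differentiable (by simp) z).const_mul a
    have h2 := (hv.differentiable (by simp) z).const_mul b
    simp only [vderiv]
    rw [fderiv_fun_add h1 h2, fderiv_const_mul (hu.differentiable (by simp) z),
      fderiv_const_mul (hv.differentiable (by simp) z)]
    simp

theorem hasDerivAt_vertical {u : ℂ → ℂ} (hu : ContDiff ℝ ∞ u) (x y : ℝ) :
    HasDerivAt (fun t : ℝ => u (x + t * Complex.I)) (vderiv u (x + y * Complex.I)) y := by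
  have h1 : HasDerivAt (fun t : ℝ => (x + t * Complex.I : ℂ)) Complex.I y := by
    simpa using ((Complex.ofRealCLM.hasDerivAt (x := y)).mul_const Complex.I).const_add (x : ℂ)
  exact (hu.differentiable (by simp) _).hasFDerivAt.comp_hasDerivAt y h1

theorem iteratedDeriv_vertical {u : ℂ → ℂ} (hu : ContDiff ℝ ∞ u) (x : ℝ) (k : ℕ) :
    iteratedDeriv k (fun t : ℝ => u (x + t * Complex.I)) =
      fun t : ℝ => (vderiv^[k] u) (x + t * Complex.I) := by
  induction k generalizing u with
  | zero => simp
  | succ k ih =>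
    rw [iteratedDeriv_succ', Function.iterate_succ_apply, ← ih (contDiff_vderiv hu)]
    congr 1
    ext y
    exact (hasDerivAt_vertical hu x y).deriv

theorem hderiv_eq_zero_of_real {u : ℂ → ℂ} (hu : ContDiff ℝ ∞ u) (h : ∀ x : ℝ, u x = 0) (x : ℝ) :
    hderiv u x = 0 := by
  have h1 : HasDerivAt (fun t : ℝ => u (t : ℂ)) (hderiv u x) x :=
    (hu.differentiable (by simp) _).hasFDerivAt.comp_hasDerivAt x
      Complex.ofRealCLM.hasDerivAt
  have h2 : HasDerivAt (fun t : ℝ => u (t : ℂ)) 0 x := by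
    simp only [h]; exact hasDerivAt_const x 0
  exact h1.unique h2

/-- Once the lower derivatives vanish, the Taylor polynomial of order `k` is a single monomial, and
g = O(t^N) with k < N forces that monomial to be o(t^k). -/
theorem iteratedDeriv_eq_zero_of_flat {g : ℝ → ℂ} (hg : ContDiff ℝ ∞ g) {N : ℕ} {C : ℝ}
    (h : ∀ t, ‖g t‖ ≤ C * |t| ^ N) (k : ℕ) (hk : k < N) : iteratedDeriv k g 0 = 0 := by
  induction k using Nat.strong_induction_on with
  | _ k ih =>
    have h1 := taylor_isLittleO_univ (f := g) (x₀ := 0) (n := k)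
      (hg.of_le (by exact_mod_cast le_top))
    have h2 : ∀ x, taylorWithinEval g k univ 0 x =
        (x ^ k * (k.factorial : ℝ)⁻¹) • iteratedDeriv k g 0 := by
      intro x
      rw [taylor_within_apply, Finset.sum_eq_single_of_mem k (by simp)]
      · simp [iteratedDerivWithin_univ, mul_comm]
      · intro j hj hjk
        have : j < k := by simp at hj; omega
        rw [iteratedDerivWithin_univ, ih j this (this.trans hk), smul_zero]
    have h3 : g =o[𝓝 0] fun x : ℝ => x ^ k := by
      have : g =O[𝓝 0] fun x : ℝ => x ^ N := by
        refine Asymptotics.IsBigO.of_bound C (Filter.Eventually.of_forall fun t => ?_)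
        simpa using h t
      exact this.trans_isLittleO (Asymptotics.isLittleO_pow_pow hk)
    simp only [sub_zero, h2] at h1
    have h4 := h3.sub h1
    simp only [sub_sub_cancel] at h4
    by_contra hne
    -- A nonzero coefficient would give x^k = o(x^k) at 0.
    have h5 : (fun x : ℝ => x ^ k) =o[𝓝 0] fun x : ℝ => x ^ k := by
      refine Asymptotics.IsBigO.trans_isLittleO ?_ h4
      refine Asymptotics.IsBigO.of_bound (k.factorial * ‖iteratedDeriv k g 0‖⁻¹)
        (Filter.Eventually.of_forall fun x => ?_)
      have : ‖iteratedDeriv k g 0‖ ≠ 0 := norm_ne_zero_iff.2 hne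
      rw [norm_smul, norm_mul, norm_inv]
      have h6 : (k.factorial : ℝ) ≠ 0 := by positivity
      simp only [Real.norm_natCast]
      field_simp
      exact le_rfl
    refine Asymptotics.isLittleO_irrefl' ?_ h5
    have h6 : ∃ᶠ x in 𝓝 (0 : ℝ), x ≠ 0 :=
      (Filter.Eventually.frequently self_mem_nhdsWithin : ∃ᶠ x in 𝓝[≠] (0 : ℝ),
        x ≠ 0).filter_mono nhdsWithin_le_nhds
    exact h6.mono fun x hx => by simpa using fun h => absurd h hx

/-- Since ∂_y u = i ∂ₓu - 2i ∂u/∂z̄, a vertical derivative can be traded for a horizontal one, which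
preserves vanishing on the axis, plus a derivative of the flat function ∂u/∂z̄. -/
theorem iterate_vderiv_eq_zero_of_flat {u : ℂ → ℂ} (hu : ContDiff ℝ ∞ u) (h0 : ∀ x : ℝ, u x = 0)
    {N : ℕ} {C : ℝ} (h : ∀ z, ‖dbar u z‖ ≤ C * |z.im| ^ N) (k : ℕ) (hk : k ≤ N) (x : ℝ) :
    (vderiv^[k] u) x = 0 := by
  induction k generalizing x with
  | zero => exact h0 x
  | succ k ih =>
    have e : vderiv u = fun z => Complex.I * hderiv u z + (-2 * Complex.I) * dbar u z := by
      ext z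
      simp only [dbar, vderiv, hderiv]
      linear_combination (fderiv ℝ u z Complex.I) * Complex.I_mul_I
    rw [Function.iterate_succ_apply, e,
      iterate_vderiv_add_smul (contDiff_hderiv hu) (contDiff_dbar hu),
      iterate_vderiv_hderiv_comm hu]
    dsimp only
    rw [hderiv_eq_zero_of_real (contDiff_iterate_vderiv hu k) (fun x => ih (by omega) x)]
    have h1 := congrFun (iteratedDeriv_vertical (contDiff_dbar hu) x k) 0
    rw [iteratedDeriv_eq_zero_of_flat (C := C) (N := N) ?_ ?_ k (by omega)] at h1
    · simp only [Complex.ofReal_zero, zero_mul, add_zero] at h1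
      simp [← h1]
    · refine (contDiff_dbar hu).comp ?_
      exact contDiff_const.add (Complex.ofRealCLM.contDiff.mul contDiff_const)
    · intro t
      simpa using h (x + t * Complex.I)

/-- Each application of the mean value inequality along a vertical segment from the axis gains one
factor |y|. The induction starts from mere boundedness. -/
theorem norm_le_of_iterate_vderiv_eq_zero {u : ℂ → ℂ} (hu : ContDiff ℝ ∞ u)
    (hc : HasCompactSupport u) {N : ℕ} (h : ∀ k ≤ N, ∀ x : ℝ, (vderiv^[k] u) x = 0) :
    ∃ C, 0 ≤ C ∧ ∀ z, ‖u z‖ ≤ C * |z.im| ^ N := by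
  induction N generalizing u with
  | zero =>
    obtain ⟨C, hC⟩ := hu.continuous.bounded_above_of_compact_support hc
    exact ⟨C, (norm_nonneg _).trans (hC 0), fun z => by simpa using hC z⟩
  | succ N ih =>
    obtain ⟨C, hC0, hC⟩ := ih (contDiff_vderiv hu) (hc.fderiv_apply ℝ Complex.I)
      (fun k hk x => by simpa using h (k + 1) (by omega) x)
    refine ⟨C, hC0, fun z => ?_⟩
    have h1 := Convex.norm_image_sub_le_of_norm_hasDerivWithin_le
      (f := fun t : ℝ => u (z.re + t * Complex.I)) (s := uIcc 0 z.im) (C := C * |z.im| ^ N)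
      (x := 0) (y := z.im)
      (fun t _ => (hasDerivAt_vertical hu z.re t).hasDerivWithinAt)
      (fun t ht => (hC _).trans ?_) (convex_uIcc _ _) left_mem_uIcc right_mem_uIcc
    · have h2 := h 0 (by omega) z.re
      simp only [Function.iterate_zero, id] at h2
      simp only [Complex.re_add_im, Complex.ofReal_zero, zero_mul, add_zero, h2, sub_zero,
        Real.norm_eq_abs] at h1
      rw [pow_succ, ← mul_assoc]
      exact h1
    · have : |t| ≤ |z.im| := by
        have := abs_sub_left_of_mem_uIcc ht
        simpa using this
      simp only [Complex.add_im, Complex.ofReal_im, Complex.mul_im, Complex.I_im, Complex.I_re,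
        Complex.ofReal_re, mul_one, mul_zero, zero_add, add_zero]
      gcongr

/-- A compactly supported smooth function that vanishes on the real axis and has
`∂u/∂z̄ = O(|y| ^ N)` is itself `O(|y| ^ N)`. -/
theorem norm_le_of_dbar_flat {u : ℂ → ℂ} (hu : ContDiff ℝ ∞ u) (hc : HasCompactSupport u)
    (h0 : ∀ x : ℝ, u x = 0) {N : ℕ} {C : ℝ} (h : ∀ z, ‖dbar u z‖ ≤ C * |z.im| ^ N) :
    ∃ C, 0 ≤ C ∧ ∀ z, ‖u z‖ ≤ C * |z.im| ^ N :=
  norm_le_of_iterate_vderiv_eq_zero hu hc fun k hk x =>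
    iterate_vderiv_eq_zero_of_flat hu h0 h k hk x

/-! ### Almost analytic extensions -/

/-- `G` is an almost analytic extension of `f` of order `N`. -/
structure IsExtension (f : ℝ → ℂ) (N : ℕ) (G : ℂ → ℂ) : Prop where
  smooth : ContDiff ℝ ∞ G
  compact : HasCompactSupport G
  eq : ∀ x : ℝ, G x = f x
  flat : ∃ C, ∀ z, ‖dbar G z‖ ≤ C * |z.im| ^ N

theorem dbar_sub {u v : ℂ → ℂ} {z : ℂ} (hu : DifferentiableAt ℝ u z)
    (hv : DifferentiableAt ℝ v z) :
    dbar (fun z => u z - v z) z = dbar u z - dbar v z := by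
  simp only [dbar, fderiv_fun_sub hu hv, sub_apply]
  ring

theorem dbar_add {u v : ℂ → ℂ} {z : ℂ} (hu : DifferentiableAt ℝ u z)
    (hv : DifferentiableAt ℝ v z) :
    dbar (fun z => u z + v z) z = dbar u z + dbar v z := by
  simp only [dbar, fderiv_fun_add hu hv, add_apply]
  ring

theorem dbar_const_mul {u : ℂ → ℂ} {z : ℂ} (hu : DifferentiableAt ℝ u z) (a : ℂ) :
    dbar (fun z => a * u z) z = a * dbar u z := by
  simp only [dbar, fderiv_const_mul hu, smul_apply, smul_eq_mul]
  ring

theorem dbar_mul {u v : ℂ → ℂ} {z : ℂ} (hu : DifferentiableAt ℝ u z)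
    (hv : DifferentiableAt ℝ v z) :
    dbar (fun z => u z * v z) z = dbar u z * v z + u z * dbar v z := by
  simp only [dbar, fderiv_fun_mul hu hv, add_apply, smul_apply, smul_eq_mul]
  ring

theorem dbar_eq_zero_of_notMem_tsupport {u : ℂ → ℂ} {z : ℂ} (h : z ∉ tsupport u) :
    dbar u z = 0 := by
  have : fderiv ℝ u z = 0 :=
    image_eq_zero_of_notMem_tsupport fun h' => h (tsupport_fderiv_subset ℝ h')
  simp [dbar, this]

/-- On the compact support the surplus powers of |y| are bounded; off it ∂G/∂z̄ vanishes. -/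
theorem IsExtension.mono {f : ℝ → ℂ} {N M : ℕ} {G : ℂ → ℂ} (h : IsExtension f N G) (hM : M ≤ N) :
    IsExtension f M G where
  smooth := h.smooth
  compact := h.compact
  eq := h.eq
  flat := by
    obtain ⟨C, hC⟩ := h.flat
    obtain ⟨R, hR⟩ := h.compact.isCompact.isBounded.subset_closedBall (0 : ℂ)
    refine ⟨|C| * |R| ^ (N - M), fun z => ?_⟩
    by_cases hz : z ∈ tsupport G
    · have h1 := hR hz
      rw [mem_closedBall_zero_iff] at h1
      have h2 : |z.im| ≤ |R| := (Complex.abs_im_le_norm z).trans (h1.trans (le_abs_self R))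
      calc ‖dbar G z‖ ≤ C * |z.im| ^ N := hC z
        _ ≤ |C| * |z.im| ^ N := by gcongr; exact le_abs_self C
        _ = |C| * |z.im| ^ (N - M) * |z.im| ^ M := by
            rw [mul_assoc, ← pow_add, Nat.sub_add_cancel hM]
        _ ≤ _ := by gcongr
    · rw [dbar_eq_zero_of_notMem_tsupport hz, norm_zero]
      positivity

theorem IsExtension.sub {f g : ℝ → ℂ} {N : ℕ} {G₁ G₂ : ℂ → ℂ} (h₁ : IsExtension f N G₁)
    (h₂ : IsExtension g N G₂) : IsExtension (fun x => f x - g x) N (fun z => G₁ z - G₂ z) where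
  smooth := h₁.smooth.sub h₂.smooth
  compact := h₁.compact.sub h₂.compact
  eq x := by rw [h₁.eq, h₂.eq]
  flat := by
    obtain ⟨C, hC⟩ := h₁.flat
    obtain ⟨D, hD⟩ := h₂.flat
    refine ⟨C + D, fun z => ?_⟩
    rw [dbar_sub (h₁.smooth.differentiable (by simp) z) (h₂.smooth.differentiable (by simp) z),
      add_mul]
    exact (norm_sub_le _ _).trans (add_le_add (hC z) (hD z))

theorem ae_im_ne_zero : ∀ᵐ z : ℂ, z.im ≠ 0 := by
  have hmp := Complex.volume_preserving_equiv_real_prod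
  have h : ∀ᵐ p : ℝ × ℝ, p.2 ≠ 0 := by
    have h1 : ∀ᵐ y : ℝ, y ≠ 0 := by simp [ae_iff]
    exact Measure.quasiMeasurePreserving_snd.ae h1
  exact hmp.quasiMeasurePreserving.ae h

theorem isOpen_im_ne_zero : IsOpen {z : ℂ | z.im ≠ 0} :=
  isOpen_ne_fun Complex.continuous_im continuous_const

/-! ### Extensions paired with holomorphic functions of polynomial growth at the real axis -/

section Invariance

variable {F : Type*} [NormedAddCommGroup F] [NormedSpace ℂ F] {A : ℂ → F} {G G₁ G₂ : ℂ → ℂ}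
  {f : ℝ → ℂ} {N n : ℕ}

/-- On the support of `G` and off the real axis, `A` is holomorphic and `O(|y| ^ (-n))`. -/
structure IsTempered (A : ℂ → F) (n : ℕ) (S : Set ℂ) : Prop where
  differentiableAt : ∀ z ∈ S, z.im ≠ 0 → DifferentiableAt ℂ A z
  bound : ∃ B, ∀ z ∈ S, z.im ≠ 0 → ‖A z‖ * |z.im| ^ n ≤ B

theorem IsTempered.mono {S T : Set ℂ} (h : IsTempered A n S) (hT : T ⊆ S) : IsTempered A n T where
  differentiableAt z hz := h.differentiableAt z (hT hz)
  bound := h.bound.imp fun _ hB z hz => hB z (hT hz)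

theorem IsTempered.union {S T : Set ℂ} (h : IsTempered A n S) (h' : IsTempered A n T) :
    IsTempered A n (S ∪ T) where
  differentiableAt z hz := hz.elim (h.differentiableAt z) (h'.differentiableAt z)
  bound := by
    obtain ⟨B, hB⟩ := h.bound
    obtain ⟨B', hB'⟩ := h'.bound
    exact ⟨max B B', fun z hz hi => hz.elim (fun hz => (hB z hz hi).trans (le_max_left _ _))
      fun hz => (hB' z hz hi).trans (le_max_right _ _)⟩

/-- The values of `A` on the real axis are arbitrary, but the axis is a null set and the product is
continuous off it. -/
theorem aestronglyMeasurable_dbar_smul (hG : ContDiff ℝ ∞ G)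
    (hA : ∀ z ∈ tsupport G, z.im ≠ 0 → DifferentiableAt ℂ A z) :
    AEStronglyMeasurable fun z => dbar G z • A z := by
  have hc : ContinuousOn (fun z => dbar G z • A z) {z : ℂ | z.im ≠ 0} := by
    intro z hz
    refine ContinuousAt.continuousWithinAt ?_
    by_cases h : z ∈ tsupport G
    · exact (contDiff_dbar hG).continuous.continuousAt.smul (hA z h hz).continuousAt
    · have : (fun z => dbar G z • A z) =ᶠ[𝓝 z] fun _ => 0 := by
        filter_upwards [(isClosed_tsupport G).isOpen_compl.mem_nhds h] with w hw
        rw [dbar_eq_zero_of_notMem_tsupport hw, zero_smul]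
      exact continuousAt_const.congr this.symm
  have h1 := hc.aestronglyMeasurable (μ := volume) isOpen_im_ne_zero.measurableSet
  rwa [Measure.restrict_eq_self_of_ae_mem (by exact ae_im_ne_zero)] at h1

/-- The order of flatness of ∂G/∂z̄ compensates the blow-up of `A`, leaving a bounded function with
compact support. -/
theorem IsExtension.integrable (hG : IsExtension f N G) (hA : IsTempered A n (tsupport G))
    (hN : n ≤ N) : Integrable fun z => dbar G z • A z := by
  obtain ⟨C, hC⟩ := (hG.mono hN).flat
  obtain ⟨B, hB⟩ := hA.bound
  have hm := aestronglyMeasurable_dbar_smul hG.smooth hA.differentiableAt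
  have hb : Integrable (indicator (tsupport G) fun _ : ℂ => |C| * |B|) :=
    (integrable_indicator_iff (isClosed_tsupport G).measurableSet).2
      (integrableOn_const hG.compact.isCompact.measure_lt_top.ne)
  refine hb.mono' hm ?_
  filter_upwards [ae_im_ne_zero] with z hz
  by_cases h : z ∈ tsupport G
  · rw [indicator_of_mem h, norm_smul]
    calc ‖dbar G z‖ * ‖A z‖ ≤ (C * |z.im| ^ n) * ‖A z‖ := by gcongr; exact hC z
      _ = C * (‖A z‖ * |z.im| ^ n) := by ring
      _ ≤ |C| * (‖A z‖ * |z.im| ^ n) := by gcongr; exact le_abs_self C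
      _ ≤ |C| * |B| := by gcongr; exact (hB z h hz).trans (le_abs_self B)
  · rw [indicator_of_notMem h, dbar_eq_zero_of_notMem_tsupport h, zero_smul, norm_zero]

/-- By the Cauchy–Riemann equations for `A` only `u` is differentiated; the 2 undoes the factor 1/2
in `dbar`. -/
theorem fderiv_smul_dbar {u : ℂ → ℂ} {z : ℂ} (hu : DifferentiableAt ℝ u z)
    (hA : DifferentiableAt ℂ A z) :
    fderiv ℝ (fun z => u z • A z) z 1 +
      Complex.I • fderiv ℝ (fun z => u z • A z) z Complex.I = (2 : ℂ) • dbar u z • A z := by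
  have h1 : HasFDerivAt A ((fderiv ℂ A z).restrictScalars ℝ) z := hA.hasFDerivAt.restrictScalars ℝ
  have h2 : fderiv ℝ (fun z => u z • A z) z = _ := (hu.hasFDerivAt.smul h1).fderiv
  have h3 : fderiv ℂ A z Complex.I = Complex.I • fderiv ℂ A z 1 := by
    rw [← map_smul, smul_eq_mul, mul_one]
  rw [h2]
  simp only [add_apply, smul_apply, ContinuousLinearMap.smulRight_apply,
    ContinuousLinearMap.coe_restrictScalars', h3, dbar]
  match_scalars
  · linear_combination (u z) * Complex.I_mul_I
  · ring

/-- Green's formula for a product of a function flat on the real axis and a holomorphic function of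
polynomial growth at the real axis. -/
theorem integral_dbar_smul_eq_zero_of_flat [CompleteSpace F] (hG : IsExtension (fun _ => 0) N G)
    (hA : IsTempered A n (tsupport G)) (hN : n + 2 ≤ N) : ∫ z, dbar G z • A z = 0 := by
  classical
  obtain ⟨C₀, hC₀⟩ := (hG.mono hN).flat
  obtain ⟨C, hC0, hC⟩ := norm_le_of_dbar_flat hG.smooth hG.compact hG.eq hC₀
  obtain ⟨B, hB⟩ := hA.bound
  -- Setting the second factor to 0 on the axis discards its arbitrary values there. Since `G`
  -- itself is O(|y|^(n+2)), the product `w` is O(|y|²), hence differentiable with derivative 0 at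
  -- real points.
  set A' : ℂ → F := fun z => if z.im = 0 then 0 else A z with hA'
  set w : ℂ → F := fun z => G z • A' z with hw
  have hAA' : ∀ z : ℂ, z.im ≠ 0 → A' =ᶠ[𝓝 z] A := fun z hz => by
    filter_upwards [isOpen_im_ne_zero.mem_nhds hz] with y hy
    simp [hA', show y.im ≠ 0 from hy]
  have hwb : ∀ z, ‖w z‖ ≤ C * |B| * |z.im| ^ 2 := by
    intro z
    by_cases hz : z.im = 0
    · simp [hw, hA', hz]
    by_cases h : z ∈ tsupport G
    · simp only [hw, hA', hz, if_false, norm_smul]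
      calc ‖G z‖ * ‖A z‖ ≤ (C * |z.im| ^ (n + 2)) * ‖A z‖ := by gcongr; exact hC z
        _ = C * (‖A z‖ * |z.im| ^ n) * |z.im| ^ 2 := by ring
        _ ≤ C * |B| * |z.im| ^ 2 := by gcongr; exact (hB z h hz).trans (le_abs_self B)
    · simp only [hw, image_eq_zero_of_notMem_tsupport h, zero_smul, norm_zero]
      positivity
  have hdiffA : ∀ z ∈ tsupport G, z.im ≠ 0 → DifferentiableAt ℂ A' z := fun z h hz =>
    (hA.differentiableAt z h hz).congr_of_eventuallyEq (hAA' z hz)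
  have hw0 : ∀ z, z ∉ tsupport G → w =ᶠ[𝓝 z] fun _ => 0 := fun z h => by
    filter_upwards [(isClosed_tsupport G).isOpen_compl.mem_nhds h] with y hy
    simp [hw, image_eq_zero_of_notMem_tsupport hy]
  have hd : Differentiable ℝ w := by
    intro z
    by_cases hz : z.im = 0
    · have : HasFDerivAt w (0 : ℂ →L[ℝ] F) z := by
        rw [hasFDerivAt_iff_isLittleO]
        have h0 : w z = 0 := by simp [hw, hA', hz]
        simp only [h0, sub_zero, zero_apply]
        have h1 : w =O[𝓝 z] fun y => ‖y - z‖ ^ 2 := by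
          refine Asymptotics.IsBigO.of_bound (C * |B|) (Filter.Eventually.of_forall fun y => ?_)
          refine (hwb y).trans ?_
          have h2 : |y.im| ≤ ‖y - z‖ := by
            have := Complex.abs_im_le_norm (y - z)
            rwa [Complex.sub_im, hz, sub_zero] at this
          rw [norm_pow, norm_norm]
          gcongr
        refine h1.trans_isLittleO ?_
        have h3 : (fun y => ‖y - z‖ ^ 2) =o[𝓝 z] fun y => ‖y - z‖ ^ 1 := by
          have h4 : Filter.Tendsto (fun y => ‖y - z‖) (𝓝 z) (𝓝 0) := by
            have : Continuous fun y => ‖y - z‖ := by fun_prop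
            simpa using this.tendsto z
          exact (Asymptotics.isLittleO_pow_pow (𝕜 := ℝ) one_lt_two).comp_tendsto h4
        simpa using h3
      exact this.differentiableAt
    by_cases h : z ∈ tsupport G
    · exact (hG.smooth.differentiable (by simp) z).smul ((hdiffA z h hz).restrictScalars ℝ)
    · exact (differentiableAt_const (0 : F)).congr_of_eventuallyEq (hw0 z h)
  have hcs : HasCompactSupport w := hG.compact.smul_right
  have hae : (fun z => fderiv ℝ w z 1 + Complex.I • fderiv ℝ w z Complex.I) =ᵐ[volume]
      fun z => (2 : ℂ) • dbar G z • A z := by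
    filter_upwards [ae_im_ne_zero] with z hz
    by_cases h : z ∈ tsupport G
    · rw [fderiv_smul_dbar (hG.smooth.differentiable (by simp) z) (hdiffA z h hz),
        (hAA' z hz).eq_of_nhds]
    · rw [(hw0 z h).fderiv_eq, dbar_eq_zero_of_notMem_tsupport h]
      simp
  have hi := (hG.integrable hA (by omega)).smul (2 : ℂ)
  have := integral_dbar_eq_zero hd hcs (hi.congr hae.symm)
  rw [integral_congr_ae hae, integral_smul] at this
  simpa using this

/-- Green's formula for a product with a holomorphic function. -/
theorem integral_dbar_smul_eq_zero_of_differentiableAt [CompleteSpace F] (hG : ContDiff ℝ ∞ G)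
    (hc : HasCompactSupport G) (hA : ∀ z ∈ tsupport G, DifferentiableAt ℂ A z) :
    ∫ z, dbar G z • A z = 0 := by
  have hw0 : ∀ z, z ∉ tsupport G → (fun z => G z • A z) =ᶠ[𝓝 z] fun _ => 0 := fun z h => by
    filter_upwards [(isClosed_tsupport G).isOpen_compl.mem_nhds h] with y hy
    simp [image_eq_zero_of_notMem_tsupport hy]
  have hd : Differentiable ℝ fun z => G z • A z := by
    intro z
    by_cases h : z ∈ tsupport G
    · exact (hG.differentiable (by simp) z).smul ((hA z h).restrictScalars ℝ)
    · exact (differentiableAt_const (0 : F)).congr_of_eventuallyEq (hw0 z h)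
  have he : (fun z => fderiv ℝ (fun z => G z • A z) z 1 +
      Complex.I • fderiv ℝ (fun z => G z • A z) z Complex.I) =
      fun z => (2 : ℂ) • dbar G z • A z := by
    ext z
    by_cases h : z ∈ tsupport G
    · exact fderiv_smul_dbar (hG.differentiable (by simp) z) (hA z h)
    · rw [(hw0 z h).fderiv_eq, dbar_eq_zero_of_notMem_tsupport h]
      simp
  have hcont : Continuous fun z => dbar G z • A z := by
    rw [continuous_iff_continuousAt]
    intro z
    by_cases h : z ∈ tsupport G
    · exact (contDiff_dbar hG).continuous.continuousAt.smul (hA z h).continuousAt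
    · refine (continuousAt_const (y := (0 : F))).congr ?_
      filter_upwards [(isClosed_tsupport G).isOpen_compl.mem_nhds h] with y hy
      rw [dbar_eq_zero_of_notMem_tsupport hy, zero_smul]
  have hcs : HasCompactSupport fun z => dbar G z • A z := by
    refine HasCompactSupport.intro hc.isCompact fun z hz => ?_
    rw [dbar_eq_zero_of_notMem_tsupport hz, zero_smul]
  have := integral_dbar_eq_zero hd hc.smul_right
    (by rw [he]; exact (hcont.integrable_of_hasCompactSupport hcs).smul (2 : ℂ))
  rw [he, integral_smul] at this
  simpa using this

theorem tsupport_fun_sub_subset : tsupport (fun z => G₁ z - G₂ z) ⊆ tsupport G₁ ∪ tsupport G₂ := by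
  refine closure_minimal (fun z hz => ?_) ((isClosed_tsupport G₁).union (isClosed_tsupport G₂))
  by_contra h
  simp only [mem_union, not_or] at h
  exact hz (by
    simp [image_eq_zero_of_notMem_tsupport h.1, image_eq_zero_of_notMem_tsupport h.2])

/-- The difference of two extensions of `f` is an extension of 0, to which Green's formula for flat
functions applies. -/
theorem IsExtension.integral_eq [CompleteSpace F] (h₁ : IsExtension f N G₁)
    (h₂ : IsExtension f N G₂) (hA₁ : IsTempered A n (tsupport G₁))
    (hA₂ : IsTempered A n (tsupport G₂)) (hN : n + 2 ≤ N) :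
    ∫ z, dbar G₁ z • A z = ∫ z, dbar G₂ z • A z := by
  have h := h₁.sub h₂
  simp only [sub_self] at h
  have h0 := integral_dbar_smul_eq_zero_of_flat h
    ((hA₁.union hA₂).mono tsupport_fun_sub_subset) hN
  rw [← sub_eq_zero, ← integral_sub (h₁.integrable hA₁ (by omega)) (h₂.integrable hA₂ (by omega)),
    ← h0]
  refine integral_congr_ae (Filter.Eventually.of_forall fun z => ?_)
  dsimp only
  rw [dbar_sub (h₁.smooth.differentiable (by simp) z) (h₂.smooth.differentiable (by simp) z),
    sub_smul]

end Invariance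

end SSF

namespace SSF

/-! ### The extension `almostAnalyticExtension` -/

theorem japaneseBracket_pos (x : ℝ) : 0 < japaneseBracket x := Real.sqrt_pos.2 (by positivity)

theorem one_le_japaneseBracket (x : ℝ) : 1 ≤ japaneseBracket x :=
  Real.one_le_sqrt.2 (by nlinarith [sq_nonneg x])

theorem contDiff_japaneseBracket : ContDiff ℝ ∞ japaneseBracket := by
  refine ContDiff.sqrt (by fun_prop) fun x => ?_
  positivity

theorem contDiff_re : ContDiff ℝ ∞ Complex.re := Complex.reCLM.contDiff

theorem contDiff_im : ContDiff ℝ ∞ Complex.im := Complex.imCLM.contDiff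

/-- The Taylor polynomial in the imaginary direction. -/
noncomputable def taylorExt (f : ℝ → ℂ) (N : ℕ) (z : ℂ) : ℂ :=
  ∑ k ∈ Finset.range (N + 1),
    iteratedDeriv k f z.re / (k.factorial : ℂ) * (Complex.I * (z.im : ℂ)) ^ k

/-- The cut-off in the imaginary direction. -/
noncomputable def cutoff (τ : ℝ → ℂ) (z : ℂ) : ℂ := τ (z.im / japaneseBracket z.re)

theorem almostAnalyticExtension_eq (f : ℝ → ℂ) (N : ℕ) (τ : ℝ → ℂ) :
    almostAnalyticExtension f N τ = fun z => taylorExt f N z * cutoff τ z := rfl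

theorem contDiff_iteratedDeriv {f : ℝ → ℂ} (hf : ContDiff ℝ ∞ f) (k : ℕ) :
    ContDiff ℝ ∞ (iteratedDeriv k f) := by
  induction k with
  | zero => simpa using hf
  | succ k ih => rw [iteratedDeriv_succ]; exact (contDiff_infty_iff_deriv.1 ih).2

theorem contDiff_taylorTerm {f : ℝ → ℂ} (hf : ContDiff ℝ ∞ f) (k : ℕ) :
    ContDiff ℝ ∞ fun z : ℂ =>
      iteratedDeriv k f z.re / (k.factorial : ℂ) * (Complex.I * (z.im : ℂ)) ^ k := by
  have h1 := (contDiff_iteratedDeriv hf k).comp contDiff_re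
  have h2 : ContDiff ℝ ∞ fun z : ℂ => (z.im : ℂ) := Complex.ofRealCLM.contDiff.comp contDiff_im
  exact (h1.div_const _).mul ((contDiff_const.mul h2).pow k)

theorem contDiff_taylorExt {f : ℝ → ℂ} (hf : ContDiff ℝ ∞ f) (N : ℕ) :
    ContDiff ℝ ∞ (taylorExt f N) :=
  ContDiff.sum fun k _ => contDiff_taylorTerm hf k

theorem contDiff_cutoff {τ : ℝ → ℂ} (hτ : ContDiff ℝ ∞ τ) : ContDiff ℝ ∞ (cutoff τ) :=
  hτ.comp (contDiff_im.div (contDiff_japaneseBracket.comp contDiff_re)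
    fun z => (japaneseBracket_pos z.re).ne')

theorem dbar_taylorTerm {f : ℝ → ℂ} (hf : ContDiff ℝ ∞ f) (k : ℕ) (z : ℂ) :
    dbar (fun z : ℂ => iteratedDeriv k f z.re / (k.factorial : ℂ) *
      (Complex.I * (z.im : ℂ)) ^ k) z =
    (1 / 2) * (iteratedDeriv (k + 1) f z.re / (k.factorial : ℂ) * (Complex.I * (z.im : ℂ)) ^ k -
      iteratedDeriv k f z.re / (k.factorial : ℂ) *
        (k * (Complex.I * (z.im : ℂ)) ^ (k - 1))) := by
  have h1 : HasFDerivAt (fun z : ℂ => iteratedDeriv k f z.re)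
      (Complex.reCLM.smulRight (iteratedDeriv (k + 1) f z.re)) z := by
    have h := ((contDiff_iteratedDeriv hf k).differentiable (by simp) z.re).hasDerivAt
    rw [← iteratedDeriv_succ] at h
    exact (h.hasFDerivAt.comp z Complex.reCLM.hasFDerivAt).congr_fderiv (by ext; simp)
  have h2 : HasFDerivAt (fun z : ℂ => (Complex.I * (z.im : ℂ)))
      (Complex.imCLM.smulRight Complex.I) z := by
    have := (Complex.ofRealCLM.comp Complex.imCLM).hasFDerivAt (x := z)
    exact (this.const_mul Complex.I).congr_fderiv (by ext; simp; ring)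
  have h3 := ((h1.mul_const ((k.factorial : ℂ)⁻¹)).mul (h2.pow k)).fderiv
  have e : (fun z : ℂ => iteratedDeriv k f z.re / (k.factorial : ℂ) *
      (Complex.I * (z.im : ℂ)) ^ k) = fun z : ℂ => iteratedDeriv k f z.re * (k.factorial : ℂ)⁻¹ *
      (Complex.I * (z.im : ℂ)) ^ k := by simp [div_eq_mul_inv]
  rw [dbar, e]
  erw [h3]
  simp only [add_apply, smul_apply, ContinuousLinearMap.smulRight_apply,
    Complex.reCLM_apply, Complex.imCLM_apply, Complex.one_re, Complex.one_im, Complex.I_re,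
    Complex.I_im, zero_smul, one_smul, smul_eq_mul, nsmul_eq_mul, mul_zero, zero_add, add_zero,
    div_eq_mul_inv, one_mul]
  linear_combination (1 / 2) * (iteratedDeriv k f z.re * (↑k.factorial)⁻¹ *
    (↑k * (Complex.I * ↑z.im) ^ (k - 1))) * Complex.I_mul_I

theorem dbar_sum {ι : Type*} (s : Finset ι) {u : ι → ℂ → ℂ} {z : ℂ}
    (hu : ∀ i ∈ s, DifferentiableAt ℝ (u i) z) :
    dbar (fun z => ∑ i ∈ s, u i z) z = ∑ i ∈ s, dbar (u i) z := by
  simp only [dbar, fderiv_fun_sum hu, sum_apply, Finset.mul_sum, Finset.sum_add_distrib, mul_add]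

/-- The sum telescopes: the y-derivative of each term cancels the x-derivative of the preceding one,
and only the x-derivative of the last term survives. -/
theorem dbar_taylorExt {f : ℝ → ℂ} (hf : ContDiff ℝ ∞ f) (N : ℕ) (z : ℂ) :
    dbar (taylorExt f N) z =
      (1 / 2) * (iteratedDeriv (N + 1) f z.re / (N.factorial : ℂ) *
        (Complex.I * (z.im : ℂ)) ^ N) := by
  unfold taylorExt
  rw [dbar_sum _ fun k _ => (contDiff_taylorTerm hf k).differentiable (by simp) z]
  simp only [dbar_taylorTerm hf]
  rw [← Finset.mul_sum]
  congr 1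
  induction N with
  | zero => simp
  | succ N ih =>
    rw [Finset.sum_range_succ, ih]
    have : ((N + 1).factorial : ℂ) = (N + 1) * N.factorial := by
      rw [Nat.factorial_succ]; push_cast; ring
    have h1 : (N.factorial : ℂ) ≠ 0 := by exact_mod_cast N.factorial_ne_zero
    have h2 : (N + 1 : ℂ) ≠ 0 := by exact_mod_cast N.succ_ne_zero
    rw [this]
    push_cast
    field_simp
    ring

theorem tsupport_almostAnalyticExtension_subset (f : ℝ → ℂ) (N : ℕ) (τ : ℝ → ℂ) :
    tsupport (almostAnalyticExtension f N τ) ⊆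
      {z | z.re ∈ tsupport f ∧ z.im / japaneseBracket z.re ∈ tsupport τ} := by
  have hc : Continuous fun z : ℂ => z.im / japaneseBracket z.re :=
    Complex.continuous_im.div₀ (contDiff_japaneseBracket.continuous.comp Complex.continuous_re)
      fun z => (japaneseBracket_pos z.re).ne'
  refine closure_minimal (fun z hz => ?_) (((isClosed_tsupport f).preimage
    Complex.continuous_re).inter ((isClosed_tsupport τ).preimage hc))
  rw [Function.mem_support, almostAnalyticExtension_eq] at hz
  constructor
  · by_contra h
    refine hz ?_
    have h1 : ∀ k, iteratedDeriv k f z.re = 0 := fun k =>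
      image_eq_zero_of_notMem_tsupport fun h' => h (by
        have := tsupport_iteratedFDeriv_subset (𝕜 := ℝ) (f := f) k
        refine this (closure_mono (fun x hx => ?_) h')
        rw [Function.mem_support] at hx ⊢
        contrapose! hx
        rw [iteratedDeriv, hx, zero_apply])
    simp [taylorExt, h1]
  · by_contra h
    refine hz ?_
    simp [cutoff, image_eq_zero_of_notMem_tsupport h]

theorem exists_bound_japaneseBracket {K : Set ℝ} (hK : IsCompact K) :
    ∃ b, 1 ≤ b ∧ ∀ x ∈ K, japaneseBracket x ≤ b := by
  obtain ⟨b, hb⟩ := hK.exists_bound_of_continuousOn contDiff_japaneseBracket.continuous.continuousOn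
  exact ⟨max 1 b, le_max_left _ _, fun x hx =>
    (le_abs_self _).trans ((hb x hx).trans (le_max_right _ _))⟩

theorem exists_compact_cutoff {K : Set ℝ} (hK : IsCompact K) {τ : ℝ → ℂ}
    (hτ : HasCompactSupport τ) :
    ∃ S : Set ℂ, IsCompact S ∧ ∀ z : ℂ, z.re ∈ K → z.im / japaneseBracket z.re ∈ tsupport τ →
      z ∈ S := by
  obtain ⟨b, hb1, hb⟩ := exists_bound_japaneseBracket hK
  obtain ⟨r, hr⟩ := hτ.isCompact.isBounded.subset_closedBall (0 : ℝ)
  refine ⟨K ×ℂ Icc (-(|r| * b)) (|r| * b), hK.reProdIm isCompact_Icc, fun z hz h => ⟨hz, ?_⟩⟩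
  have h1 := hr h
  rw [mem_closedBall_zero_iff, Real.norm_eq_abs, abs_div, abs_of_pos (japaneseBracket_pos _),
    div_le_iff₀ (japaneseBracket_pos _)] at h1
  refine abs_le.1 (h1.trans ?_)
  exact mul_le_mul (le_abs_self r) (hb _ hz) (japaneseBracket_pos _).le (abs_nonneg r)

theorem hasCompactSupport_almostAnalyticExtension {f : ℝ → ℂ} (hf : HasCompactSupport f) (N : ℕ)
    {τ : ℝ → ℂ} (hτ : HasCompactSupport τ) :
    HasCompactSupport (almostAnalyticExtension f N τ) := by
  obtain ⟨S, hS, h⟩ := exists_compact_cutoff hf.isCompact hτ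
  exact hS.of_isClosed_subset (isClosed_tsupport _) fun z hz =>
    h z (tsupport_almostAnalyticExtension_subset f N τ hz).1
      (tsupport_almostAnalyticExtension_subset f N τ hz).2

theorem contDiff_almostAnalyticExtension {f : ℝ → ℂ} (hf : ContDiff ℝ ∞ f) (N : ℕ) {τ : ℝ → ℂ}
    (hτ : ContDiff ℝ ∞ τ) : ContDiff ℝ ∞ (almostAnalyticExtension f N τ) :=
  (contDiff_taylorExt hf N).mul (contDiff_cutoff hτ)

/-- The constant depends on `f` only through `K`; this uniformity later yields continuity on test
functions. By the product rule one term carries the flat ∂/∂z̄ of the Taylor sum. The other carries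
∂/∂z̄ of the cut-off, which vanishes near the axis and is thus trivially O(|y|^N). -/
theorem exists_dbar_bound {K : Set ℝ} (hK : IsCompact K) (N : ℕ) {τ : ℝ → ℂ}
    (hτ : ContDiff ℝ ∞ τ) (hτc : HasCompactSupport τ) (hτ1 : ∀ᶠ s in 𝓝 (0 : ℝ), τ s = 1) :
    ∃ C, 0 ≤ C ∧ ∀ f : ℝ → ℂ, ContDiff ℝ ∞ f → tsupport f ⊆ K → ∀ B,
      (∀ k ≤ N + 1, ∀ x, ‖iteratedDeriv k f x‖ ≤ B) →
      ∀ z, ‖dbar (almostAnalyticExtension f N τ) z‖ ≤ C * B * |z.im| ^ N := by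
  obtain ⟨S, hS, hSK⟩ := exists_compact_cutoff hK hτc
  obtain ⟨D, hD⟩ := hS.exists_bound_of_continuousOn
    (contDiff_dbar (contDiff_cutoff hτ)).continuous.continuousOn
  obtain ⟨t, ht⟩ := hτ.continuous.bounded_above_of_compact_support hτc
  obtain ⟨M, hM⟩ := hS.exists_bound_of_continuousOn Complex.continuous_im.continuousOn
  obtain ⟨ε, hε, hετ⟩ := Metric.eventually_nhds_iff.1 hτ1
  have ht0 : 0 ≤ t := (norm_nonneg _).trans (ht 0)
  -- `t` bounds τ, `D` bounds ∂/∂z̄ of the cut-off, 1 + |M| bounds |y| on the support, and τ = 1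
  -- within distance `ε` of 0.
  refine ⟨t + (N + 1) * (1 + |M|) ^ N * |D| * (ε ^ N)⁻¹, by positivity, ?_⟩
  intro f hf hfK B hB z
  have hB0 : 0 ≤ B := (norm_nonneg _).trans (hB 0 (by omega) 0)
  by_cases hz : z ∈ tsupport (almostAnalyticExtension f N τ)
  swap
  · rw [dbar_eq_zero_of_notMem_tsupport hz, norm_zero]
    positivity
  obtain ⟨hz1, hz2⟩ := tsupport_almostAnalyticExtension_subset f N τ hz
  have hzS := hSK z (hfK hz1) hz2
  have hterm : ∀ k j, j ≤ N + 1 → ‖iteratedDeriv j f z.re / (k.factorial : ℂ) *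
      (Complex.I * (z.im : ℂ)) ^ k‖ ≤ B * |z.im| ^ k := by
    intro k j hj
    rw [norm_mul, norm_div, norm_pow, norm_mul, Complex.norm_I, one_mul, Complex.norm_real,
      Real.norm_eq_abs, Complex.norm_natCast]
    gcongr
    exact (div_le_self (norm_nonneg _) (by exact_mod_cast k.factorial_pos)).trans (hB j hj _)
  have h1 : ‖dbar (taylorExt f N) z‖ ≤ B * |z.im| ^ N := by
    rw [dbar_taylorExt hf, norm_mul]
    have := hterm N (N + 1) le_rfl
    have h2 : ‖(1 / 2 : ℂ)‖ ≤ 1 := by norm_num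
    exact (mul_le_of_le_one_left (norm_nonneg _) h2).trans this
  have hMi : |z.im| ≤ 1 + |M| := (hM z hzS).trans (by linarith [le_abs_self M])
  have h2 : ‖taylorExt f N z‖ ≤ (N + 1) * (1 + |M|) ^ N * B := by
    refine (norm_sum_le _ _).trans ?_
    refine (Finset.sum_le_card_nsmul _ _ (B * (1 + |M|) ^ N) fun k hk => ?_).trans ?_
    · have hk : k ≤ N := by simp at hk; omega
      refine (hterm k k (by omega)).trans ?_
      gcongr
      calc |z.im| ^ k ≤ (1 + |M|) ^ k := by gcongr
        _ ≤ (1 + |M|) ^ N := pow_le_pow_right₀ (by linarith [abs_nonneg M]) hk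
    · rw [Finset.card_range, nsmul_eq_mul]
      push_cast
      apply le_of_eq
      ring
  have h3 : ‖dbar (cutoff τ) z‖ ≤ |D| * (ε ^ N)⁻¹ * |z.im| ^ N := by
    by_cases hy : |z.im| < ε
    · have : dbar (cutoff τ) z = 0 := by
        -- Since ⟨x⟩ ≥ 1, |y| < ε already puts y/⟨x⟩ in the region where τ = 1.
        have he : cutoff τ =ᶠ[𝓝 z] fun _ => 1 := by
          have : {w : ℂ | |w.im| < ε} ∈ 𝓝 z :=
            (isOpen_lt (Complex.continuous_im.abs) continuous_const).mem_nhds hy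
          filter_upwards [this] with w hw
          refine hετ ?_
          rw [dist_zero_right, Real.norm_eq_abs, abs_div, abs_of_pos (japaneseBracket_pos _)]
          exact (div_le_self (abs_nonneg _) (one_le_japaneseBracket _)).trans_lt hw
        simp [dbar, he.fderiv_eq]
      rw [this, norm_zero]
      positivity
    · rw [not_lt] at hy
      have h4 : 1 ≤ (ε ^ N)⁻¹ * |z.im| ^ N := by
        rw [inv_mul_eq_div, one_le_div (by positivity)]
        gcongr
      rw [mul_assoc]
      exact ((hD z hzS).trans (le_abs_self D)).trans (le_mul_of_one_le_right (abs_nonneg D) h4)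
  rw [almostAnalyticExtension_eq,
    dbar_mul ((contDiff_taylorExt hf N).differentiable (by simp) z)
      ((contDiff_cutoff hτ).differentiable (by simp) z)]
  refine (norm_add_le _ _).trans ?_
  rw [norm_mul, norm_mul]
  calc ‖dbar (taylorExt f N) z‖ * ‖cutoff τ z‖ + ‖taylorExt f N z‖ * ‖dbar (cutoff τ) z‖
      ≤ (B * |z.im| ^ N) * t +
        ((N + 1) * (1 + |M|) ^ N * B) * (|D| * (ε ^ N)⁻¹ * |z.im| ^ N) := by
        gcongr
        exact ht _
    _ = _ := by ring

theorem exists_bound_iteratedDeriv {f : ℝ → ℂ} (hf : ContDiff ℝ ∞ f) (hc : HasCompactSupport f)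
    (N : ℕ) : ∃ B, ∀ k ≤ N, ∀ x, ‖iteratedDeriv k f x‖ ≤ B := by
  have h : ∀ k, ∃ B, ∀ x, ‖iteratedDeriv k f x‖ ≤ B := fun k => by
    obtain ⟨B, hB⟩ := (hf.continuous_iteratedFDeriv (m := k)
      (by exact_mod_cast le_top)).bounded_above_of_compact_support (hc.iteratedFDeriv (𝕜 := ℝ) k)
    exact ⟨B, fun x => by rw [← norm_iteratedFDeriv_eq_norm_iteratedDeriv]; exact hB x⟩
  choose B hB using h
  refine ⟨∑ k ∈ Finset.range (N + 1), B k, fun k hk x => (hB k x).trans ?_⟩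
  exact Finset.single_le_sum (f := B) (fun j _ => (norm_nonneg _).trans (hB j 0)) (by simp; omega)

theorem isExtension_almostAnalyticExtension {f : ℝ → ℂ} (hf : ContDiff ℝ ∞ f)
    (hc : HasCompactSupport f) (N : ℕ) {τ : ℝ → ℂ} (hτ : ContDiff ℝ ∞ τ)
    (hτc : HasCompactSupport τ) (hτ1 : ∀ᶠ s in 𝓝 (0 : ℝ), τ s = 1) :
    IsExtension f N (almostAnalyticExtension f N τ) where
  smooth := contDiff_almostAnalyticExtension hf N hτ
  compact := hasCompactSupport_almostAnalyticExtension hc N hτc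
  eq x := by
    simp only [almostAnalyticExtension_eq, taylorExt, cutoff, Complex.ofReal_im,
      Complex.ofReal_zero, mul_zero, zero_div, hτ1.self_of_nhds, mul_one, Complex.ofReal_re]
    rw [Finset.sum_eq_single_of_mem 0 (by simp)]
    · simp
    · intro k _ hk
      simp [hk]
  flat := by
    obtain ⟨C, -, hC⟩ := exists_dbar_bound hc.isCompact N hτ hτc hτ1
    obtain ⟨B, hB⟩ := exists_bound_iteratedDeriv hf hc (N + 1)
    exact ⟨C * B, hC f hf subset_rfl B hB⟩

/-- Cut-off functions with support in a given neighbourhood of `0`. -/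
theorem exists_cutoff {δ : ℝ} (hδ : 0 < δ) : ∃ τ : ℝ → ℂ, ContDiff ℝ ∞ τ ∧ HasCompactSupport τ ∧
    (∀ᶠ s in 𝓝 (0 : ℝ), τ s = 1) ∧ tsupport τ ⊆ Icc (-δ) δ := by
  let b : ContDiffBump (0 : ℝ) := ⟨δ / 2, δ, by positivity, by linarith⟩
  have hts : tsupport (fun s => ((b s : ℝ) : ℂ)) ⊆ tsupport b :=
    closure_mono fun s hs h => hs (by simp [h])
  refine ⟨fun s => (b s : ℝ), Complex.ofRealCLM.contDiff.comp b.contDiff, ?_, ?_, ?_⟩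
  · exact b.hasCompactSupport.of_isClosed_subset (isClosed_tsupport _) hts
  · filter_upwards [b.eventuallyEq_one] with s hs
    simp [hs]
  · refine hts.trans ?_
    rw [b.tsupport_eq, Real.closedBall_eq_Icc]
    simp [b]

end SSF

namespace SSF

set_option linter.unusedSectionVars false

/-! ### The resolvent -/

section ResolventSet

variable {E : Type*} [NormedAddCommGroup E] [NormedSpace ℂ E] {L : E →ₗ.[ℂ] E} {z w : ℂ}
  {R S : E →L[ℂ] E}

theorem IsResolventAt.resolvent_eq (h : IsResolventAt L z R) : resolvent L z = R :=
  (isResolventAt_resolvent ⟨R, h⟩).unique h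

theorem IsResolventAt.identity (hz : IsResolventAt L z R) (hw : IsResolventAt L w S) :
    R - S = (z - w) • (R * S) := by
  ext u
  obtain ⟨h, hu⟩ := hw.1 u
  have h1 := hz.2 ⟨S u, h⟩
  have h2 : L ⟨S u, h⟩ - z • S u = u + (w - z) • S u := by
    rw [eq_add_of_sub_eq hu]; module
  rw [h2, map_add, map_smul] at h1
  simp only [sub_apply, smul_apply, mul_apply_eq_comp]
  rw [eq_sub_of_add_eq h1]
  module

theorem resolvent_identity (hz : z ∈ resolventSet L) (hw : w ∈ resolventSet L) :
    resolvent L z - resolvent L w = (z - w) • (resolvent L z * resolvent L w) :=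
  (isResolventAt_resolvent hz).identity (isResolventAt_resolvent hw)

/-- On the domain, L - w = (L - z)(1 - (w - z)R) = (1 - (w - z)R)(L - z). An inverse of the bounded
factor commutes with `R`, so the same operator serves as left and right inverse. -/
theorem IsResolventAt.perturb (h : IsResolventAt L z R) {T : E →L[ℂ] E}
    (h1 : (1 - (w - z) • R) * T = 1) (h2 : T * (1 - (w - z) • R) = 1) :
    IsResolventAt L w (R * T) := by
  have hcomm : R * T = T * R := by
    have : (1 - (w - z) • R) * R = R * (1 - (w - z) • R) := by
      simp [sub_mul, mul_sub]
    calc R * T = T * (1 - (w - z) • R) * R * T := by rw [h2, one_mul]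
      _ = T * (R * (1 - (w - z) • R)) * T := by rw [← this]; simp only [mul_assoc]
      _ = T * R * ((1 - (w - z) • R) * T) := by simp only [mul_assoc]
      _ = T * R := by rw [h1, mul_one]
  constructor
  · intro u
    obtain ⟨hd, hu⟩ := h.1 (T u)
    refine ⟨hd, ?_⟩
    have h3 := DFunLike.congr_fun h1 u
    simp only [mul_apply_eq_comp, sub_apply, smul_apply,
      one_apply_eq_self] at h3
    change L ⟨R (T u), hd⟩ - w • R (T u) = u
    rw [eq_add_of_sub_eq hu]
    refine Eq.trans ?_ h3
    module
  · intro u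
    have h3 := h.2 u
    have h4 := DFunLike.congr_fun h2 (u : E)
    simp only [mul_apply_eq_comp, sub_apply, smul_apply,
      one_apply_eq_self] at h4
    rw [hcomm, mul_apply_eq_comp]
    have h5 : L u - w • (u : E) = (L u - z • (u : E)) - (w - z) • (u : E) := by module
    rw [h5, map_sub, h3, map_smul, h4]

variable [CompleteSpace E]

theorem eventually_isResolventAt (h : IsResolventAt L z R) :
    ∀ᶠ w in 𝓝 z, IsResolventAt L w (R * Ring.inverse (1 - (w - z) • R)) := by
  have hc : Filter.Tendsto (fun w : ℂ => ‖(w - z) • R‖) (𝓝 z) (𝓝 0) := by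
    have : Continuous fun w : ℂ => ‖(w - z) • R‖ := by fun_prop
    simpa using this.tendsto z
  filter_upwards [hc.eventually_lt_const zero_lt_one] with w hw
  have hu : IsUnit (1 - (w - z) • R) := isUnit_one_sub_of_norm_lt_one hw
  exact h.perturb (Ring.mul_inverse_cancel _ hu) (Ring.inverse_mul_cancel _ hu)

theorem differentiableAt_resolvent (hz : z ∈ resolventSet L) :
    DifferentiableAt ℂ (resolvent L) z := by
  obtain ⟨R, hR⟩ := hz
  have h1 : DifferentiableAt ℂ (fun w : ℂ => R * Ring.inverse (1 - (w - z) • R)) z := by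
    have h2 : DifferentiableAt ℂ (fun w : ℂ => 1 - (w - z) • R) z := by fun_prop
    have h3 : DifferentiableAt ℂ Ring.inverse (1 - (z - z) • R) := by
      have := differentiableAt_inverse (𝕜 := ℂ) (isUnit_one (M := E →L[ℂ] E))
      simpa using this
    exact (h3.comp z h2).const_mul R
  exact h1.congr_of_eventuallyEq ((eventually_isResolventAt hR).mono fun w h => h.resolvent_eq)

/-! ### The functional calculus -/

/-- The resolvent has at most polynomial growth at the real axis over `K`. -/
def StripBound (L : E →ₗ.[ℂ] E) (n : ℕ) (K : Set ℝ) : Prop :=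
  ∃ a > (0 : ℝ), ∃ C, ∀ z : ℂ, z.re ∈ K → 0 < |z.im| → |z.im| < a →
    z ∈ resolventSet L ∧ ‖resolvent L z‖ * |z.im| ^ n ≤ C

theorem StripBound.mono {n : ℕ} {K K' : Set ℝ} (h : StripBound L n K) (hK : K' ⊆ K) :
    StripBound L n K' := by
  obtain ⟨a, ha, C, hC⟩ := h
  exact ⟨a, ha, C, fun z hz => hC z (hK hz)⟩

theorem StripBound.mono_exponent {n m : ℕ} {K : Set ℝ} (h : StripBound L n K) (hnm : n ≤ m) :
    StripBound L m K := by
  obtain ⟨a, ha, C, hC⟩ := h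
  -- For |y| ≤ 1 raising the exponent decreases |y|^n.
  refine ⟨min a 1, lt_min ha one_pos, C, fun z hz h0 h1 => ?_⟩
  obtain ⟨h2, h3⟩ := hC z hz h0 (h1.trans_le (min_le_left _ _))
  refine ⟨h2, le_trans ?_ h3⟩
  gcongr ?_ * ?_
  exact pow_le_pow_of_le_one h0.le (h1.le.trans (min_le_right _ _)) hnm

/-- Near the axis the strip bound applies; the rest of `S` is compact and the resolvent is
continuous on it. -/
theorem StripBound.isTempered {n : ℕ} {K : Set ℝ} (h : StripBound L n K) {S : Set ℂ}
    (hS : IsCompact S) (hSK : ∀ z ∈ S, z.re ∈ K) (hSL : ∀ z ∈ S, z.im ≠ 0 → z ∈ resolventSet L) :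
    IsTempered (resolvent L) n S where
  differentiableAt z hz hi := differentiableAt_resolvent (hSL z hz hi)
  bound := by
    obtain ⟨a, ha, C, hC⟩ := h
    have hT : IsCompact (S ∩ {z | a ≤ |z.im|}) :=
      hS.inter_right (isClosed_le continuous_const Complex.continuous_im.abs)
    have hne : ∀ z ∈ S ∩ {z | a ≤ |z.im|}, z.im ≠ 0 := fun z hz => by
      have : a ≤ |z.im| := hz.2
      exact abs_pos.1 (ha.trans_le this)
    have hcont : ContinuousOn (fun z => ‖resolvent L z‖ * |z.im| ^ n) (S ∩ {z | a ≤ |z.im|}) := by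
      intro z hz
      have h1 := (differentiableAt_resolvent (hSL z hz.1 (hne z hz))).continuousAt
      exact (h1.norm.mul (Complex.continuous_im.abs.pow n).continuousAt).continuousWithinAt
    obtain ⟨D, hD⟩ := hT.exists_bound_of_continuousOn hcont
    refine ⟨max C D, fun z hz hi => ?_⟩
    rcases lt_or_ge |z.im| a with h1 | h1
    · exact (hC z (hSK z hz) (abs_pos.2 hi) h1).2.trans (le_max_left _ _)
    · exact ((le_abs_self _).trans (hD z ⟨hz, h1⟩)).trans (le_max_right _ _)

theorem StripBound.exists_cutoff_avoiding {n : ℕ} {K : Set ℝ} (hK : IsCompact K)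
    (h : StripBound L n K) : ∃ δ > (0 : ℝ), ∀ z : ℂ, z.im ≠ 0 → z.re ∈ K →
      |z.im / japaneseBracket z.re| ≤ δ → z ∈ resolventSet L := by
  obtain ⟨a, ha, C, hC⟩ := h
  obtain ⟨b, hb1, hb⟩ := exists_bound_japaneseBracket hK
  -- With ⟨x⟩ ≤ b on `K`, |y| ≤ δ⟨x⟩ gives |y| ≤ a/2, inside the strip.
  refine ⟨a / (2 * b), by positivity, fun z hi hz h1 => (hC z hz (abs_pos.2 hi) ?_).1⟩
  rw [abs_div, abs_of_pos (japaneseBracket_pos _), div_le_iff₀ (japaneseBracket_pos _)] at h1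
  refine h1.trans_lt ?_
  have hb0 : 0 < b := by linarith
  calc a / (2 * b) * japaneseBracket z.re ≤ a / (2 * b) * b := by gcongr; exact hb _ hz
    _ = a / 2 := by field_simp
    _ < a := by linarith

theorem isAdmissibleCutoff_of_subset {f : ℝ → ℂ} {K : Set ℝ} (hfK : tsupport f ⊆ K) {δ : ℝ}
    (hδ : ∀ z : ℂ, z.im ≠ 0 → z.re ∈ K → |z.im / japaneseBracket z.re| ≤ δ → z ∈ resolventSet L)
    {τ : ℝ → ℂ} (h1 : ContDiff ℝ ∞ τ) (h2 : HasCompactSupport τ) (h3 : ∀ᶠ s in 𝓝 (0 : ℝ), τ s = 1)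
    (h4 : tsupport τ ⊆ Icc (-δ) δ) : IsAdmissibleCutoff L f τ where
  smooth := h1
  compact := h2
  eq_one := h3
  avoids z hi hz hs := hδ z hi (hfK hz) (abs_le.2 (h4 hs))

theorem IsAdmissibleCutoff.isExtension {f : ℝ → ℂ} {τ : ℝ → ℂ} (hτ : IsAdmissibleCutoff L f τ)
    (hf : ContDiff ℝ ∞ f) (hc : HasCompactSupport f) (N : ℕ) :
    IsExtension f N (almostAnalyticExtension f N τ) :=
  isExtension_almostAnalyticExtension hf hc N hτ.smooth hτ.compact hτ.eq_one

theorem IsAdmissibleCutoff.isTempered {f : ℝ → ℂ} {τ : ℝ → ℂ} (hτ : IsAdmissibleCutoff L f τ)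
    (hc : HasCompactSupport f) {n : ℕ} (h : StripBound L n (tsupport f)) (N : ℕ) :
    IsTempered (resolvent L) n (tsupport (almostAnalyticExtension f N τ)) :=
  h.isTempered (hasCompactSupport_almostAnalyticExtension hc N hτ.compact).isCompact
    (fun _ hz => (tsupport_almostAnalyticExtension_subset f N τ hz).1) fun z hz hi =>
      hτ.avoids z hi (tsupport_almostAnalyticExtension_subset f N τ hz).1
        (tsupport_almostAnalyticExtension_subset f N τ hz).2

/-- The definition allows only Taylor extensions with admissible cut-offs. Here any extension may be
used, which is what sums and pull-backs under a holomorphic map require. -/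
theorem isFunCalc_of_isExtension {f : ℝ → ℂ} (hf : ContDiff ℝ ∞ f) (hc : HasCompactSupport f)
    {n N : ℕ} (h : StripBound L n (tsupport f)) {G : ℂ → ℂ} (hG : IsExtension f N G)
    (hN : n + 2 ≤ N) (hA : IsTempered (resolvent L) n (tsupport G)) :
    IsFunCalc L f ((Real.pi : ℂ)⁻¹ • ∫ z, dbar G z • resolvent L z) := by
  constructor
  · obtain ⟨δ, hδ, h1⟩ := h.exists_cutoff_avoiding hc.isCompact
    obtain ⟨τ, h2, h3, h4, h5⟩ := exists_cutoff hδ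
    exact ⟨τ, isAdmissibleCutoff_of_subset subset_rfl h1 h2 h3 h4 h5⟩
  · refine ⟨n + 2, fun M hM τ hτ => ⟨?_, ?_⟩⟩
    · exact (hτ.isExtension hf hc M).integrable (hτ.isTempered hc h M) (by omega)
    · rw [(hG.mono hN).integral_eq ((hτ.isExtension hf hc M).mono hM) hA
        (hτ.isTempered hc h M) le_rfl]

theorem IsAdmissibleCutoff.isFunCalc {f : ℝ → ℂ} {τ : ℝ → ℂ} (hτ : IsAdmissibleCutoff L f τ)
    (hf : ContDiff ℝ ∞ f) (hc : HasCompactSupport f) {n N : ℕ} (h : StripBound L n (tsupport f))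
    (hN : n + 2 ≤ N) : IsFunCalc L f ((Real.pi : ℂ)⁻¹ •
      ∫ z, dbar (almostAnalyticExtension f N τ) z • resolvent L z) :=
  isFunCalc_of_isExtension hf hc h (hτ.isExtension hf hc N) hN (hτ.isTempered hc h N)

theorem StripBound.funCalcDefined {f : ℝ → ℂ} (hf : ContDiff ℝ ∞ f) (hc : HasCompactSupport f)
    {n : ℕ} (h : StripBound L n (tsupport f)) : FunCalcDefined L f := by
  obtain ⟨δ, hδ, h1⟩ := h.exists_cutoff_avoiding hc.isCompact
  obtain ⟨τ, h2, h3, h4, h5⟩ := exists_cutoff hδ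
  exact ⟨_, (isAdmissibleCutoff_of_subset subset_rfl h1 h2 h3 h4 h5).isFunCalc hf hc h le_rfl⟩

theorem IsFunCalc.funCalc_eq {f : ℝ → ℂ} {T : E →L[ℂ] E} (h : IsFunCalc L f T) :
    funCalc L f = T :=
  (isFunCalc_funCalc ⟨T, h⟩).unique h

/-- `f(L) = 0` if the support of `f` lies in the resolvent set. -/
theorem funCalc_eq_zero {f : ℝ → ℂ} (hf : ContDiff ℝ ∞ f) (hc : HasCompactSupport f) {n : ℕ}
    (h : StripBound L n (tsupport f)) (hL : ∀ x ∈ tsupport f, (x : ℂ) ∈ resolventSet L) :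
    funCalc L f = 0 := by
  obtain ⟨δ, hδ, h1⟩ := h.exists_cutoff_avoiding hc.isCompact
  obtain ⟨τ, h2, h3, h4, h5⟩ := exists_cutoff hδ
  have hτ := isAdmissibleCutoff_of_subset subset_rfl h1 h2 h3 h4 h5
  rw [(hτ.isFunCalc hf hc h le_rfl).funCalc_eq,
    integral_dbar_smul_eq_zero_of_differentiableAt
      (contDiff_almostAnalyticExtension hf _ hτ.smooth)
      (hasCompactSupport_almostAnalyticExtension hc _ hτ.compact), smul_zero]
  intro z hz
  obtain ⟨hz1, hz2⟩ := tsupport_almostAnalyticExtension_subset f _ τ hz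
  refine differentiableAt_resolvent ?_
  by_cases hi : z.im = 0
  · have : z = (z.re : ℂ) := Complex.ext rfl (by simp [hi])
    rw [this]
    exact hL _ hz1
  · exact hτ.avoids z hi hz1 hz2

end ResolventSet

end SSF

namespace SSF

/-! ### Self-adjoint operators -/

section SelfAdjoint

variable {E : Type*} [NormedAddCommGroup E] [InnerProductSpace ℂ E] [CompleteSpace E]
  {A : E →ₗ.[ℂ] E}

theorem isFormalAdjoint_self (hA : IsSelfAdjoint A) : A.IsFormalAdjoint A := by
  have h := LinearPMap.adjoint_isFormalAdjoint hA.dense_domain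
  rwa [LinearPMap.isSelfAdjoint_def.1 hA] at h

/-- ⟨u, Au⟩ is real, so the imaginary part of ⟨u, (A - z)u⟩ is -Im z ‖u‖²; Cauchy–Schwarz concludes.
-/
theorem abs_im_mul_norm_le (hA : IsSelfAdjoint A) (z : ℂ) (u : A.domain) :
    |z.im| * ‖(u : E)‖ ≤ ‖A u - z • (u : E)‖ := by
  have h1 : (inner ℂ (u : E) (A u)).im = 0 := by
    have h := isFormalAdjoint_self hA u u
    rw [← inner_conj_symm] at h
    exact Complex.conj_eq_iff_im.1 h
  have h2 : (inner ℂ (u : E) (A u - z • (u : E))).im = -(z.im * ‖(u : E)‖ ^ 2) := by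
    rw [inner_sub_right, inner_smul_right, inner_self_eq_norm_sq_to_K, Complex.sub_im, h1]
    simp [← Complex.ofReal_pow]
  have h3 := (Complex.abs_im_le_norm _).trans
    (norm_inner_le_norm (𝕜 := ℂ) (u : E) (A u - z • (u : E)))
  rw [h2, abs_neg, abs_mul, abs_of_nonneg (sq_nonneg ‖(u : E)‖), sq, ← mul_assoc, mul_comm] at h3
  rcases (norm_nonneg (u : E)).eq_or_lt with h0 | h0
  · rw [← h0, mul_zero]
    exact norm_nonneg _
  · exact le_of_mul_le_mul_left h3 h0

/-- On the graph, complete because `A` is closed, A - z is a bounded operator bounded below, hence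
injective with closed range. A vector orthogonal to the range is an eigenvector of A* = A for the
conjugate of z, unless it is zero; `abs_im_mul_norm_le` excludes the former. -/
theorem exists_isResolventAt_of_im_ne_zero (hA : IsSelfAdjoint A) {z : ℂ} (hz : z.im ≠ 0) :
    ∃ R, IsResolventAt A z R ∧ ‖R‖ ≤ |z.im|⁻¹ := by
  have hz0 : 0 < |z.im| := abs_pos.2 hz
  let T : A.graph →L[ℂ] E :=
    (ContinuousLinearMap.snd ℂ E E - z • ContinuousLinearMap.fst ℂ E E).comp A.graph.subtypeL
  have hT : ∀ p : A.graph, T p = (p : E × E).2 - z • (p : E × E).1 := fun p => rfl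
  have hb : ∀ p : A.graph, |z.im| * ‖(p : E × E).1‖ ≤ ‖T p‖ := by
    rintro ⟨p, hp⟩
    obtain ⟨u, hu1, hu2⟩ := (LinearPMap.mem_graph_iff A).1 hp
    rw [hT]
    simp only [← hu1, ← hu2]
    exact abs_im_mul_norm_le hA z u
  have hcomplete : CompleteSpace A.graph := hA.isClosed.completeSpace_coe
  have hanti : AntilipschitzWith (Real.toNNReal (1 + (1 + ‖z‖) * |z.im|⁻¹)) T := by
    refine T.antilipschitz_of_bound fun p => ?_
    rw [Real.coe_toNNReal _ (by positivity)]
    change ‖p‖ ≤ _ * ‖T p‖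
    have h1 : ‖(p : E × E).1‖ ≤ |z.im|⁻¹ * ‖T p‖ := by
      rw [← div_eq_inv_mul, le_div_iff₀' hz0]
      exact hb p
    have h2 : ‖(p : E × E).2‖ ≤ ‖T p‖ + ‖z‖ * (|z.im|⁻¹ * ‖T p‖) := by
      have : (p : E × E).2 = T p + z • (p : E × E).1 := by rw [hT]; abel
      rw [this]
      refine (norm_add_le _ _).trans ?_
      rw [norm_smul]
      gcongr
    have h3 : ‖p‖ = max ‖(p : E × E).1‖ ‖(p : E × E).2‖ := rfl
    have h4 : 0 ≤ |z.im|⁻¹ * ‖T p‖ := by positivity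
    have h5 : 0 ≤ ‖z‖ * (|z.im|⁻¹ * ‖T p‖) := by positivity
    rw [h3]
    refine max_le ?_ ?_ <;> nlinarith [norm_nonneg (T p)]
  have hclosed : IsClosed (Set.range T) := hanti.isClosed_range T.uniformContinuous
  have hsurj : Function.Surjective T := by
    have hK : (LinearMap.range T.toLinearMap)ᗮ = ⊥ := by
      rw [Submodule.eq_bot_iff]
      intro v hv
      have h1 : ∀ u : A.domain, inner ℂ ((starRingEnd ℂ z) • v) (u : E) = inner ℂ v (A u) := by
        intro u
        have h2 := (Submodule.mem_orthogonal' _ _).1 hv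
          (T ⟨((u : E), A u), A.mem_graph u⟩) ⟨_, rfl⟩
        rw [hT, inner_sub_right, inner_smul_right, sub_eq_zero] at h2
        rw [inner_smul_left, Complex.conj_conj]
        exact h2.symm
      have hv1 : v ∈ A.adjoint.domain := LinearPMap.mem_adjoint_domain_of_exists v ⟨_, h1⟩
      have hv2 := LinearPMap.adjoint_apply_eq hA.dense_domain ⟨v, hv1⟩ h1
      -- The equality of A* and A is one of partial maps; quantifying over `B` transports the vector
      -- together with its proof of membership in the domain.
      have hex : ∀ B : E →ₗ.[ℂ] E, B = A → ∀ hv : v ∈ B.domain,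
          B ⟨v, hv⟩ = (starRingEnd ℂ z) • v → v = 0 := by
        rintro B rfl hv h
        have h3 := abs_im_mul_norm_le hA (starRingEnd ℂ z) ⟨v, hv⟩
        rw [h, sub_self, norm_zero, Complex.conj_im, abs_neg] at h3
        exact norm_eq_zero.1 (le_antisymm (nonpos_of_mul_nonpos_right h3 hz0) (norm_nonneg v))
      exact hex _ (LinearPMap.isSelfAdjoint_def.1 hA) hv1 hv2
    have hc' : IsClosed ((LinearMap.range T.toLinearMap : Submodule ℂ E) : Set E) := hclosed
    have : CompleteSpace (LinearMap.range T.toLinearMap) := hc'.completeSpace_coe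
    have h4 := Submodule.orthogonal_eq_bot_iff.1 hK
    exact LinearMap.range_eq_top.1 h4
  let e := LinearEquiv.ofBijective T.toLinearMap ⟨hanti.injective, hsurj⟩
  have he : ∀ u, T (e.symm u) = u := fun u => e.apply_symm_apply u
  let R₀ : E →ₗ[ℂ] E := (LinearMap.fst ℂ E E).comp (A.graph.subtype.comp e.symm.toLinearMap)
  have hR₀ : ∀ u, ‖R₀ u‖ ≤ |z.im|⁻¹ * ‖u‖ := by
    intro u
    rw [← div_eq_inv_mul, le_div_iff₀' hz0]
    have := hb (e.symm u)
    rwa [he] at this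
  refine ⟨R₀.mkContinuous _ hR₀, ⟨fun u => ?_, fun u => ?_⟩,
    R₀.mkContinuous_norm_le (by positivity) hR₀⟩
  · obtain ⟨v, hv1, hv2⟩ := (LinearPMap.mem_graph_iff A).1 (e.symm u).2
    have hd : R₀ u = v := hv1.symm
    have hmem : R₀ u ∈ A.domain := hd ▸ v.2
    refine ⟨hmem, ?_⟩
    have h5 : (⟨R₀ u, hmem⟩ : A.domain) = v := Subtype.ext hd
    change A ⟨R₀ u, hmem⟩ - z • R₀ u = u
    rw [h5, hv2]
    exact he u
  · have h6 : e.symm (A u - z • (u : E)) = ⟨((u : E), A u), A.mem_graph u⟩ := by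
      rw [LinearEquiv.symm_apply_eq]
      rfl
    change ((e.symm (A u - z • (u : E)) : A.graph) : E × E).1 = u
    rw [h6]

theorem mem_resolventSet_of_im_ne_zero (hA : IsSelfAdjoint A) {z : ℂ} (hz : z.im ≠ 0) :
    z ∈ resolventSet A :=
  (exists_isResolventAt_of_im_ne_zero hA hz).imp fun _ h => h.1

theorem polynomialResolventBound_of_isSelfAdjoint (hA : IsSelfAdjoint A) (I : Set ℝ) :
    PolynomialResolventBound A I := by
  refine ⟨1, one_pos, 1, one_pos, 1, one_pos, fun z _ h0 h1 => ?_⟩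
  obtain ⟨R, hR, hn⟩ := exists_isResolventAt_of_im_ne_zero hA (abs_pos.1 h0)
  refine ⟨⟨R, hR⟩, ?_⟩
  rw [hR.resolvent_eq, one_mul, Real.rpow_one]
  refine hn.trans (le_mul_of_one_le_right (by positivity) ?_)
  rw [one_le_div h0]
  exact h1.le.trans (one_le_japaneseBracket _)

end SelfAdjoint

end SSF

namespace SSF

/-! ### Trace-class operators -/

section TraceClass

open ContinuousLinearMap

variable {E : Type*} [NormedAddCommGroup E] [InnerProductSpace ℂ E] [CompleteSpace E]

/-- Douglas' lemma. -/
theorem exists_contraction_mul_eq {A B : E →L[ℂ] E} (h : ∀ x, ‖A x‖ ≤ ‖B x‖) :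
    ∃ U : E →L[ℂ] E, ‖U‖ ≤ 1 ∧ U * B = A := by
  let K : Submodule ℂ E := (LinearMap.range B.toLinearMap).topologicalClosure
  have hK : ∀ x, B x ∈ K := fun x => Submodule.le_topologicalClosure _ ⟨x, rfl⟩
  let e : E →ₗ[ℂ] K := B.toLinearMap.codRestrict K hK
  have hcl : IsClosed (K : Set E) := Submodule.isClosed_topologicalClosure _
  have : CompleteSpace K := hcl.completeSpace_coe
  have he : DenseRange e := by
    intro y
    rw [Metric.mem_closure_iff]
    intro ε hε
    have hy : (y : E) ∈ closure (LinearMap.range B.toLinearMap : Set E) := y.2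
    obtain ⟨_, ⟨x, rfl⟩, hx⟩ := Metric.mem_closure_iff.1 hy ε hε
    exact ⟨e x, ⟨x, rfl⟩, hx⟩
  have hn : ∀ x, ‖A.toLinearMap x‖ ≤ 1 * ‖e x‖ := fun x => by rw [one_mul]; exact h x
  let U₀ : K →L[ℂ] E := A.toLinearMap.extendOfNorm e
  have hU₀ : ‖U₀‖ ≤ 1 := U₀.opNorm_le_bound zero_le_one fun x =>
    LinearMap.norm_extendOfNorm_apply_le he 1 hn x
  refine ⟨U₀ ∘L K.orthogonalProjectionOnto, ?_, ?_⟩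
  · refine (opNorm_comp_le _ _).trans ?_
    exact mul_le_one₀ hU₀ (norm_nonneg _) K.orthogonalProjectionOnto_norm_le
  · ext x
    have h1 : K.orthogonalProjectionOnto (B x) = e x :=
      K.orthogonalProjectionOnto_mem_subspace_eq_self (e x)
    change U₀ (K.orthogonalProjectionOnto (B x)) = A x
    rw [h1]
    exact LinearMap.extendOfNorm_eq he ⟨1, hn⟩ x

theorem norm_abs_apply (T : E →L[ℂ] E) (x : E) : ‖CFC.abs T x‖ = ‖T x‖ := by
  have hs : star (CFC.abs T) = CFC.abs T := (CFC.abs_nonneg T).isSelfAdjoint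
  have h : star (CFC.abs T) * CFC.abs T = star T * T := by rw [hs, CFC.abs_mul_abs]
  have h1 : ∀ S : E →L[ℂ] E, inner ℂ ((star S * S) x) x = ((‖S x‖ : ℂ)) ^ 2 := fun S => by
    rw [mul_apply_eq_comp, star_eq_adjoint, adjoint_inner_left, inner_self_eq_norm_sq_to_K]
    rfl
  have h2 := (h1 (CFC.abs T)).symm.trans ((congrArg (fun S => inner ℂ (S x) x) h).trans (h1 T))
  have h3 : ‖CFC.abs T x‖ ^ 2 = ‖T x‖ ^ 2 := by exact_mod_cast h2
  exact (sq_eq_sq₀ (norm_nonneg _) (norm_nonneg _)).1 h3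

theorem tsum_enorm_inner_sq (x : E) : ∑' i, ‖inner ℂ (basis E i) x‖ₑ ^ 2 = ‖x‖ₑ ^ 2 := by
  have h := (basis E).hasSum_inner_mul_inner x x
  have h1 : HasSum (fun i => ‖inner ℂ (basis E i) x‖ ^ 2) (‖x‖ ^ 2) := by
    have h2 := Complex.hasSum_re h
    rw [inner_self_eq_norm_sq_to_K] at h2
    have h3 : ∀ i, (inner ℂ x (basis E i) * inner ℂ (basis E i) x).re =
        ‖inner ℂ (basis E i) x‖ ^ 2 := fun i => by
      rw [← inner_conj_symm, Complex.conj_mul', ← Complex.ofReal_pow, Complex.ofReal_re]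
    simp only [h3] at h2
    convert h2 using 1
    norm_cast
  have h4 := ENNReal.ofReal_tsum_of_nonneg (fun i => sq_nonneg ‖inner ℂ (basis E i) x‖) h1.summable
  rw [h1.tsum_eq, ENNReal.ofReal_pow (norm_nonneg _), ofReal_norm] at h4
  rw [h4]
  refine tsum_congr fun i => ?_
  rw [ENNReal.ofReal_pow (norm_nonneg _), ofReal_norm]

/-- The square of the Hilbert–Schmidt norm. -/
noncomputable def hsNormSq (P : E →L[ℂ] E) : ENNReal := ∑' i, ‖P (basis E i)‖ₑ ^ 2

/-- By Parseval both sides are double sums of squared matrix entries, and nonnegative sums may be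
interchanged. -/
theorem hsNormSq_adjoint (P : E →L[ℂ] E) : hsNormSq (adjoint P) = hsNormSq P := by
  have h : ∀ Q : E →L[ℂ] E, hsNormSq Q =
      ∑' i, ∑' j, ‖inner ℂ (basis E j) (Q (basis E i))‖ₑ ^ 2 := fun Q =>
    tsum_congr fun i => (tsum_enorm_inner_sq _).symm
  rw [h, h, ENNReal.tsum_comm]
  refine tsum_congr fun i => tsum_congr fun j => ?_
  rw [adjoint_inner_right, ← inner_conj_symm, ← ofReal_norm, RCLike.norm_conj, ofReal_norm]

theorem hsNormSq_mul_left_le (W P : E →L[ℂ] E) : hsNormSq (W * P) ≤ ‖W‖ₑ ^ 2 * hsNormSq P := by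
  rw [hsNormSq, hsNormSq, ← ENNReal.tsum_mul_left]
  refine ENNReal.tsum_le_tsum fun i => ?_
  rw [← mul_pow]
  gcongr
  exact W.le_opENorm _

theorem hsNormSq_mul_right_le (P W : E →L[ℂ] E) : hsNormSq (P * W) ≤ ‖W‖ₑ ^ 2 * hsNormSq P := by
  rw [← hsNormSq_adjoint, ← hsNormSq_adjoint P]
  have h : adjoint (P * W) = adjoint W * adjoint P := adjoint_comp P W
  have h2 : ‖adjoint W‖ₑ = ‖W‖ₑ := by
    rw [← ofReal_norm, ← ofReal_norm, LinearIsometryEquiv.norm_map]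
  rw [h, ← h2]
  exact hsNormSq_mul_left_le _ _

theorem sum_norm_sq_le_hsNormSq {P : E →L[ℂ] E} (hP : hsNormSq P ≠ ⊤)
    (F : Finset (basisIndex E)) : ∑ i ∈ F, ‖P (basis E i)‖ ^ 2 ≤ (hsNormSq P).toReal := by
  have h := ENNReal.toReal_mono hP (ENNReal.sum_le_tsum (f := fun i => ‖P (basis E i)‖ₑ ^ 2) F)
  rw [ENNReal.toReal_sum (fun i _ => by simp)] at h
  simpa using h

/-- The trace norm of `T` is at most `M`. -/
def NuclearBound (T : E →L[ℂ] E) (M : ℝ) : Prop :=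
  ∀ W : E →L[ℂ] E, ‖W‖ ≤ 1 → ∀ F : Finset (basisIndex E),
    ∑ i ∈ F, ‖inner ℂ (W (basis E i)) (T (basis E i))‖ ≤ M

/-- ⟨We, P*Qe⟩ = ⟨PWe, Qe⟩, so Cauchy–Schwarz over the basis bounds the sum by the product of two
Hilbert–Schmidt norms. -/
theorem nuclearBound_adjoint_mul {P Q : E →L[ℂ] E} {p q : ℝ} (hp : 0 ≤ p) (hq : 0 ≤ q)
    (hP : hsNormSq P ≤ ENNReal.ofReal (p ^ 2)) (hQ : hsNormSq Q ≤ ENNReal.ofReal (q ^ 2)) :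
    NuclearBound (adjoint P * Q) (p * q) := by
  intro W hW F
  have hW' : ‖W‖ₑ ≤ 1 := by
    rw [← ofReal_norm, ← ENNReal.ofReal_one]
    exact ENNReal.ofReal_le_ofReal hW
  have hPW : hsNormSq (P * W) ≤ ENNReal.ofReal (p ^ 2) := by
    refine (hsNormSq_mul_right_le P W).trans (le_trans ?_ hP)
    exact mul_le_of_le_one_left' (pow_le_one₀ (by simp) hW')
  have h1 : ∑ i ∈ F, ‖(P * W) (basis E i)‖ ^ 2 ≤ p ^ 2 :=
    (sum_norm_sq_le_hsNormSq (ne_top_of_le_ne_top ENNReal.ofReal_ne_top hPW) F).trans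
      (ENNReal.toReal_le_of_le_ofReal (sq_nonneg p) hPW)
  have h2 : ∑ i ∈ F, ‖Q (basis E i)‖ ^ 2 ≤ q ^ 2 :=
    (sum_norm_sq_le_hsNormSq (ne_top_of_le_ne_top ENNReal.ofReal_ne_top hQ) F).trans
      (ENNReal.toReal_le_of_le_ofReal (sq_nonneg q) hQ)
  calc ∑ i ∈ F, ‖inner ℂ (W (basis E i)) ((adjoint P * Q) (basis E i))‖
      ≤ ∑ i ∈ F, ‖(P * W) (basis E i)‖ * ‖Q (basis E i)‖ := by
        refine Finset.sum_le_sum fun i _ => ?_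
        rw [mul_apply_eq_comp, adjoint_inner_right]
        exact norm_inner_le_norm _ _
    _ ≤ √(∑ i ∈ F, ‖(P * W) (basis E i)‖ ^ 2) * √(∑ i ∈ F, ‖Q (basis E i)‖ ^ 2) :=
        Real.sum_mul_le_sqrt_mul_sqrt _ _ _
    _ ≤ √(p ^ 2) * √(q ^ 2) := by gcongr
    _ = p * q := by rw [Real.sqrt_sq hp, Real.sqrt_sq hq]

/-- The ideal property of trace-class operators. -/
theorem IsTraceClass.exists_nuclearBound {T : E →L[ℂ] E} (hT : IsTraceClass T) :
    ∃ M, 0 ≤ M ∧ ∀ A B : E →L[ℂ] E, NuclearBound (A * T * B) (‖A‖ * ‖B‖ * M) := by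
  set S := CFC.abs T with hS
  set Q := CFC.sqrt S with hQ
  have hS0 : 0 ≤ S := CFC.abs_nonneg T
  have hQ0 : 0 ≤ Q := CFC.sqrt_nonneg S
  have hQQ : Q * Q = S := CFC.sqrt_mul_sqrt_self S hS0
  have hQs : adjoint Q = Q := hQ0.isSelfAdjoint
  -- T = U|T| with a contraction U, and |T| = Q² with Q Hilbert–Schmidt. Thus A T B = (Q U* A*)* (Q
  -- B) is a product of two Hilbert–Schmidt operators.
  obtain ⟨U, hU, hUS⟩ := exists_contraction_mul_eq (A := T) (B := S)
    (fun x => (norm_abs_apply T x).symm.le)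
  have hre : ∀ i, (inner ℂ (basis E i) (S (basis E i))).re = ‖Q (basis E i)‖ ^ 2 := fun i => by
    rw [← hQQ, mul_apply_eq_comp]
    nth_rw 1 [← hQs]
    rw [adjoint_inner_right, inner_self_eq_norm_sq_to_K]
    norm_cast
  have hsum : Summable fun i => ‖Q (basis E i)‖ ^ 2 := by
    have h : Summable fun i => (inner ℂ (basis E i) (S (basis E i))).re := hT
    simpa only [hre] using h
  set M := ∑' i, ‖Q (basis E i)‖ ^ 2 with hM
  have hM0 : 0 ≤ M := tsum_nonneg fun i => sq_nonneg _
  have hQM : hsNormSq Q = ENNReal.ofReal M := by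
    rw [hM, ENNReal.ofReal_tsum_of_nonneg (fun i => sq_nonneg _) hsum, hsNormSq]
    refine tsum_congr fun i => ?_
    rw [ENNReal.ofReal_pow (norm_nonneg _), ofReal_norm]
  refine ⟨M, hM0, fun A B => ?_⟩
  have e : A * T * B = adjoint (Q * (adjoint U * adjoint A)) * (Q * B) := by
    have h1 : adjoint (Q * (adjoint U * adjoint A)) = A * U * Q := by
      have h2 : adjoint (Q * (adjoint U * adjoint A)) =
        (adjoint (adjoint A) * adjoint (adjoint U)) * adjoint Q := by
        simp only [← star_eq_adjoint, star_mul]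
      rw [h2, hQs, adjoint_adjoint, adjoint_adjoint]
    rw [h1, ← hUS, ← hQQ]
    simp only [mul_assoc]
  have hgen : ∀ D : E →L[ℂ] E, ∀ d, ‖D‖ ≤ d →
      hsNormSq (Q * D) ≤ ENNReal.ofReal ((d * √M) ^ 2) := by
    intro D d hd
    refine (hsNormSq_mul_right_le Q D).trans ?_
    have hd0 : 0 ≤ d := (norm_nonneg D).trans hd
    rw [hQM, mul_pow, Real.sq_sqrt hM0, ENNReal.ofReal_mul (by positivity),
      ENNReal.ofReal_pow hd0, ← ofReal_norm]
    gcongr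
  have hn : ‖adjoint U * adjoint A‖ ≤ ‖A‖ := by
    refine (norm_mul_le _ _).trans ?_
    rw [LinearIsometryEquiv.norm_map, LinearIsometryEquiv.norm_map]
    exact mul_le_of_le_one_left (norm_nonneg A) hU
  have := nuclearBound_adjoint_mul (by positivity) (by positivity) (hgen _ _ hn) (hgen B _ le_rfl)
  rw [e]
  convert this using 1
  rw [mul_mul_mul_comm, Real.mul_self_sqrt hM0]

/-- |T| = WT for a contraction W, and ⟨e, WTe⟩ = ⟨W*e, Te⟩ is one of the sums controlled by
`NuclearBound`; this is why its definition tests against all contractions. -/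
theorem NuclearBound.isTraceClass {T : E →L[ℂ] E} {M : ℝ} (h : NuclearBound T M) :
    IsTraceClass T := by
  obtain ⟨W, hW, hWT⟩ := exists_contraction_mul_eq (A := CFC.abs T) (B := T)
    (fun x => (norm_abs_apply T x).le)
  refine Summable.of_norm (summable_of_sum_le (c := M) (fun i => norm_nonneg _) fun F => ?_)
  refine le_trans (Finset.sum_le_sum fun i _ => ?_) (h (adjoint W)
    (by rwa [LinearIsometryEquiv.norm_map]) F)
  rw [← hWT, mul_apply_eq_comp, adjoint_inner_left]
  exact Complex.abs_re_le_norm _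

theorem NuclearBound.sum_le {T : E →L[ℂ] E} {M : ℝ} (h : NuclearBound T M)
    (F : Finset (basisIndex E)) : ∑ i ∈ F, ‖inner ℂ (basis E i) (T (basis E i))‖ ≤ M := by
  have := h 1 norm_id_le F
  simpa using this

theorem NuclearBound.norm_trace_le {T : E →L[ℂ] E} {M : ℝ} (h : NuclearBound T M) :
    ‖trace T‖ ≤ M := by
  have hs : Summable fun i => ‖inner ℂ (basis E i) (T (basis E i))‖ :=
    summable_of_sum_le (fun i => norm_nonneg _) h.sum_le
  exact (norm_tsum_le_tsum_norm hs).trans (hs.tsum_le_of_sum_le h.sum_le)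

theorem NuclearBound.smul {T : E →L[ℂ] E} {M : ℝ} (h : NuclearBound T M) (a : ℂ) :
    NuclearBound (a • T) (‖a‖ * M) := by
  intro W hW F
  simp only [smul_apply, inner_smul_right, norm_mul, ← Finset.mul_sum]
  exact mul_le_mul_of_nonneg_left (h W hW F) (norm_nonneg a)

theorem trace_smul (a : ℂ) (T : E →L[ℂ] E) : trace (a • T) = a * trace T := by
  simp only [trace, smul_apply, inner_smul_right, tsum_mul_left]

/-! ### Trace-norm bounds for operator-valued integrals -/

section Integral

variable {α : Type*} [MeasurableSpace α] {μ : Measure α} {D : α → E →L[ℂ] E} {b : α → ℝ}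

theorem inner_integral_apply (hD : Integrable D μ) (x y : E) :
    Integrable (fun w => inner ℂ x (D w y)) μ ∧
      inner ℂ x ((∫ w, D w ∂μ) y) = ∫ w, inner ℂ x (D w y) ∂μ := by
  let ℓ : (E →L[ℂ] E) →L[ℂ] ℂ := (innerSL ℂ x) ∘L (ContinuousLinearMap.apply ℂ E y)
  exact ⟨ℓ.integrable_comp hD, (ℓ.integral_comp_comm hD).symm⟩

/-- `NuclearBound` only involves finite sums of matrix entries, which commute with the
norm-convergent integral; no measurability in trace norm is needed. -/
theorem nuclearBound_integral (hD : Integrable D μ) (hb : Integrable b μ)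
    (h : ∀ᵐ w ∂μ, NuclearBound (D w) (b w)) : NuclearBound (∫ w, D w ∂μ) (∫ w, b w ∂μ) := by
  intro W hW F
  have h1 : ∀ i, Integrable (fun w => ‖inner ℂ (W (basis E i)) (D w (basis E i))‖) μ := fun i =>
    (inner_integral_apply hD _ _).1.norm
  calc ∑ i ∈ F, ‖inner ℂ (W (basis E i)) ((∫ w, D w ∂μ) (basis E i))‖
      ≤ ∑ i ∈ F, ∫ w, ‖inner ℂ (W (basis E i)) (D w (basis E i))‖ ∂μ := by
        refine Finset.sum_le_sum fun i _ => ?_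
        rw [(inner_integral_apply hD _ _).2]
        exact norm_integral_le_integral_norm _
    _ = ∫ w, ∑ i ∈ F, ‖inner ℂ (W (basis E i)) (D w (basis E i))‖ ∂μ :=
        (integral_finsetSum _ fun i _ => h1 i).symm
    _ ≤ ∫ w, b w ∂μ := integral_mono_ae (integrable_finsetSum _ fun i _ => h1 i) hb
        (h.mono fun w hw => hw W hW F)

end Integral

end TraceClass

end SSF

namespace SSF

/-! ### Distributions on intervals -/

section Distributions

variable {Ω : Opens ℝ}

theorem contDiff_testFunction (f : 𝓓(Ω, ℂ)) : ContDiff ℝ ∞ f := f.contDiff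

/-- The family of estimates that characterizes continuity on the space of test functions. -/
def HasTestBounds (T : 𝓓(Ω, ℂ) → ℂ) : Prop :=
  ∀ K : Set ℝ, IsCompact K → K ⊆ Ω → ∃ (N : ℕ) (C : ℝ), 0 ≤ C ∧ ∀ f : 𝓓(Ω, ℂ), tsupport f ⊆ K →
    ∀ B, (∀ k ≤ N, ∀ x, ‖iteratedDeriv k f x‖ ≤ B) → ‖T f‖ ≤ C * B

theorem exists_distr_of_hasTestBounds {T : 𝓓(Ω, ℂ) → ℂ} (hadd : ∀ f g, T (f + g) = T f + T g)
    (hsmul : ∀ (a : ℂ) f, T (a • f) = a • T f) (hT : HasTestBounds T) :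
    ∃ ξ : Distr Ω, ∀ f, ξ f = T f := by
  refine ⟨TestFunction.mkCLM ℂ T hadd hsmul fun K hK => ?_, fun f => rfl⟩
  obtain ⟨N, C, hC, h⟩ := hT K K.isCompact hK
  let A : 𝓓_{K}(ℝ, ℂ) →L[ℂ] ℂ := ContDiffMapSupportedIn.mkCLMtoNormedSpace ℂ
    (fun f => T (TestFunction.ofSupportedIn hK f))
    (fun f g => hadd (TestFunction.ofSupportedIn hK f) (TestFunction.ofSupportedIn hK g))
    (fun a f => hsmul a (TestFunction.ofSupportedIn hK f)) (by
      refine ⟨Finset.range (N + 1), C, hC, fun f => ?_⟩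
      refine h _ f.tsupport_subset _ fun k hk x => ?_
      rw [← norm_iteratedFDeriv_eq_norm_iteratedDeriv]
      refine (ContDiffMapSupportedIn.norm_iteratedFDeriv_apply_le_seminorm_top ℂ).trans ?_
      exact Seminorm.le_finset_sup_apply (by simp; omega))
  exact A.continuous

theorem hasTestBounds (η : Distr Ω) : HasTestBounds (η : 𝓓(Ω, ℂ) → ℂ) := by
  intro K hK hKΩ
  let K' : Compacts ℝ := ⟨K, hK⟩
  let A : 𝓓_{K'}(ℝ, ℂ) →L[ℂ] ℂ := η.comp (TestFunction.ofSupportedInCLM ℂ hKΩ)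
  have hcont : Continuous (fun f => ‖A f‖) := A.continuous.norm
  obtain ⟨s, C, -, hC⟩ := Seminorm.bound_of_continuous
    (ContDiffMapSupportedIn.withSeminorms ℂ ℝ ℂ ⊤ K')
    ((normSeminorm ℂ ℂ).comp A.toLinearMap) hcont
  -- Continuity provides a finite set `s` of seminorm indices; its largest element serves as the
  -- order.
  refine ⟨s.sup id, C, C.2, fun f hf B hB => ?_⟩
  have hB0 : 0 ≤ B := (norm_nonneg _).trans (hB 0 (Nat.zero_le _) 0)
  let f' : 𝓓_{K'}(ℝ, ℂ) :=
    ContDiffMapSupportedIn.of_support_subset f.contDiff (subset_closure.trans hf)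
  have h1 : ‖η f‖ ≤ C • (s.sup (ContDiffMapSupportedIn.seminorm ℂ ℝ ℂ ⊤ K')) f' := hC f'
  refine h1.trans ?_
  rw [NNReal.smul_def, smul_eq_mul]
  gcongr
  refine Seminorm.finset_sup_apply_le hB0 fun i hi => ?_
  refine (ContDiffMapSupportedIn.seminorm_top_le_iff ℂ hB0 i f').2 fun x _ => ?_
  rw [norm_iteratedFDeriv_eq_norm_iteratedDeriv]
  exact hB i (Finset.le_sup (f := id) hi) x

theorem exists_Icc_of_isCompact {K S : Set ℝ} (hK : IsCompact K) (hS : S.OrdConnected)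
    (hKS : K ⊆ S) (hne : K.Nonempty) : ∃ a b, a ≤ b ∧ K ⊆ Icc a b ∧ Icc a b ⊆ S :=
  ⟨sInf K, sSup K, csInf_le_csSup hne hK.bddBelow hK.bddAbove,
    fun _ hx => ⟨csInf_le hK.bddBelow hx, le_csSup hK.bddAbove hx⟩,
    hS.out (hKS (hK.sInf_mem hne)) (hKS (hK.sSup_mem hne))⟩

theorem integrable_testFunction (f : 𝓓(Ω, ℂ)) : Integrable f :=
  f.continuous.integrable_of_hasCompactSupport f.hasCompactSupport

theorem integral_testDeriv (f : 𝓓(Ω, ℂ)) : ∫ x, testDeriv f x = 0 := by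
  have h : ∀ x, HasDerivAt f (testDeriv f x) x := fun x => by
    rw [testDeriv_apply]
    exact ((contDiff_testFunction f).differentiable (by simp) x).hasDerivAt
  exact integral_eq_zero_of_hasDerivAt_of_integrable h (integrable_testFunction _)
    (integrable_testFunction _)

theorem testDeriv_injective : Function.Injective (testDeriv : 𝓓(Ω, ℂ) →L[ℂ] 𝓓(Ω, ℂ)) := by
  rw [injective_iff_map_eq_zero]
  intro f hf
  have h : ∀ x, deriv f x = 0 := fun x => by rw [← testDeriv_apply, hf]; rfl
  have hc := is_const_of_deriv_eq_zero ((contDiff_testFunction f).differentiable (by simp)) h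
  obtain ⟨y, hy⟩ : ∃ y, y ∉ tsupport f := by
    by_contra! hcon
    exact noncompact_univ ℝ (by
      rw [← eq_univ_of_forall hcon]; exact f.hasCompactSupport.isCompact)
  ext x
  rw [hc x y, image_eq_zero_of_notMem_tsupport hy]
  rfl

/-- The primitive from `a` vanishes to the left of `a` because `g` does, and to the right of `b`
because the total integral of `g` is 0. -/
theorem exists_primitive {g : 𝓓(Ω, ℂ)} {a b : ℝ} (hab : a ≤ b) (hg : tsupport g ⊆ Icc a b)
    (hΩ : Icc a b ⊆ Ω) (h0 : ∫ x, g x = 0) :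
    ∃ f : 𝓓(Ω, ℂ), testDeriv f = g ∧ tsupport f ⊆ Icc a b ∧
      ∀ B, (∀ x, ‖g x‖ ≤ B) → ∀ x, ‖f x‖ ≤ (b - a) * B := by
  have hgc : Continuous g := g.continuous
  have hz : ∀ x, x ∉ Icc a b → g x = 0 := fun x hx =>
    image_eq_zero_of_notMem_tsupport fun h => hx (hg h)
  let F : ℝ → ℂ := fun x => ∫ t in a..x, g t
  have hd : ∀ x, HasDerivAt F (g x) x := fun x =>
    intervalIntegral.integral_hasDerivAt_right (hgc.intervalIntegrable _ _)
      hgc.stronglyMeasurable.stronglyMeasurableAtFilter hgc.continuousAt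
  have hF0 : ∀ x, x ∉ Icc a b → F x = 0 := by
    intro x hx
    rw [mem_Icc, not_and_or, not_le, not_le] at hx
    rcases hx with hx | hx
    · refine (intervalIntegral.integral_congr_ae (g := fun _ => (0 : ℂ)) ?_).trans (by simp)
      have : ∀ᵐ t : ℝ, t ≠ a := by simp [ae_iff]
      filter_upwards [this] with t hta ht
      rw [uIoc_of_ge hx.le] at ht
      exact hz t fun h => hta (le_antisymm ht.2 h.1)
    · rw [← h0]
      have h1 : Function.support (g : ℝ → ℂ) ⊆ Icc a b := subset_closure.trans hg
      have h2 : ∫ t in a..x, g t = ∫ t in Icc a x, g t := by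
        rw [intervalIntegral.integral_of_le (hab.trans hx.le), integral_Icc_eq_integral_Ioc]
      change ∫ t in a..x, g t = _
      rw [h2]
      refine setIntegral_eq_integral_of_forall_compl_eq_zero fun t ht => hz t fun h => ht ?_
      exact ⟨h.1, h.2.trans hx.le⟩
  have hFs : tsupport F ⊆ Icc a b :=
    closure_minimal (fun x hx => by_contra fun h => hx (hF0 x h)) isClosed_Icc
  have hFd : deriv F = g := funext fun x => (hd x).deriv
  have hFc : ContDiff ℝ ∞ F := by
    rw [contDiff_infty_iff_deriv, hFd]
    exact ⟨fun x => (hd x).differentiableAt, contDiff_testFunction g⟩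
  let f : 𝓓(Ω, ℂ) := ⟨F, hFc, isCompact_Icc.of_isClosed_subset (isClosed_tsupport F) hFs,
    hFs.trans hΩ⟩
  refine ⟨f, ?_, hFs, fun B hB x => ?_⟩
  · ext x
    rw [testDeriv_apply]
    exact (hd x).deriv
  · have hB0 : 0 ≤ B := (norm_nonneg _).trans (hB 0)
    change ‖F x‖ ≤ _
    by_cases hx : x ∈ Icc a b
    · refine (intervalIntegral.norm_integral_le_of_norm_le_const fun t _ => hB t).trans ?_
      rw [abs_of_nonneg (by linarith [hx.1]), mul_comm]
      gcongr
      exact hx.2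
    · rw [hF0 x hx, norm_zero]
      have := sub_nonneg.2 hab
      positivity

theorem exists_testFunction_integral_one {S : Set ℝ} (hS : IsOpen S) (hSΩ : S ⊆ Ω)
    (hne : S.Nonempty) : ∃ χ : 𝓓(Ω, ℂ), tsupport χ ⊆ S ∧ ∫ x, χ x = 1 := by
  obtain ⟨x₀, hx₀⟩ := hne
  obtain ⟨ε, hε, hb⟩ := Metric.isOpen_iff.1 hS x₀ hx₀
  let β : ContDiffBump x₀ := ⟨ε / 4, ε / 2, by positivity, by linarith⟩
  let F : ℝ → ℂ := fun x => (β.normed volume x : ℝ)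
  have hFs : tsupport F ⊆ S := by
    refine Subset.trans (closure_mono (t := Function.support (β.normed volume)) fun s hs h => ?_) ?_
    · exact hs (by simp only [F, h, Complex.ofReal_zero])
    · change tsupport _ ⊆ _
      rw [β.tsupport_normed_eq]
      exact (Metric.closedBall_subset_ball (by simp only [β]; linarith)).trans hb
  have hFc : HasCompactSupport F := by
    refine (isCompact_closedBall x₀ (ε / 2)).of_isClosed_subset (isClosed_tsupport F) ?_
    refine closure_minimal (fun s hs => ?_) Metric.isClosed_closedBall
    have : s ∈ Function.support (β.normed volume) := fun h =>
      hs (by simp only [F, h, Complex.ofReal_zero])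
    rw [β.support_normed_eq] at this
    exact Metric.ball_subset_closedBall this
  refine ⟨⟨F, Complex.ofRealCLM.contDiff.comp β.contDiff_normed, hFc, hFs.trans hSΩ⟩, hFs, ?_⟩
  change ∫ x, ((β.normed volume x : ℝ) : ℂ) = 1
  rw [integral_complex_ofReal, β.integral_normed, Complex.ofReal_one]

theorem testFunction_eq_zero {f : 𝓓(Ω, ℂ)} (h : tsupport f = ∅) : f = 0 := by
  ext x
  exact image_eq_zero_of_notMem_tsupport (by rw [h]; exact notMem_empty x)

theorem tsupport_sub_smul_subset (f χ : 𝓓(Ω, ℂ)) (a : ℂ) :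
    tsupport (f - a • χ : 𝓓(Ω, ℂ)) ⊆ tsupport f ∪ tsupport χ := by
  refine closure_minimal (fun x hx => ?_) ((isClosed_tsupport f).union (isClosed_tsupport χ))
  by_contra h
  simp only [mem_union, not_or] at h
  refine hx ?_
  change f x - a • χ x = 0
  rw [image_eq_zero_of_notMem_tsupport h.1, image_eq_zero_of_notMem_tsupport h.2]
  simp

theorem integral_sub_smul_eq_zero {f χ : 𝓓(Ω, ℂ)} (hχ : ∫ x, χ x = 1) :
    ∫ x, (f - (∫ x, f x) • χ : 𝓓(Ω, ℂ)) x = 0 := by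
  change ∫ x, (f x - (∫ x, f x) • χ x) = 0
  have h : Integrable fun x => (∫ x, f x) • χ x := (integrable_testFunction χ).smul (∫ x, f x)
  rw [integral_sub (integrable_testFunction f) h, integral_smul, hχ]
  simp

/-- A distribution with vanishing derivative on an open interval is constant there. -/
theorem exists_const_of_deriv_eq_zero {ξ : Distr Ω} {S : Set ℝ} (hS : IsOpen S)
    (hSc : S.OrdConnected) (hSΩ : S ⊆ Ω)
    (h : ∀ f : 𝓓(Ω, ℂ), tsupport f ⊆ S → ξ (testDeriv f) = 0) :
    ∃ k : ℂ, ∀ f : 𝓓(Ω, ℂ), tsupport f ⊆ S → ξ f = k * ∫ x, f x := by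
  rcases S.eq_empty_or_nonempty with rfl | hne
  · refine ⟨0, fun f hf => ?_⟩
    rw [testFunction_eq_zero (subset_empty_iff.1 hf), map_zero, zero_mul]
  obtain ⟨χ, hχS, hχ⟩ := exists_testFunction_integral_one hS hSΩ hne
  -- f - (∫ f)χ has integral 0, so it is the derivative of a test function supported in `S` and is
  -- annihilated by ξ.
  refine ⟨ξ χ, fun f hf => ?_⟩
  obtain ⟨a, b, hab, hK, hI⟩ := exists_Icc_of_isCompact
    (f.hasCompactSupport.isCompact.union χ.hasCompactSupport.isCompact) hSc
    (union_subset hf hχS) (by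
      refine Nonempty.inr ?_
      by_contra hcon
      rw [testFunction_eq_zero (not_nonempty_iff_eq_empty.1 hcon)] at hχ
      simp at hχ)
  obtain ⟨p, hp, hps, -⟩ := exists_primitive hab ((tsupport_sub_smul_subset f χ _).trans hK)
    (hI.trans hSΩ) (integral_sub_smul_eq_zero hχ)
  have h1 := h p (hps.trans hI)
  rw [hp, map_sub, map_smul, sub_eq_zero, smul_eq_mul] at h1
  rw [h1, mul_comm]

/-- Distributions on intervals have primitives. -/
theorem exists_distr_primitive (hΩ : (Ω : Set ℝ).OrdConnected) (T : Distr Ω) :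
    ∃ ξ : Distr Ω, ∀ f, ξ (testDeriv f) = T f := by
  rcases (Ω : Set ℝ).eq_empty_or_nonempty with hem | hne
  · refine ⟨0, fun f => ?_⟩
    rw [testFunction_eq_zero (subset_empty_iff.1 (f.tsupport_subset.trans hem.subset)), map_zero,
      map_zero,
      map_zero]
  obtain ⟨χ, -, hχ⟩ := exists_testFunction_integral_one Ω.isOpen subset_rfl hne
  have hχne : (tsupport χ).Nonempty := by
    by_contra hcon
    rw [testFunction_eq_zero (not_nonempty_iff_eq_empty.1 hcon)] at hχ
    simp at hχ
  -- Subtracting (∫ g)χ makes the integral zero. The map g ↦ P g is then a linear left inverse of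
  -- the derivative, and the required distribution is T ∘ P.
  have hP : ∀ g : 𝓓(Ω, ℂ), ∃ p : 𝓓(Ω, ℂ), testDeriv p = g - (∫ x, g x) • χ := by
    intro g
    obtain ⟨a, b, hab, hK, hI⟩ := exists_Icc_of_isCompact
      (g.hasCompactSupport.isCompact.union χ.hasCompactSupport.isCompact) hΩ
      (union_subset g.tsupport_subset χ.tsupport_subset) hχne.inr
    obtain ⟨p, hp, -⟩ := exists_primitive hab ((tsupport_sub_smul_subset g χ _).trans hK) hI
      (integral_sub_smul_eq_zero hχ)
    exact ⟨p, hp⟩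
  choose P hP using hP
  have hPadd : ∀ f g, P (f + g) = P f + P g := fun f g => testDeriv_injective (by
    rw [map_add, hP, hP, hP]
    have : ∫ x, (f + g) x = (∫ x, f x) + ∫ x, g x :=
      integral_add (integrable_testFunction f) (integrable_testFunction g)
    rw [this]
    module)
  have hPsmul : ∀ (a : ℂ) f, P (a • f) = a • P f := fun a f => testDeriv_injective (by
    rw [map_smul, hP, hP]
    have : ∫ x, (a • f) x = a • ∫ x, f x := integral_smul a _
    rw [this]
    module)
  obtain ⟨ξ, hξ⟩ := exists_distr_of_hasTestBounds (T := fun g => T (P g))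
    (fun f g => by rw [hPadd, map_add]) (fun a f => by rw [hPsmul, map_smul]) (by
      intro K hK hKΩ
      obtain ⟨a, b, hab, hKI, hI⟩ := exists_Icc_of_isCompact
        (hK.union χ.hasCompactSupport.isCompact) hΩ
        (union_subset hKΩ χ.tsupport_subset) hχne.inr
      obtain ⟨N, C, hC, hT⟩ := hasTestBounds T (Icc a b) isCompact_Icc hI
      obtain ⟨D, hD⟩ := exists_bound_iteratedDeriv (contDiff_testFunction χ) χ.hasCompactSupport N
      have hD0 : 0 ≤ D := (norm_nonneg _).trans (hD 0 (Nat.zero_le _) 0)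
      have hab' := sub_nonneg.2 hab
      -- For `f` bounded by `B` with its derivatives, |∫ f| ≤ (b - a)B. So f - (∫ f)χ is bounded to
      -- order `N` by (1 + (b - a)D)B, and taking the primitive costs at most a factor 1 + (b - a).
      refine ⟨N, C * ((1 + (b - a)) * (1 + (b - a) * D)), by positivity, fun f hf B hB => ?_⟩
      have hB0 : 0 ≤ B := (norm_nonneg _).trans (hB 0 (Nat.zero_le _) 0)
      obtain ⟨p, hp, hps, hpb⟩ := exists_primitive hab (((tsupport_sub_smul_subset f χ _).trans
        (union_subset_union_left _ hf)).trans hKI) hI (integral_sub_smul_eq_zero hχ)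
      have hpP : P f = p := testDeriv_injective (by rw [hP, hp])
      have hint : ‖∫ x, f x‖ ≤ (b - a) * B := by
        have h1 : ∫ x, f x = ∫ x in Icc a b, f x := by
          refine (setIntegral_eq_integral_of_forall_compl_eq_zero fun t ht => ?_).symm
          exact image_eq_zero_of_notMem_tsupport fun h => ht (hKI (Or.inl (hf h)))
        rw [h1]
        have h2 := norm_setIntegral_le_of_norm_le_const (μ := volume) (s := Icc a b) (f := f)
          (C := B) (by simp) fun x _ => by simpa using hB 0 (Nat.zero_le _) x
        simpa [Measure.real, hab', mul_comm] using h2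
      set g : 𝓓(Ω, ℂ) := f - (∫ x, f x) • χ with hg
      have hgb : ∀ k ≤ N, ∀ x, ‖iteratedDeriv k g x‖ ≤ (1 + (b - a) * D) * B := by
        intro k hk x
        have h1 : iteratedDeriv k g x =
            iteratedDeriv k f x - (∫ x, f x) • iteratedDeriv k χ x := by
          have hcf : ContDiffAt ℝ k f x :=
            ((contDiff_testFunction f).of_le (by exact_mod_cast le_top)).contDiffAt
          have hcχ : ContDiffAt ℝ k χ x :=
            ((contDiff_testFunction χ).of_le (by exact_mod_cast le_top)).contDiffAt
          have h2 : (g : ℝ → ℂ) = (f : ℝ → ℂ) - (∫ x, f x) • (χ : ℝ → ℂ) := rfl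
          have h3 : ContDiffAt ℝ k ((∫ x, f x) • (χ : ℝ → ℂ)) x := hcχ.const_smul (∫ x, f x)
          rw [h2, iteratedDeriv_sub hcf h3, iteratedDeriv_const_smul hcχ]
        rw [h1]
        refine (norm_sub_le _ _).trans ?_
        rw [norm_smul]
        calc _ ≤ B + ((b - a) * B) * D := by
              gcongr
              · exact hB k hk x
              · exact hD k hk x
          _ = _ := by ring
      have hgB0 : 0 ≤ (1 + (b - a) * D) * B := by positivity
      have h3 := hT p hps ((1 + (b - a)) * ((1 + (b - a) * D) * B)) (by
        intro k hk x
        rcases k with _ | k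
        · rw [iteratedDeriv_zero]
          refine (hpb _ (fun x => by simpa using hgb 0 (Nat.zero_le _) x) x).trans ?_
          gcongr
          linarith
        · have h4 : deriv p = (g : ℝ → ℂ) := by
            ext x
            rw [← testDeriv_apply, hp]
          rw [iteratedDeriv_succ', h4]
          refine (hgb k (by omega) x).trans ?_
          exact le_mul_of_one_le_left hgB0 (by linarith))
      dsimp only
      rw [hpP]
      refine h3.trans (le_of_eq ?_)
      ring)
  refine ⟨ξ, fun f => ?_⟩
  rw [hξ]
  congr 1
  -- A derivative has integral 0, so no multiple of χ is subtracted and P inverts the derivative.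
  refine testDeriv_injective ?_
  rw [hP, integral_testDeriv, zero_smul, sub_zero]

end Distributions

end SSF

namespace SSF

/-! ### The spectral change of variables on test functions -/

section ChangeOfVariables

variable {c : ℝ} {m : ℕ} {I : Opens ℝ}

/-- The inverse of `specMap`. -/
noncomputable def specInv (c : ℝ) (m : ℕ) (μ : ℝ) : ℝ := μ ^ (-(1 / (m : ℝ))) - c

theorem specMap_pos {x : ℝ} (hx : -c < x) : 0 < specMap c m x := by
  have : 0 < x + c := by linarith
  rw [specMap]
  positivity

theorem specMap_specInv (hm : 1 ≤ m) {μ : ℝ} (hμ : 0 < μ) : specMap c m (specInv c m μ) = μ := by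
  have hm0 : (m : ℝ) ≠ 0 := by positivity
  rw [specMap, specInv, sub_add_cancel, ← Real.rpow_natCast, ← Real.rpow_mul hμ.le]
  have : -(1 / (m : ℝ)) * m = -1 := by field_simp
  rw [this, Real.rpow_neg_one, inv_inv]

theorem specInv_specMap (hm : 1 ≤ m) {x : ℝ} (hx : -c < x) : specInv c m (specMap c m x) = x := by
  have hx' : 0 < x + c := by linarith
  rw [specInv, specMap, Real.rpow_neg (by positivity), Real.inv_rpow (by positivity), inv_inv,
    one_div, Real.pow_rpow_inv_natCast hx'.le (by omega), add_sub_cancel_right]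

theorem specInv_mem {μ : ℝ} (hμ : μ ∈ specImage c m I) : specInv c m μ ∈ I := hμ.2

theorem pos_of_mem_specImage {μ : ℝ} (hμ : μ ∈ specImage c m I) : 0 < μ := hμ.1

theorem contDiffOn_specInv : ContDiffOn ℝ ∞ (specInv c m) (Ioi 0) := fun _ hx =>
  ((Real.contDiffAt_rpow_const_of_ne (ne_of_gt hx)).sub contDiffAt_const).contDiffWithinAt

theorem hasDerivAt_specMap {x : ℝ} (hx : -c < x) :
    HasDerivAt (specMap c m) (-(m * ((x + c) ^ (m + 1))⁻¹)) x := by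
  have hx' : x + c ≠ 0 := by linarith
  have h1 : HasDerivAt (fun x : ℝ => (x + c) ^ m) (m * (x + c) ^ (m - 1)) x := by
    simpa using ((hasDerivAt_id x).add_const c).fun_pow m
  have h2 := h1.inv (pow_ne_zero m hx')
  refine h2.congr_deriv ?_
  rcases m with _ | m
  · simp
  · rw [Nat.add_sub_cancel]
    field_simp
    ring

theorem continuousOn_specMap : ContinuousOn (specMap c m) (Ioi (-c)) := fun _ hx =>
  (hasDerivAt_specMap hx).continuousAt.continuousWithinAt

theorem abs_deriv_specMap {x : ℝ} (hx : -c < x) :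
    |deriv (specMap c m) x| = m * ((x + c) ^ (m + 1))⁻¹ := by
  have hx' : 0 < x + c := by linarith
  rw [(hasDerivAt_specMap hx).deriv, abs_neg, abs_of_nonneg (by positivity)]

theorem ordConnected_specImage (hm : 1 ≤ m) (hI : (I : Set ℝ) ⊆ Ioi (-c))
    (hIc : (I : Set ℝ).OrdConnected) : (specImage c m I : Set ℝ).OrdConnected := by
  rw [coe_specImage hm hI]
  exact (hIc.isPreconnected.image _ (continuousOn_specMap.mono hI)).ordConnected

/-- The function `μ ↦ q μ * g (specInv c m μ)` on `(0, ∞)`. -/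
noncomputable def pullFun (c : ℝ) (m : ℕ) (q : ℝ → ℂ) (g : ℝ → ℂ) (μ : ℝ) : ℂ :=
  if 0 < μ then q μ * g (specInv c m μ) else 0

theorem pullFun_specMap (hm : 1 ≤ m) (q g : ℝ → ℂ) {x : ℝ} (hx : -c < x) :
    pullFun c m q g (specMap c m x) = q (specMap c m x) * g x := by
  rw [pullFun, if_pos (specMap_pos hx), specInv_specMap hm hx]

theorem tsupport_pullFun_subset (hm : 1 ≤ m) (q : ℝ → ℂ) {g : ℝ → ℂ} {K : Set ℝ}
    (hg : tsupport g ⊆ K) (hK : IsCompact K) (hKc : K ⊆ Ioi (-c)) :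
    tsupport (pullFun c m q g) ⊆ specMap c m '' K := by
  have hc : IsCompact (specMap c m '' K) := hK.image_of_continuousOn (continuousOn_specMap.mono hKc)
  refine closure_minimal (fun μ hμ => ?_) hc.isClosed
  rw [Function.mem_support, pullFun] at hμ
  split_ifs at hμ with h0
  · refine ⟨specInv c m μ, hg ?_, specMap_specInv hm h0⟩
    by_contra hcon
    exact hμ (by rw [image_eq_zero_of_notMem_tsupport hcon, mul_zero])
  · exact absurd rfl hμ

theorem pullFun_eventuallyEq (q g : ℝ → ℂ) {μ : ℝ} (hμ : 0 < μ) :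
    pullFun c m q g =ᶠ[𝓝 μ] fun μ => q μ * g (specInv c m μ) := by
  filter_upwards [lt_mem_nhds hμ] with ν hν
  rw [pullFun, if_pos hν]

/-- The root is singular at 0, but the support is contained in the image of a compact subset of (-c,
∞), which stays away from 0. -/
theorem contDiff_pullFun (hm : 1 ≤ m) {q g : ℝ → ℂ} (hq : ContDiffOn ℝ ∞ q (Ioi 0))
    (hg : ContDiff ℝ ∞ g) (hgc : HasCompactSupport g) (hgI : tsupport g ⊆ Ioi (-c)) :
    ContDiff ℝ ∞ (pullFun c m q g) := by
  rw [contDiff_iff_contDiffAt]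
  intro μ
  by_cases hμ : 0 < μ
  · have h1 : ContDiffAt ℝ ∞ (fun μ => q μ * g (specInv c m μ)) μ :=
      (hq.contDiffAt (Ioi_mem_nhds hμ)).mul
        (hg.contDiffAt.comp μ (contDiffOn_specInv.contDiffAt (Ioi_mem_nhds hμ)))
    exact h1.congr_of_eventuallyEq (pullFun_eventuallyEq q g hμ)
  · have h2 : μ ∉ tsupport (pullFun c m q g) := fun h => by
      obtain ⟨x, hx, rfl⟩ := tsupport_pullFun_subset hm q subset_rfl hgc.isCompact hgI h
      exact hμ (specMap_pos (hgI hx))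
    have h3 : pullFun c m q g =ᶠ[𝓝 μ] fun _ => 0 := notMem_tsupport_iff_eventuallyEq.1 h2
    exact contDiffAt_const.congr_of_eventuallyEq h3

/-- The derivative of q · (g ∘ ψ) is q' · (g ∘ ψ) + qψ' · (g' ∘ ψ), a sum of two terms of the same
shape. Keeping the weight `q` arbitrary makes the induction close. -/
theorem exists_bound_iteratedDeriv_comp {U : Set ℝ} (hU : IsOpen U) {ψ : ℝ → ℝ}
    (hψ : ContDiffOn ℝ ∞ ψ U) {K : Set ℝ} (hK : IsCompact K) (hKU : K ⊆ U) (k : ℕ) :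
    ∀ q : ℝ → ℂ, ContDiffOn ℝ ∞ q U → ∃ C, 0 ≤ C ∧ ∀ g : ℝ → ℂ, ContDiff ℝ ∞ g → ∀ B,
      (∀ j ≤ k, ∀ x, ‖iteratedDeriv j g x‖ ≤ B) →
      ∀ μ ∈ K, ‖iteratedDeriv k (fun μ => q μ * g (ψ μ)) μ‖ ≤ C * B := by
  induction k with
  | zero =>
    intro q hq
    obtain ⟨C, hC⟩ := hK.exists_bound_of_continuousOn (hq.continuousOn.mono hKU)
    refine ⟨|C|, abs_nonneg C, fun g _ B hB μ hμ => ?_⟩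
    rw [iteratedDeriv_zero, norm_mul]
    gcongr
    · exact (hC μ hμ).trans (le_abs_self C)
    · simpa using hB 0 le_rfl (ψ μ)
  | succ k ih =>
    intro q hq
    have hq' : ContDiffOn ℝ ∞ (deriv q) U := ((contDiffOn_infty_iff_deriv_of_isOpen hU).1 hq).2
    have hψ' : ContDiffOn ℝ ∞ (fun μ => q μ * ((deriv ψ μ : ℝ) : ℂ)) U :=
      hq.mul (Complex.ofRealCLM.contDiff.comp_contDiffOn
        ((contDiffOn_infty_iff_deriv_of_isOpen hU).1 hψ).2)
    obtain ⟨C₁, hC₁, h₁⟩ := ih _ hq'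
    obtain ⟨C₂, hC₂, h₂⟩ := ih _ hψ'
    refine ⟨C₁ + C₂, by positivity, fun g hg B hB μ hμ => ?_⟩
    have hg' : ContDiff ℝ ∞ (deriv g) := (contDiff_infty_iff_deriv.1 hg).2
    have hd : deriv (fun μ => q μ * g (ψ μ)) =ᶠ[𝓝 μ] fun ν =>
        deriv q ν * g (ψ ν) + (q ν * ((deriv ψ ν : ℝ) : ℂ)) * deriv g (ψ ν) := by
      filter_upwards [hU.mem_nhds (hKU hμ)] with ν hν
      have d1 : HasDerivAt q (deriv q ν) ν :=
        ((hq.contDiffAt (hU.mem_nhds hν)).differentiableAt (by simp)).hasDerivAt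
      have d2 : HasDerivAt ψ (deriv ψ ν) ν :=
        ((hψ.contDiffAt (hU.mem_nhds hν)).differentiableAt (by simp)).hasDerivAt
      have d3 : HasDerivAt g (deriv g (ψ ν)) (ψ ν) :=
        (hg.differentiable (by simp) _).hasDerivAt
      refine (d1.mul (d3.scomp ν d2)).deriv.trans ?_
      simp
      ring
    have hca : ∀ p : ℝ → ℂ, ContDiffOn ℝ ∞ p U → ∀ g : ℝ → ℂ, ContDiff ℝ ∞ g →
        ContDiffAt ℝ k (fun ν => p ν * g (ψ ν)) μ := fun p hp g hg =>
      ((hp.contDiffAt (hU.mem_nhds (hKU hμ))).mul (hg.contDiffAt.comp μ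
        (hψ.contDiffAt (hU.mem_nhds (hKU hμ))))).of_le (by exact_mod_cast le_top)
    rw [iteratedDeriv_succ', hd.iteratedDeriv_eq,
      iteratedDeriv_fun_add (hca _ hq' _ hg) (hca _ hψ' _ hg'), add_mul]
    refine (norm_add_le _ _).trans (add_le_add (h₁ g hg B (fun j hj => hB j (by omega)) μ hμ)
      (h₂ _ hg' B (fun j hj x => ?_) μ hμ))
    rw [← iteratedDeriv_succ']
    exact hB (j + 1) (by omega) x

/-- The test function `μ ↦ q μ * g (specInv c m μ)`. -/
noncomputable def pullTest (hm : 1 ≤ m) (hI : (I : Set ℝ) ⊆ Ioi (-c)) {q : ℝ → ℂ}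
    (hq : ContDiffOn ℝ ∞ q (Ioi 0)) (g : 𝓓(I, ℂ)) : 𝓓(specImage c m I, ℂ) :=
  have hs := tsupport_pullFun_subset hm q subset_rfl g.hasCompactSupport.isCompact
    (g.tsupport_subset.trans hI)
  ⟨pullFun c m q g, contDiff_pullFun hm hq (contDiff_testFunction g) g.hasCompactSupport
    (g.tsupport_subset.trans hI), ((g.hasCompactSupport.isCompact.image_of_continuousOn
    (continuousOn_specMap.mono (g.tsupport_subset.trans hI)))).of_isClosed_subset
      (isClosed_tsupport _) hs, hs.trans (by
      rw [coe_specImage hm hI]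
      exact image_mono g.tsupport_subset)⟩

theorem testFunction_ext_specMap (hm : 1 ≤ m) {h h' : 𝓓(specImage c m I, ℂ)}
    (H : ∀ x ∈ I, h (specMap c m x) = h' (specMap c m x)) : h = h' := by
  ext μ
  by_cases hμ : μ ∈ specImage c m I
  · have := H _ (specInv_mem hμ)
    rwa [specMap_specInv hm (pos_of_mem_specImage hμ)] at this
  · rw [image_eq_zero_of_notMem_tsupport fun h1 => hμ (h.tsupport_subset h1),
      image_eq_zero_of_notMem_tsupport fun h1 => hμ (h'.tsupport_subset h1)]

theorem hasTestBounds_pullTest (hm : 1 ≤ m) (hI : (I : Set ℝ) ⊆ Ioi (-c)) {q : ℝ → ℂ}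
    (hq : ContDiffOn ℝ ∞ q (Ioi 0)) (η : Distr (specImage c m I)) :
    HasTestBounds fun g : 𝓓(I, ℂ) => η (pullTest hm hI hq g) := by
  intro K hK hKI
  have hK' : IsCompact (specMap c m '' K) :=
    hK.image_of_continuousOn (continuousOn_specMap.mono (hKI.trans hI))
  have hK'I : specMap c m '' K ⊆ specImage c m I := by
    rw [coe_specImage hm hI]
    exact image_mono hKI
  have hK'0 : specMap c m '' K ⊆ Ioi 0 := fun μ hμ => pos_of_mem_specImage (hK'I hμ)
  obtain ⟨N, C, hC, h⟩ := hasTestBounds η _ hK' hK'I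
  choose D hD0 hD using fun k =>
    exists_bound_iteratedDeriv_comp isOpen_Ioi (contDiffOn_specInv (c := c) (m := m)) hK' hK'0
      k q hq
  refine ⟨N, C * ∑ k ∈ Finset.range (N + 1), D k,
    mul_nonneg hC (Finset.sum_nonneg fun k _ => hD0 k), fun g hg B hB => ?_⟩
  have hB0 : 0 ≤ B := (norm_nonneg _).trans (hB 0 (Nat.zero_le _) 0)
  have hs : tsupport (pullTest hm hI hq g) ⊆ specMap c m '' K :=
    tsupport_pullFun_subset hm q hg hK (hKI.trans hI)
  rw [mul_assoc]
  refine h _ hs _ fun k hk μ => ?_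
  by_cases hμ : μ ∈ specMap c m '' K
  · have h1 : iteratedDeriv k (pullTest hm hI hq g) μ = _ :=
      (pullFun_eventuallyEq (c := c) (m := m) q g (hK'0 hμ)).iteratedDeriv_eq k
    rw [h1]
    refine (hD k g (contDiff_testFunction g) B (fun j hj => hB j (by omega)) μ hμ).trans ?_
    gcongr
    exact Finset.single_le_sum (fun j _ => hD0 j) (by simp; omega)
  · have h1 : (pullTest hm hI hq g : ℝ → ℂ) =ᶠ[𝓝 μ] fun _ => 0 :=
      notMem_tsupport_iff_eventuallyEq.1 fun h => hμ (hs h)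
    rw [h1.iteratedDeriv_eq]
    simp only [iteratedDeriv_fun_const_zero, norm_zero]
    exact mul_nonneg (Finset.sum_nonneg fun k _ => hD0 k) hB0

/-- Each `g` has exactly one partner, h = (g / |φ'|) ∘ φ⁻¹, so the defining relation prescribes ξ;
only continuity of the assignment has to be proved. -/
theorem existsUnique_isComposition (hm : 1 ≤ m) (hI : (I : Set ℝ) ⊆ Ioi (-c))
    (η : Distr (specImage c m I)) : ∃! ξ : Distr I, IsComposition c m ξ η := by
  -- `q` is 1/|φ'| expressed in the variable μ = φ(x), since |φ'(x)| = m (x + c)^(-(m+1)).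
  set q : ℝ → ℂ := fun μ => (((specInv c m μ + c) ^ (m + 1) / m : ℝ) : ℂ) with hqd
  have hq : ContDiffOn ℝ ∞ q (Ioi 0) := Complex.ofRealCLM.contDiff.comp_contDiffOn
    (((contDiffOn_specInv.add contDiffOn_const).pow (m + 1)).div_const _)
  have hspec : ∀ g : 𝓓(I, ℂ), ∀ x ∈ I, g x =
      ((|deriv (specMap c m) x| : ℝ) : ℂ) * pullTest hm hI hq g (specMap c m x) := by
    intro g x hx
    have hxc : -c < x := hI hx
    have hx' : ((x : ℂ) + c) ≠ 0 := by
      have : x + c ≠ 0 := by linarith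
      exact_mod_cast this
    have hm0 : (m : ℂ) ≠ 0 := by exact_mod_cast (by omega : m ≠ 0)
    change _ = _ * pullFun c m q g (specMap c m x)
    rw [pullFun_specMap hm _ _ hxc, abs_deriv_specMap hxc, hqd]
    dsimp only
    rw [specInv_specMap hm hxc]
    push_cast
    field_simp
  obtain ⟨ξ, hξ⟩ := exists_distr_of_hasTestBounds (T := fun g => η (pullTest hm hI hq g))
    (fun f g => by
      rw [← map_add]
      congr 1
      refine testFunction_ext_specMap hm fun x hx => ?_
      change pullFun c m q _ _ = pullFun c m q f _ + pullFun c m q g _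
      rw [pullFun_specMap hm _ _ (hI hx), pullFun_specMap hm _ _ (hI hx),
        pullFun_specMap hm _ _ (hI hx)]
      exact mul_add _ _ _) (fun a f => by
      rw [← map_smul]
      congr 1
      refine testFunction_ext_specMap hm fun x hx => ?_
      change pullFun c m q _ _ = a * pullFun c m q f _
      rw [pullFun_specMap hm _ _ (hI hx), pullFun_specMap hm _ _ (hI hx)]
      exact mul_left_comm _ a _) (hasTestBounds_pullTest hm hI hq η)
  refine ⟨ξ, fun g h hgh => ?_, fun ξ' hξ' => ?_⟩
  · rw [hξ]
    congr 1
    refine testFunction_ext_specMap hm fun x hx => ?_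
    have h1 := (hspec g x hx).symm.trans (hgh x hx)
    refine mul_left_cancel₀ ?_ h1
    rw [abs_deriv_specMap (hI hx)]
    have hx' : 0 < x + c := by have := hI hx; rw [mem_Ioi] at this; linarith
    have : (0 : ℝ) < m * ((x + c) ^ (m + 1))⁻¹ := by positivity
    exact_mod_cast this.ne'
  · ext g
    rw [hξ, hξ' g _ (hspec g)]

/-- The test function `f ∘ specInv`. -/
noncomputable def pushTest (hm : 1 ≤ m) (hI : (I : Set ℝ) ⊆ Ioi (-c)) (f : 𝓓(I, ℂ)) :
    𝓓(specImage c m I, ℂ) :=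
  pullTest hm hI (q := fun _ => 1) contDiffOn_const f

theorem pushTest_specMap (hm : 1 ≤ m) (hI : (I : Set ℝ) ⊆ Ioi (-c)) (f : 𝓓(I, ℂ)) {x : ℝ}
    (hx : x ∈ I) : pushTest hm hI f (specMap c m x) = f x :=
  (pullFun_specMap hm (fun _ => 1) f (hI hx)).trans (one_mul _)

/-- Writing f = h ∘ φ with φ decreasing, f' = -|φ'| (h' ∘ φ); the sign is the one in the definition
of the distributional derivative. -/
theorem IsComposition.testDeriv_eq (hm : 1 ≤ m) (hI : (I : Set ℝ) ⊆ Ioi (-c)) {ξ : Distr I}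
    {η : Distr (specImage c m I)} (h : IsComposition c m ξ η) (f : 𝓓(I, ℂ)) :
    ξ (testDeriv f) = distrDeriv η (pushTest hm hI f) := by
  have h1 := h (testDeriv f) (-testDeriv (pushTest hm hI f)) (fun x hx => by
    have hxc : -c < x := hI hx
    have hx' : 0 < x + c := by linarith
    have d1 := ((contDiff_testFunction (pushTest hm hI f)).differentiable (by simp)
      (specMap c m x)).hasDerivAt.scomp x (hasDerivAt_specMap hxc)
    have d2 : HasDerivAt f _ x := d1.congr_of_eventuallyEq (by
      filter_upwards [I.isOpen.mem_nhds hx] with y hy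
      exact (pushTest_specMap hm hI f hy).symm)
    rw [testDeriv_apply, d2.deriv, abs_deriv_specMap hxc]
    change _ = _ * -(testDeriv (pushTest hm hI f) (specMap c m x))
    rw [testDeriv_apply]
    simp)
  rw [h1, map_neg]
  rfl

end ChangeOfVariables

end SSF

namespace SSF

set_option linter.unusedSectionVars false

/-! ### The complex change of variables -/

section SpecInvC

variable {c : ℝ} {m : ℕ} {w : ℂ}

/-- The principal `m`-th root. -/
noncomputable def specRoot (m : ℕ) (w : ℂ) : ℂ := w ^ ((m : ℂ)⁻¹)

/-- The inverse of `z ↦ (z + c) ^ (-m)`, on the right half-plane. -/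
noncomputable def specInvC (c : ℝ) (m : ℕ) (w : ℂ) : ℂ := (specRoot m w)⁻¹ - c

theorem ne_zero_of_re_pos (hw : 0 < w.re) : w ≠ 0 := by
  rintro rfl
  simp at hw

theorem specRoot_pow (hm : 1 ≤ m) (w : ℂ) : specRoot m w ^ m = w :=
  Complex.cpow_nat_inv_pow w (by omega)

theorem specRoot_ne_zero (hm : 1 ≤ m) (hw : 0 < w.re) : specRoot m w ≠ 0 := fun h => by
  have := specRoot_pow hm w
  rw [h, zero_pow (by omega)] at this
  exact ne_zero_of_re_pos hw this.symm

theorem specInvC_add (c : ℝ) (m : ℕ) (w : ℂ) : specInvC c m w + c = (specRoot m w)⁻¹ := by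
  rw [specInvC, sub_add_cancel]

theorem arg_specRoot (hm : 1 ≤ m) (hw : w ≠ 0) : (specRoot m w).arg = w.arg / m := by
  have hm' : (0 : ℝ) < m := by exact_mod_cast hm
  have hm1 : (1 : ℝ) ≤ m := by exact_mod_cast hm
  have h1 : specRoot m w = Complex.exp (Complex.log w * (m : ℂ)⁻¹) := by
    rw [specRoot, Complex.cpow_def_of_ne_zero hw]
  have h2 : (Complex.log w * (m : ℂ)⁻¹).im = w.arg / m := by
    rw [← Complex.ofReal_natCast, ← Complex.ofReal_inv, Complex.im_mul_ofReal, Complex.log_im]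
    rfl
  have h3 := Complex.neg_pi_lt_arg w
  have h4 := Complex.arg_le_pi w
  have h5 := Real.pi_pos
  rw [h1, Complex.arg_exp, h2, toIocMod_eq_self]
  constructor
  · rw [lt_div_iff₀ hm']
    nlinarith
  · rw [div_le_iff₀ hm']
    nlinarith

theorem abs_arg_lt_pi_div_two (hw : 0 < w.re) : |w.arg| < Real.pi / 2 :=
  Complex.abs_arg_lt_pi_div_two_iff.2 (Or.inl hw)

theorem specInvC_sector (hm : 1 ≤ m) (hw : 0 < w.re) :
    specInvC c m w + c ≠ 0 ∧ |(specInvC c m w + c).arg| < Real.pi / (2 * m) := by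
  have hm' : (0 : ℝ) < m := by exact_mod_cast hm
  rw [specInvC_add]
  refine ⟨inv_ne_zero (specRoot_ne_zero hm hw), ?_⟩
  rw [Complex.abs_arg_inv, arg_specRoot hm (ne_zero_of_re_pos hw), abs_div, abs_of_pos hm',
    div_lt_iff₀ hm']
  refine (abs_arg_lt_pi_div_two hw).trans_eq ?_
  field_simp

theorem re_pow_pos {ζ : ℂ} (hm : 1 ≤ m) (h0 : ζ ≠ 0) (h : |ζ.arg| < Real.pi / (2 * m)) :
    0 < (ζ ^ m).re := by
  have hm' : (0 : ℝ) < m := by exact_mod_cast hm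
  rw [← Complex.norm_mul_exp_arg_mul_I ζ, mul_pow, ← Complex.exp_nat_mul, ← Complex.ofReal_pow,
    Complex.re_ofReal_mul]
  refine mul_pos (pow_pos (norm_pos_iff.2 h0) m) ?_
  have : (m : ℂ) * (ζ.arg * Complex.I) = ((m * ζ.arg : ℝ) : ℂ) * Complex.I := by push_cast; ring
  rw [this, Complex.exp_ofReal_mul_I_re]
  refine Real.cos_pos_of_mem_Ioo (abs_lt.1 ?_)
  rw [abs_mul, abs_of_pos hm']
  rw [lt_div_iff₀ (by positivity)] at h
  linarith

/-- The map `z ↦ (z + c) ^ (-m)`. -/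
noncomputable def specMapC (c : ℝ) (m : ℕ) (z : ℂ) : ℂ := ((z + c)⁻¹) ^ m

theorem specMapC_specInvC (hm : 1 ≤ m) (w : ℂ) : specMapC c m (specInvC c m w) = w := by
  rw [specMapC, specInvC_add, inv_inv, specRoot_pow hm]

theorem specMapC_re_pos {z : ℂ} (hm : 1 ≤ m) (h0 : z + c ≠ 0)
    (h : |(z + c).arg| < Real.pi / (2 * m)) : 0 < (specMapC c m z).re :=
  re_pow_pos hm (inv_ne_zero h0) (by rwa [Complex.abs_arg_inv])

theorem specInvC_specMapC {z : ℂ} (hm : 1 ≤ m)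
    (h : |(z + c).arg| < Real.pi / (2 * m)) : specInvC c m (specMapC c m z) = z := by
  have hm' : (0 : ℝ) < m := by exact_mod_cast hm
  have h1 : Real.pi / (2 * m) < Real.pi / m := by
    have := Real.pi_pos
    gcongr
    linarith
  have h2 : |((z + c)⁻¹).arg| < Real.pi / m := by rw [Complex.abs_arg_inv]; exact h.trans h1
  rw [specInvC, specRoot, specMapC, Complex.pow_cpow_nat_inv (by omega) (abs_lt.1 h2).1
    (abs_lt.1 h2).2.le, inv_inv, add_sub_cancel_right]

theorem hasDerivAt_specInvC (hm : 1 ≤ m) (hw : 0 < w.re) :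
    HasDerivAt (specInvC c m) (-(m * specRoot m w ^ (m + 1))⁻¹) w := by
  have h1 : HasDerivAt (specRoot m) ((m : ℂ)⁻¹ * w ^ ((m : ℂ)⁻¹ - 1) * 1) w :=
    (hasDerivAt_id w).cpow_const (Or.inl hw)
  have hr := specRoot_ne_zero hm hw
  have hm0 : (m : ℂ) ≠ 0 := by exact_mod_cast (by omega : m ≠ 0)
  have hw0 := ne_zero_of_re_pos hw
  refine ((h1.inv hr).sub_const _).congr_deriv ?_
  rw [Complex.cpow_sub _ _ hw0, Complex.cpow_one]
  change -((m : ℂ)⁻¹ * (specRoot m w / w) * 1) / specRoot m w ^ 2 = _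
  nth_rw 2 [← specRoot_pow hm w]
  field_simp
  ring

theorem differentiableAt_specRoot (hw : 0 < w.re) : DifferentiableAt ℂ (specRoot m) w :=
  ((hasDerivAt_id w).cpow_const (Or.inl hw)).differentiableAt

theorem specInvC_ofReal {μ : ℝ} (hμ : 0 < μ) :
    specInvC c m μ = ((μ ^ (-(1 / (m : ℝ))) - c : ℝ) : ℂ) := by
  rw [specInvC, specRoot, one_div, Real.rpow_neg hμ.le]
  push_cast
  rw [Complex.ofReal_cpow hμ.le]
  push_cast
  rfl

theorem abs_im_pow_le (ζ : ℂ) (m : ℕ) : |(ζ ^ m).im| ≤ m * ‖ζ‖ ^ (m - 1) * |ζ.im| := by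
  induction m with
  | zero => simp
  | succ m ih =>
    rcases m.eq_zero_or_pos with rfl | hm
    · simp
    rw [pow_succ, Complex.mul_im, Nat.add_sub_cancel]
    calc |(ζ ^ m).re * ζ.im + (ζ ^ m).im * ζ.re|
        ≤ |(ζ ^ m).re| * |ζ.im| + |(ζ ^ m).im| * |ζ.re| := by
          rw [← abs_mul, ← abs_mul]
          exact abs_add_le _ _
      _ ≤ ‖ζ‖ ^ m * |ζ.im| + m * ‖ζ‖ ^ (m - 1) * |ζ.im| * ‖ζ‖ := by
          gcongr
          · exact (Complex.abs_re_le_norm _).trans (norm_pow ζ m).le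
          · exact Complex.abs_re_le_norm ζ
      _ = ((m + 1 : ℕ) : ℝ) * ‖ζ‖ ^ m * |ζ.im| := by
          obtain ⟨k, rfl⟩ : ∃ k, m = k + 1 := ⟨m - 1, by omega⟩
          rw [Nat.add_sub_cancel]
          push_cast
          ring

/-- Apply `abs_im_pow_le` to the root ζ of w and use Im(1/ζ) = -Im ζ / |ζ|². This turns a blow-up of
the resolvent in Im ψ(w) into one in Im w. -/
theorem abs_im_le_specInvC (hm : 1 ≤ m) (hw : 0 < w.re) :
    |w.im| ≤ m * ‖specRoot m w‖ ^ (m + 1) * |(specInvC c m w).im| := by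
  have hr := specRoot_ne_zero hm hw
  have h1 := abs_im_pow_le (specRoot m w) m
  rw [specRoot_pow hm] at h1
  have h2 : (specInvC c m w).im = -(specRoot m w).im / ‖specRoot m w‖ ^ 2 := by
    rw [specInvC, Complex.sub_im, Complex.ofReal_im, sub_zero, Complex.inv_im,
      Complex.normSq_eq_norm_sq]
  have h3 : |(specRoot m w).im| = ‖specRoot m w‖ ^ 2 * |(specInvC c m w).im| := by
    have : ‖specRoot m w‖ ≠ 0 := norm_ne_zero_iff.2 hr
    rw [h2, abs_div, abs_neg, abs_of_nonneg (sq_nonneg ‖specRoot m w‖)]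
    field_simp
  refine h1.trans (le_of_eq ?_)
  obtain ⟨k, rfl⟩ : ∃ k, m = k + 1 := ⟨m - 1, by omega⟩
  rw [h3, Nat.add_sub_cancel]
  ring

end SpecInvC

/-! ### The resolvent of a power of the resolvent -/

section Power

variable {E : Type*} [NormedAddCommGroup E] [NormedSpace ℂ E] [CompleteSpace E]
  {L : E →ₗ.[ℂ] E} {c : ℝ} {m : ℕ}

/-- The map `z ↦ (z + c) ^ m` takes its values on the sector `|arg (z + c)| < π / (2 m)` at no
other point of the spectrum of `L`. -/
structure IsPowerAdmissible (L : E →ₗ.[ℂ] E) (c : ℝ) (m : ℕ) : Prop where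
  one_le : 1 ≤ m
  neg_mem : -(c : ℂ) ∈ resolventSet L
  eq_of_pow_eq : ∀ l ∈ spectrum L, ∀ z : ℂ, z + c ≠ 0 → |(z + c).arg| < Real.pi / (2 * m) →
    (l + c) ^ m = (z + c) ^ m → l = z

theorem isResolventAt_ofBounded {X S : E →L[ℂ] E} {w : ℂ} (h1 : (X - w • 1) * S = 1)
    (h2 : S * (X - w • 1) = 1) : IsResolventAt (ofBounded X) w S := by
  constructor
  · intro u
    refine ⟨Submodule.mem_top, ?_⟩
    exact DFunLike.congr_fun h1 u
  · intro u
    exact DFunLike.congr_fun h2 (u : E)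

/-- With R = (L + c)⁻¹ and l = x⁻¹ - c, formally R - x = -x (L - l)R. Its inverse is therefore
-x⁻¹(L + c)(L - l)⁻¹, and L + c = (L - l) + x⁻¹. -/
theorem resolvent_sub_inverse {x : ℂ} (hx : x ≠ 0) (hc : -(c : ℂ) ∈ resolventSet L)
    (hl : x⁻¹ - c ∈ resolventSet L) :
    (resolvent L (-(c : ℂ)) - x • 1) *
      (-x⁻¹ • (1 + x⁻¹ • resolvent L (x⁻¹ - c))) = 1 ∧
    (-x⁻¹ • (1 + x⁻¹ • resolvent L (x⁻¹ - c))) *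
      (resolvent L (-(c : ℂ)) - x • 1) = 1 := by
  have h1 := resolvent_identity hc hl
  have h2 := resolvent_identity hl hc
  set R := resolvent L (-(c : ℂ))
  set S := resolvent L (x⁻¹ - c)
  have e1 : (-(c : ℂ) - (x⁻¹ - c)) = -x⁻¹ := by ring
  have e2 : ((x⁻¹ - c) - -(c : ℂ)) = x⁻¹ := by ring
  rw [e1] at h1
  rw [e2] at h2
  have h1' : x⁻¹ • (R * S) = S - R := by rw [← neg_sub R S, h1, neg_smul, neg_neg]
  constructor
  · rw [mul_smul_comm, sub_mul, mul_add, mul_one, mul_smul_comm, h1', smul_mul_assoc, one_mul,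
      smul_add, smul_smul, mul_inv_cancel₀ hx, one_smul, add_sub_cancel, sub_add_cancel_right,
      smul_neg, neg_smul, neg_neg, smul_smul, inv_mul_cancel₀ hx, one_smul]
  · rw [smul_mul_assoc, mul_sub, add_mul, one_mul, smul_mul_assoc, ← h2, mul_smul_comm, mul_one,
      smul_add, smul_smul, mul_inv_cancel₀ hx, one_smul, add_sub_cancel, sub_add_cancel_right,
      smul_neg, neg_smul, neg_neg, smul_smul, inv_mul_cancel₀ hx, one_smul]

theorem mem_spectrum_of_mem_spectrum_resolvent {x : ℂ} (hx : x ≠ 0)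
    (hc : -(c : ℂ) ∈ resolventSet L) (h : x ∈ _root_.spectrum ℂ (resolvent L (-(c : ℂ)))) :
    x⁻¹ - c ∈ spectrum L := by
  intro hl
  obtain ⟨h1, h2⟩ := resolvent_sub_inverse hx hc hl
  refine h ?_
  rw [_root_.spectrum.mem_resolventSet_iff, Algebra.algebraMap_eq_smul_one, ← IsUnit.neg_iff,
    neg_sub]
  exact ⟨⟨_, _, h1, h2⟩, rfl⟩

/-- The quotient of `R ^ m - x ^ m` by `R - x`. -/
noncomputable def geomOp (R : E →L[ℂ] E) (m : ℕ) (x : ℂ) : E →L[ℂ] E :=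
  ∑ j ∈ Finset.range m, x ^ (m - 1 - j) • R ^ j

theorem geomOp_commute (R : E →L[ℂ] E) (m : ℕ) (x : ℂ) : Commute (R - x • 1) (geomOp R m x) := by
  refine Commute.sum_right _ _ _ fun j _ => ?_
  have h1 : Commute R (R ^ j) := Commute.self_pow R j
  exact ((h1.sub_left ((Commute.one_left _).smul_left x)).smul_right _)

theorem sub_mul_geomOp (R : E →L[ℂ] E) (m : ℕ) (x : ℂ) :
    (R - x • 1) * geomOp R m x = R ^ m - x ^ m • 1 := by
  have h : Commute R (x • (1 : E →L[ℂ] E)) := (Commute.one_right R).smul_right x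
  have h1 := h.mul_geom_sum₂ m
  rw [smul_pow, one_pow] at h1
  rw [← h1, geomOp]
  congr 1
  refine Finset.sum_congr rfl fun j _ => ?_
  rw [smul_pow, one_pow, mul_smul_comm, mul_one]

/-- The operator is p(R) with p(y) = (y^m - x^m)/(y - x). By spectral mapping, failure of
invertibility gives y in σ(R) with p(y) = 0, hence y^m = x^m. Then 1/y - c lies in σ(L), and power
admissibility forces y = x; but p(x) = m x^(m-1) ≠ 0. -/
theorem isUnit_geomOp (hL : IsPowerAdmissible L c m) {x : ℂ} (hx0 : x ≠ 0)
    (hx : |x.arg| < Real.pi / (2 * m)) : IsUnit (geomOp (resolvent L (-(c : ℂ))) m x) := by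
  rcases subsingleton_or_nontrivial (E →L[ℂ] E) with _ | _
  · exact isUnit_of_subsingleton _
  set R := resolvent L (-(c : ℂ))
  set p : Polynomial ℂ := ∑ j ∈ Finset.range m,
    Polynomial.C (x ^ (m - 1 - j)) * Polynomial.X ^ j with hp
  have hpR : Polynomial.aeval R p = geomOp R m x := by
    simp [hp, geomOp, Algebra.smul_def]
  have hpe : ∀ y, p.eval y = ∑ j ∈ Finset.range m, x ^ (m - 1 - j) * y ^ j := fun y => by
    simp [hp, Polynomial.eval_finsetSum]
  by_contra hu
  have h0 : (0 : ℂ) ∈ _root_.spectrum ℂ (Polynomial.aeval R p) := by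
    rw [hpR, _root_.spectrum.zero_mem_iff]
    exact hu
  rw [_root_.spectrum.map_polynomial_aeval_of_nonempty R p (_root_.spectrum.nonempty R)] at h0
  obtain ⟨y, hy, hy0⟩ := h0
  dsimp only at hy0
  rw [hpe] at hy0
  have hpow : y ^ m = x ^ m := by
    have h1 := (Commute.all y x).mul_geom_sum₂ m
    have h2 : ∑ i ∈ Finset.range m, y ^ i * x ^ (m - 1 - i) = 0 := by
      rw [← hy0]
      exact Finset.sum_congr rfl fun j _ => mul_comm _ _
    rw [h2, mul_zero] at h1
    exact (sub_eq_zero.1 h1.symm)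
  have hm := hL.one_le
  have hy0' : y ≠ 0 := by
    rintro rfl
    rw [zero_pow (by omega)] at hpow
    exact hx0 (pow_eq_zero_iff (by omega) |>.1 hpow.symm)
  have hs := mem_spectrum_of_mem_spectrum_resolvent hy0' hL.neg_mem hy
  have hyx := hL.eq_of_pow_eq _ hs (x⁻¹ - c) (by simpa using hx0)
    (by rwa [sub_add_cancel, Complex.abs_arg_inv])
    (by rw [sub_add_cancel, sub_add_cancel, inv_pow, inv_pow, hpow])
  have hyx' : y = x := by simpa using hyx
  rw [hyx'] at hy0
  have h3 : ∑ j ∈ Finset.range m, x ^ (m - 1 - j) * x ^ j = m * x ^ (m - 1) := by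
    rw [Finset.sum_congr rfl (g := fun _ => x ^ (m - 1)) fun j hj => ?_]
    · simp
    · rw [← pow_add]
      congr 1
      have := Finset.mem_range.1 hj
      omega
  rw [h3] at hy0
  have hm0 : (m : ℂ) ≠ 0 := by exact_mod_cast (by omega : m ≠ 0)
  exact mul_ne_zero hm0 (pow_ne_zero _ hx0) hy0

/-- The second-order quotient: `(geomOp R m x - m x ^ (m - 1)) / (R - x)`. -/
noncomputable def geomOp₂ (R : E →L[ℂ] E) (m : ℕ) (x : ℂ) : E →L[ℂ] E :=
  ∑ j ∈ Finset.range m, x ^ (m - 1 - j) • geomOp R j x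

theorem sub_mul_geomOp₂ (R : E →L[ℂ] E) (m : ℕ) (x : ℂ) :
    (R - x • 1) * geomOp₂ R m x = geomOp R m x - (m * x ^ (m - 1)) • 1 := by
  rw [geomOp₂, Finset.mul_sum]
  simp only [mul_smul_comm, sub_mul_geomOp, smul_sub, Finset.sum_sub_distrib]
  congr 1
  rw [Finset.sum_congr rfl (g := fun _ => x ^ (m - 1) • (1 : E →L[ℂ] E)) fun j hj => ?_]
  · rw [Finset.sum_const, Finset.card_range, ← Nat.cast_smul_eq_nsmul ℂ, smul_smul]
  · rw [smul_smul, ← pow_add]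
    congr 2
    have := Finset.mem_range.1 hj
    omega

theorem differentiableAt_geomOp (R : E →L[ℂ] E) (m : ℕ) {ρ : ℂ → ℂ} {w : ℂ}
    (hρ : DifferentiableAt ℂ ρ w) : DifferentiableAt ℂ (fun w => geomOp R m (ρ w)) w := by
  unfold geomOp
  fun_prop

theorem differentiableAt_geomOp₂ (R : E →L[ℂ] E) (m : ℕ) {ρ : ℂ → ℂ} {w : ℂ}
    (hρ : DifferentiableAt ℂ ρ w) : DifferentiableAt ℂ (fun w => geomOp₂ R m (ρ w)) w := by
  unfold geomOp₂ geomOp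
  fun_prop

/-- The resolvent of `(L + c) ^ (-m)` is, up to a holomorphic term, the pull-back of the resolvent
of `L`. -/
theorem exists_resolvent_negPow_eq (hL : IsPowerAdmissible L c m) :
    ∃ D : ℂ → E →L[ℂ] E, (∀ w : ℂ, 0 < w.re → DifferentiableAt ℂ D w) ∧
      ∀ w : ℂ, 0 < w.re → specInvC c m w ∈ resolventSet L →
        w ∈ resolventSet (ofBounded (negPow L c m)) ∧
        resolvent (ofBounded (negPow L c m)) w =
          deriv (specInvC c m) w • resolvent L (specInvC c m w) - D w := by
  have hm := hL.one_le
  have hm0 : (m : ℂ) ≠ 0 := by exact_mod_cast (by omega : m ≠ 0)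
  set R := resolvent L (-(c : ℂ)) with hR
  have hunit : ∀ w : ℂ, 0 < w.re → IsUnit (geomOp R m (specRoot m w)) := fun w hw => by
    refine isUnit_geomOp hL (specRoot_ne_zero hm hw) ?_
    have := (specInvC_sector (c := c) hm hw).2
    rwa [specInvC_add, Complex.abs_arg_inv] at this
  -- X - w = (R - x)P and P = m x^(m-1) + (R - x)Q. So (X - w)⁻¹ = a (R - x)⁻¹ - a Q P⁻¹ with a = (m
  -- x^(m-1))⁻¹. Inserting `resolvent_sub_inverse`, the singular part has coefficient -(m x^(m+1))⁻¹
  -- = ψ'(w), and the rest is -D(w).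
  refine ⟨fun w => (m * specRoot m w ^ m)⁻¹ • 1 + (m * specRoot m w ^ (m - 1))⁻¹ •
    (geomOp₂ R m (specRoot m w) * Ring.inverse (geomOp R m (specRoot m w))), fun w hw => ?_,
    fun w hw hl => ?_⟩
  · have h1 := differentiableAt_specRoot (m := m) hw
    have h2 := specRoot_ne_zero hm hw
    have h3 : DifferentiableAt ℂ (fun w => (m * specRoot m w ^ m)⁻¹) w :=
      ((h1.pow m).const_mul _).inv (mul_ne_zero hm0 (pow_ne_zero _ h2))
    have h4 : DifferentiableAt ℂ (fun w => (m * specRoot m w ^ (m - 1))⁻¹) w :=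
      ((h1.pow (m - 1)).const_mul _).inv (mul_ne_zero hm0 (pow_ne_zero _ h2))
    have h5 : DifferentiableAt ℂ (fun w => Ring.inverse (geomOp R m (specRoot m w))) w := by
      have h6 : DifferentiableAt ℂ (Ring.inverse : (E →L[ℂ] E) → E →L[ℂ] E)
          (geomOp R m (specRoot m w)) :=
        differentiableAt_inverse (hunit w hw)
      exact h6.comp w (differentiableAt_geomOp R m h1)
    exact (h3.smul_const _).add (h4.smul ((differentiableAt_geomOp₂ R m h1).mul h5))
  · have hx := specRoot_ne_zero hm hw
    set x := specRoot m w with hxd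
    have hxw : x ^ m = w := specRoot_pow hm w
    set P := geomOp R m x with hP
    set Q := geomOp₂ R m x with hQ
    set S := resolvent L (specInvC c m w) with hS
    obtain ⟨h1, h2⟩ := resolvent_sub_inverse hx hL.neg_mem hl
    change (R - x • 1) * (-x⁻¹ • (1 + x⁻¹ • S)) = 1 at h1
    change (-x⁻¹ • (1 + x⁻¹ • S)) * (R - x • 1) = 1 at h2
    obtain ⟨T, hT⟩ : ∃ T, T = -x⁻¹ • (1 + x⁻¹ • S) := ⟨_, rfl⟩
    rw [← hT] at h1 h2
    have hPu := hunit w hw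
    have hP1 : P * Ring.inverse P = 1 := Ring.mul_inverse_cancel _ hPu
    have hP2 : Ring.inverse P * P = 1 := Ring.inverse_mul_cancel _ hPu
    have hcomm : (R - x • 1) * P = P * (R - x • 1) := geomOp_commute R m x
    have hX : negPow L c m - w • 1 = (R - x • 1) * P := by rw [hP, sub_mul_geomOp, hxw]; rfl
    have hres : IsResolventAt (ofBounded (negPow L c m)) w (T * Ring.inverse P) := by
      refine isResolventAt_ofBounded ?_ ?_
      · calc (negPow L c m - w • 1) * (T * Ring.inverse P)
            = P * ((R - x • 1) * T) * Ring.inverse P := by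
              rw [hX, hcomm]; simp only [mul_assoc]
          _ = 1 := by rw [h1, mul_one, hP1]
      · have hPT : Ring.inverse P * (R - x • 1) = (R - x • 1) * Ring.inverse P := by
          calc Ring.inverse P * (R - x • 1)
              = Ring.inverse P * ((R - x • 1) * P) * Ring.inverse P := by
                rw [mul_assoc, mul_assoc, hP1, mul_one]
            _ = (R - x • 1) * Ring.inverse P := by
                rw [hcomm, ← mul_assoc, hP2, one_mul]
        calc T * Ring.inverse P * (negPow L c m - w • 1)
            = T * (Ring.inverse P * (R - x • 1)) * P := by rw [hX]; simp only [mul_assoc]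
          _ = (T * (R - x • 1)) * (Ring.inverse P * P) := by rw [hPT]; simp only [mul_assoc]
          _ = 1 := by rw [h2, hP2, one_mul]
    refine ⟨⟨_, hres⟩, ?_⟩
    rw [hres.resolvent_eq, (hasDerivAt_specInvC hm hw).deriv, ← hxd]
    set a : ℂ := (m * x ^ (m - 1))⁻¹ with ha
    have ha' : a * (m * x ^ (m - 1)) = 1 :=
      inv_mul_cancel₀ (mul_ne_zero hm0 (pow_ne_zero _ hx))
    have hTQ : T * (P - (m * x ^ (m - 1)) • 1) = Q := by
      rw [← sub_mul_geomOp₂, ← mul_assoc, h2, one_mul]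
    have hQP : a • (Q * Ring.inverse P) = a • T - T * Ring.inverse P := by
      rw [← hTQ, mul_sub, sub_mul, mul_assoc, hP1, mul_one, mul_smul_comm, mul_one,
        smul_mul_assoc, smul_sub, smul_smul, ha', one_smul]
    have hxm : x ^ m = x ^ (m - 1) * x := by
      rw [← pow_succ]; congr 1; omega
    have hxm' : x ^ (m + 1) = x ^ (m - 1) * x * x := by rw [pow_succ, hxm]
    change T * Ring.inverse P =
      -(m * x ^ (m + 1))⁻¹ • S - ((m * x ^ m)⁻¹ • 1 + a • (Q * Ring.inverse P))
    rw [hQP, hxm, hxm', ha]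
    generalize T * Ring.inverse P = Z
    rw [hT]
    have hk : x ^ (m - 1) ≠ 0 := pow_ne_zero _ hx
    clear_value P Q S R
    match_scalars <;> field_simp <;> ring

end Power

end SSF

namespace SSF

/-! ### Resolvent bounds for powers of the resolvent -/

section PowerBounds

variable {c : ℝ} {m : ℕ}

theorem differentiableAt_specInvC (hm : 1 ≤ m) {w : ℂ} (hw : 0 < w.re) :
    DifferentiableAt ℂ (specInvC c m) w :=
  (hasDerivAt_specInvC hm hw).differentiableAt

theorem isOpen_re_pos : IsOpen {w : ℂ | 0 < w.re} :=
  isOpen_lt continuous_const Complex.continuous_re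

theorem continuousOn_specInvC (hm : 1 ≤ m) : ContinuousOn (specInvC c m) {w | 0 < w.re} :=
  fun _ hw => (differentiableAt_specInvC hm hw).continuousAt.continuousWithinAt

theorem specInvC_im_ne_zero (hm : 1 ≤ m) {w : ℂ} (hw : 0 < w.re) (hi : w.im ≠ 0) :
    (specInvC c m w).im ≠ 0 := fun h => by
  have := abs_im_le_specInvC (c := c) hm hw
  rw [h, abs_zero, mul_zero] at this
  exact hi (abs_nonpos_iff.1 this)

/-- ψ is real on the positive axis, so |Im ψ(w)| ≤ |ψ(w) - ψ(Re w)|, and the mean value inequality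
applies. -/
theorem exists_abs_im_specInvC_le (hm : 1 ≤ m) {S : Set ℂ} (hS : IsCompact S)
    (hSre : ∀ w ∈ S, 0 < w.re) : ∃ p, 0 ≤ p ∧
      ∀ w ∈ S, |(specInvC c m w).im| ≤ p * |w.im| ∧ ‖deriv (specInvC c m) w‖ ≤ p := by
  obtain ⟨r, hr, hrS⟩ := hS.exists_forall_le' Complex.continuous_re.continuousOn hSre
  obtain ⟨R, hR⟩ := hS.isBounded.subset_closedBall (0 : ℂ)
  -- A truncated disc: compact in the right half-plane, convex, and containing both `w` and Re w for
  -- every `w` in `S`.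
  set T : Set ℂ := Metric.closedBall 0 R ∩ {w | r ≤ w.re} with hT
  have hTc : IsCompact T := (isCompact_closedBall 0 R).inter_right
    (isClosed_le continuous_const Complex.continuous_re)
  have hTv : Convex ℝ T := (convex_closedBall 0 R).inter (convex_halfSpace_re_ge r)
  have hT0 : ∀ w ∈ T, 0 < w.re := fun w hw => hr.trans_le hw.2
  have hc : ContinuousOn (deriv (specInvC c m)) T := by
    have : ContinuousOn (deriv (specInvC c m)) {w | 0 < w.re} :=
      (DifferentiableOn.deriv (fun w hw => (differentiableAt_specInvC hm hw).differentiableWithinAt)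
        isOpen_re_pos).continuousOn
    exact this.mono hT0
  obtain ⟨p, hp⟩ := hTc.exists_bound_of_continuousOn hc
  refine ⟨max p 0, le_max_right _ _, fun w hw => ?_⟩
  have hwT : w ∈ T := ⟨hR hw, hrS w hw⟩
  refine ⟨?_, (hp w hwT).trans (le_max_left _ _)⟩
  have hxT : ((w.re : ℝ) : ℂ) ∈ T := by
    refine ⟨?_, by simpa using hrS w hw⟩
    rw [mem_closedBall_zero_iff, Complex.norm_real]
    exact (Complex.abs_re_le_norm w).trans (mem_closedBall_zero_iff.1 (hR hw))
  have h1 := hTv.norm_image_sub_le_of_norm_deriv_le (𝕜 := ℂ) (f := specInvC c m)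
    (fun z hz => differentiableAt_specInvC hm (hT0 z hz))
    (fun z hz => (hp z hz).trans (le_max_left p 0)) hxT hwT
  have h2 : (specInvC c m w - specInvC c m (w.re : ℝ)).im = (specInvC c m w).im := by
    rw [specInvC_ofReal (hSre w hw), Complex.sub_im, Complex.ofReal_im, sub_zero]
  have h3 : w - ((w.re : ℝ) : ℂ) = w.im * Complex.I := by
    apply Complex.ext <;> simp
  rw [h3, norm_mul, Complex.norm_I, mul_one, Complex.norm_real, Real.norm_eq_abs] at h1
  rw [← h2]
  exact (Complex.abs_im_le_norm _).trans h1

variable {E : Type*} [NormedAddCommGroup E] [NormedSpace ℂ E] {L : E →ₗ.[ℂ] E}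

theorem PolynomialResolventBound.exists_stripBound {I K : Set ℝ}
    (h : PolynomialResolventBound L I) (hK : IsCompact K) (hKI : K ⊆ I) :
    ∃ n, StripBound L n K := by
  obtain ⟨a, ha, n, hn, C, hC, h⟩ := h
  obtain ⟨b, hb1, hb⟩ := exists_bound_japaneseBracket hK
  -- The additional 1 absorbs the factor |Im z|⁻¹; |Im z| ≤ 1 ≤ b ensures b/|Im z| ≥ 1, so the real
  -- exponent may be rounded up.
  refine ⟨⌈n⌉₊ + 1, min a 1, lt_min ha one_pos, C * b ^ ⌈n⌉₊, fun z hz h0 h1 => ?_⟩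
  obtain ⟨h2, h3⟩ := h z (hKI hz) h0 (h1.trans_le (min_le_left _ _))
  refine ⟨h2, ?_⟩
  have hy1 : |z.im| ≤ 1 := (h1.trans_le (min_le_right _ _)).le
  have h4 : (japaneseBracket z.re / |z.im|) ^ n ≤ (b / |z.im|) ^ ⌈n⌉₊ := by
    calc (japaneseBracket z.re / |z.im|) ^ n ≤ (b / |z.im|) ^ n := by
          gcongr
          · exact div_nonneg (japaneseBracket_pos _).le h0.le
          · exact hb _ hz
      _ ≤ (b / |z.im|) ^ (⌈n⌉₊ : ℝ) :=
          Real.rpow_le_rpow_of_exponent_le ((one_le_div h0).2 (hy1.trans hb1)) (Nat.le_ceil n)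
      _ = (b / |z.im|) ^ ⌈n⌉₊ := Real.rpow_natCast _ _
  calc ‖resolvent L z‖ * |z.im| ^ (⌈n⌉₊ + 1)
      ≤ C * |z.im|⁻¹ * (b / |z.im|) ^ ⌈n⌉₊ * |z.im| ^ (⌈n⌉₊ + 1) := by
        gcongr
        refine h3.trans ?_
        gcongr
    _ = C * b ^ ⌈n⌉₊ := by
        rw [div_pow, pow_succ]
        field_simp

variable [CompleteSpace E]

/-- The resolvent of the power at `w` is that of `L` at ψ(w), times a bounded factor, minus a
bounded term on `S`; and |Im w| is at most a constant times |Im ψ(w)|. -/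
theorem isTempered_resolvent_negPow (hL : IsPowerAdmissible L c m) {S : Set ℂ} (hS : IsCompact S)
    (hSre : ∀ w ∈ S, 0 < w.re) {n : ℕ}
    (hSL : ∀ w ∈ S, w.im ≠ 0 → specInvC c m w ∈ resolventSet L)
    (hA : IsTempered (resolvent L) n (specInvC c m '' S)) :
    (∀ w ∈ S, w.im ≠ 0 → w ∈ resolventSet (ofBounded (negPow L c m))) ∧
      IsTempered (resolvent (ofBounded (negPow L c m))) n S := by
  have hm := hL.one_le
  obtain ⟨D, hD, hX⟩ := exists_resolvent_negPow_eq hL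
  have hmem : ∀ w ∈ S, w.im ≠ 0 → w ∈ resolventSet (ofBounded (negPow L c m)) := fun w hw hi =>
    (hX w (hSre w hw) (hSL w hw hi)).1
  refine ⟨hmem, ⟨fun w hw hi => differentiableAt_resolvent (hmem w hw hi), ?_⟩⟩
  obtain ⟨p, hp0, hp⟩ := exists_abs_im_specInvC_le (c := c) hm hS hSre
  obtain ⟨d, hd⟩ := hS.exists_bound_of_continuousOn (f := D) fun w hw =>
    (hD w (hSre w hw)).continuousAt.continuousWithinAt
  obtain ⟨q, hq⟩ := hS.exists_bound_of_continuousOn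
    (f := fun w => (m : ℂ) * specRoot m w ^ (m + 1)) fun w hw =>
      (((differentiableAt_specRoot (hSre w hw)).pow (m + 1)).const_mul
        (m : ℂ)).continuousAt.continuousWithinAt
  obtain ⟨t, ht⟩ := hS.exists_bound_of_continuousOn Complex.continuous_im.continuousOn
  obtain ⟨B, hB⟩ := hA.bound
  refine ⟨p * (q ^ n * B) + d * t ^ n, fun w hw hi => ?_⟩
  have hw0 := hSre w hw
  have him := specInvC_im_ne_zero (c := c) hm hw0 hi
  have h1 := hB _ (mem_image_of_mem _ hw) him
  have h2 : |w.im| ≤ q * |(specInvC c m w).im| := by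
    refine (abs_im_le_specInvC (c := c) hm hw0).trans ?_
    gcongr
    simpa using hq w hw
  have hq0 : 0 ≤ q := (norm_nonneg _).trans (hq w hw)
  have hd0 : 0 ≤ d := (norm_nonneg _).trans (hd w hw)
  rw [(hX w hw0 (hSL w hw hi)).2]
  calc ‖deriv (specInvC c m) w • resolvent L (specInvC c m w) - D w‖ * |w.im| ^ n
      ≤ (p * ‖resolvent L (specInvC c m w)‖ + d) * |w.im| ^ n := by
        gcongr
        refine (norm_sub_le _ _).trans (add_le_add ?_ (hd w hw))
        rw [norm_smul]
        gcongr
        exact (hp w hw).2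
    _ = p * (‖resolvent L (specInvC c m w)‖ * |w.im| ^ n) + d * |w.im| ^ n := by ring
    _ ≤ p * (‖resolvent L (specInvC c m w)‖ * (q * |(specInvC c m w).im|) ^ n) + d * t ^ n := by
        gcongr
        exact ht w hw
    _ = p * (q ^ n * (‖resolvent L (specInvC c m w)‖ * |(specInvC c m w).im| ^ n)) + d * t ^ n := by
        rw [mul_pow]; ring
    _ ≤ p * (q ^ n * B) + d * t ^ n := by gcongr

/-- ψ does not preserve vertical lines, so a strip bound is needed over a neighbourhood `K₁` of the
image of `K`. By compactness ψ maps a thin rectangle around `K` into the strip over `K₁`. -/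
theorem StripBound.negPow (hL : IsPowerAdmissible L c m) {n : ℕ} {K K₁ : Set ℝ}
    (hK : IsCompact K) (hK0 : K ⊆ Ioi 0) (h : StripBound L n K₁)
    (hK₁ : specInv c m '' K ⊆ interior K₁) : StripBound (ofBounded (negPow L c m)) n K := by
  have hm := hL.one_le
  obtain ⟨a, ha, C, hC⟩ := h
  set U : Set ℂ := {w | 0 < w.re} ∩
    specInvC c m ⁻¹' {z | z.re ∈ interior K₁ ∧ |z.im| < a} with hU
  have hUo : IsOpen U := by
    refine (continuousOn_specInvC hm).isOpen_inter_preimage isOpen_re_pos ?_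
    exact (isOpen_interior.preimage Complex.continuous_re).inter
      (isOpen_lt Complex.continuous_im.abs continuous_const)
  have hKU : ((↑) : ℝ → ℂ) '' K ⊆ U := by
    rintro _ ⟨μ, hμ, rfl⟩
    have h0 : 0 < μ := hK0 hμ
    refine ⟨by simpa using h0, ?_⟩
    rw [mem_preimage, specInvC_ofReal h0]
    refine ⟨?_, ?_⟩
    · rw [Complex.ofReal_re]
      exact hK₁ (mem_image_of_mem _ hμ)
    · simpa using ha
  obtain ⟨δ, hδ, hδU⟩ := (hK.image Complex.continuous_ofReal).exists_cthickening_subset_open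
    hUo hKU
  have hSU : K ×ℂ Icc (-δ) δ ⊆ U := fun w hw => hδU (by
    refine Metric.mem_cthickening_of_dist_le w (w.re : ℝ) δ _ (mem_image_of_mem _ hw.1) ?_
    rw [Complex.dist_of_re_eq (by simp), Complex.ofReal_im, Real.dist_eq, sub_zero]
    exact abs_le.2 hw.2)
  have hSL : ∀ w ∈ K ×ℂ Icc (-δ) δ, w.im ≠ 0 → specInvC c m w ∈ resolventSet L ∧
      ‖resolvent L (specInvC c m w)‖ * |(specInvC c m w).im| ^ n ≤ C := fun w hw hi =>
    hC _ (interior_subset (hSU hw).2.1)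
      (abs_pos.2 (specInvC_im_ne_zero hm (hSU hw).1 hi)) (hSU hw).2.2
  have hSre : ∀ w ∈ K ×ℂ Icc (-δ) δ, 0 < w.re := fun w hw => (hSU hw).1
  have him : ∀ w ∈ K ×ℂ Icc (-δ) δ, (specInvC c m w).im ≠ 0 → w.im ≠ 0 := fun w hw hi h0 => by
    have : w = (w.re : ℝ) := by apply Complex.ext <;> simp [h0]
    rw [this, specInvC_ofReal (hSre w hw)] at hi
    exact hi (Complex.ofReal_im _)
  obtain ⟨h1, h2⟩ := isTempered_resolvent_negPow hL (hK.reProdIm isCompact_Icc) hSre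
    (fun w hw hi => (hSL w hw hi).1) (n := n)
    { differentiableAt := by
        rintro _ ⟨w, hw, rfl⟩ hi
        exact differentiableAt_resolvent (hSL w hw (him w hw hi)).1
      bound := ⟨C, by
        rintro _ ⟨w, hw, rfl⟩ hi
        exact (hSL w hw (him w hw hi)).2⟩ }
  obtain ⟨B, hB⟩ := h2.bound
  refine ⟨δ, hδ, B, fun w hw h3 h4 => ?_⟩
  have hwS : w ∈ K ×ℂ Icc (-δ) δ := ⟨hw, abs_le.1 h4.le⟩
  exact ⟨h1 w hwS (abs_pos.1 h3), hB w hwS (abs_pos.1 h3)⟩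

theorem PolynomialResolventBound.exists_stripBound_negPow (hL : IsPowerAdmissible L c m)
    {I : Opens ℝ} (h : PolynomialResolventBound L I) {K : Set ℝ}
    (hK : IsCompact K) (hKI : K ⊆ specImage c m I) :
    ∃ n, StripBound (ofBounded (negPow L c m)) n K := by
  have hK0 : K ⊆ Ioi 0 := fun μ hμ => pos_of_mem_specImage (hKI hμ)
  have hc : IsCompact (specInv c m '' K) :=
    hK.image_of_continuousOn (contDiffOn_specInv.continuousOn.mono hK0)
  have hcI : specInv c m '' K ⊆ I := by
    rintro _ ⟨μ, hμ, rfl⟩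
    exact specInv_mem (hKI hμ)
  obtain ⟨K₁, hK₁, h1, h2⟩ := exists_compact_between hc I.isOpen hcI
  obtain ⟨n, hn⟩ := h.exists_stripBound hK₁ h2
  exact ⟨n, hn.negPow hL hK hK0 h1⟩

end PowerBounds

end SSF

namespace SSF

/-! ### Change of variables in the Helffer–Sjöstrand formula -/

section Pullback

variable {c : ℝ} {m : ℕ}

/-- The image of the right half-plane under `specInvC c m`. -/
def sector (c : ℝ) (m : ℕ) : Set ℂ := {z | z + c ∈ Complex.slitPlane ∧
  |(z + c).arg| < Real.pi / (2 * m)}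

theorem isOpen_sector (c : ℝ) (m : ℕ) : IsOpen (sector c m) := by
  have h1 : IsOpen {z : ℂ | z + c ∈ Complex.slitPlane} :=
    Complex.isOpen_slitPlane.preimage (continuous_id.add continuous_const)
  have h2 : ContinuousOn (fun z : ℂ => |(z + c).arg|) {z : ℂ | z + c ∈ Complex.slitPlane} :=
    fun z hz => ((Complex.continuousAt_arg hz).comp (f := fun z : ℂ => z + c)
      (by fun_prop)).abs.continuousWithinAt
  exact h2.isOpen_inter_preimage h1 isOpen_Iio

theorem ofReal_mem_sector (hm : 1 ≤ m) {x : ℝ} (hx : -c < x) : (x : ℂ) ∈ sector c m := by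
  have hm' : (0 : ℝ) < m := by exact_mod_cast hm
  have h0 : 0 < x + c := by linarith
  have h1 : (x : ℂ) + c = ((x + c : ℝ) : ℂ) := by push_cast; rfl
  refine ⟨?_, ?_⟩
  · rw [h1]
    exact Complex.ofReal_mem_slitPlane.2 h0
  · rw [h1, Complex.arg_ofReal_of_nonneg h0.le, abs_zero]
    positivity

theorem image_specMapC_subset (hm : 1 ≤ m) {T : Set ℂ} (hT : T ⊆ sector c m) :
    ∀ w ∈ specMapC c m '' T, 0 < w.re := by
  rintro _ ⟨z, hz, rfl⟩
  exact specMapC_re_pos hm (Complex.slitPlane_ne_zero (hT hz).1) (hT hz).2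

theorem image_specInvC_image (hm : 1 ≤ m) {T : Set ℂ} (hT : T ⊆ sector c m) :
    specInvC c m '' (specMapC c m '' T) = T := by
  rw [image_image]
  ext z
  constructor
  · rintro ⟨y, hy, rfl⟩
    dsimp only
    rwa [specInvC_specMapC hm (hT hy).2]
  · exact fun hz => ⟨z, hz, specInvC_specMapC hm (hT hz).2⟩

theorem isCompact_image_specMapC {T : Set ℂ} (hTc : IsCompact T) (hT : T ⊆ sector c m) :
    IsCompact (specMapC c m '' T) := by
  refine hTc.image_of_continuousOn fun z hz => ContinuousAt.continuousWithinAt ?_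
  have h0 : z + c ≠ 0 := Complex.slitPlane_ne_zero (hT hz).1
  unfold specMapC
  exact ((by fun_prop : ContinuousAt (fun z : ℂ => z + c) z).inv₀ h0).pow m

/-- The pull-back of `G` under `specInvC c m`. -/
noncomputable def pullC (c : ℝ) (m : ℕ) (G : ℂ → ℂ) (w : ℂ) : ℂ :=
  if 0 < w.re then G (specInvC c m w) else 0

theorem pullC_eventuallyEq (G : ℂ → ℂ) {w : ℂ} (hw : 0 < w.re) :
    pullC c m G =ᶠ[𝓝 w] G ∘ specInvC c m := by
  filter_upwards [isOpen_re_pos.mem_nhds hw] with v hv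
  exact if_pos hv

theorem tsupport_pullC_subset (hm : 1 ≤ m) {G : ℂ → ℂ} (hc : HasCompactSupport G)
    (hG : tsupport G ⊆ sector c m) : tsupport (pullC c m G) ⊆ specMapC c m '' tsupport G := by
  refine closure_minimal (fun w hw => ?_) (isCompact_image_specMapC hc hG).isClosed
  rw [Function.mem_support, pullC] at hw
  split_ifs at hw with h0
  · exact ⟨_, subset_tsupport _ hw, specMapC_specInvC hm w⟩
  · exact absurd rfl hw

theorem contDiffAt_specInvC (hm : 1 ≤ m) {w : ℂ} (hw : 0 < w.re) :
    ContDiffAt ℝ ∞ (specInvC c m) w := by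
  have h : DifferentiableOn ℂ (specInvC c m) {w | 0 < w.re} := fun w hw =>
    (differentiableAt_specInvC hm hw).differentiableWithinAt
  exact ((h.contDiffOn (n := ∞) isOpen_re_pos).contDiffAt
    (isOpen_re_pos.mem_nhds hw)).restrict_scalars ℝ

theorem contDiff_pullC (hm : 1 ≤ m) {G : ℂ → ℂ} (hG : ContDiff ℝ ∞ G) (hc : HasCompactSupport G)
    (hGs : tsupport G ⊆ sector c m) : ContDiff ℝ ∞ (pullC c m G) := by
  rw [contDiff_iff_contDiffAt]
  intro w
  by_cases hw : 0 < w.re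
  · exact (hG.contDiffAt.comp w (contDiffAt_specInvC hm hw)).congr_of_eventuallyEq
      (pullC_eventuallyEq G hw)
  · have h : w ∉ tsupport (pullC c m G) := fun h =>
      hw (image_specMapC_subset hm hGs w (tsupport_pullC_subset hm hc hGs h))
    refine (contDiffAt_const (c := (0 : ℂ))).congr_of_eventuallyEq ?_
    filter_upwards [(isClosed_tsupport _).isOpen_compl.mem_nhds h] with v hv
    exact image_eq_zero_of_notMem_tsupport hv

/-- The real differential of `G` splits into a complex-linear and an antilinear part, and `dbar`
reads off the latter; composing it with multiplication by ψ' brings out the conjugate. -/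
theorem dbar_comp {G ψ : ℂ → ℂ} {w : ℂ} (hG : DifferentiableAt ℝ G (ψ w))
    (hψ : DifferentiableAt ℂ ψ w) :
    dbar (G ∘ ψ) w = dbar G (ψ w) * (starRingEnd ℂ) (deriv ψ w) := by
  have h1 : HasFDerivAt ψ ((ContinuousLinearMap.toSpanSingleton ℂ (deriv ψ w)).restrictScalars ℝ)
      w := hψ.hasDerivAt.hasFDerivAt.restrictScalars ℝ
  have h2 := (hG.hasFDerivAt.comp w h1).fderiv
  set d := deriv ψ w
  set A := fderiv ℝ G (ψ w) with hA
  have h3 : ∀ v : ℂ, A v = v.re * A 1 + v.im * A Complex.I := fun v => by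
    have : v = v.re • (1 : ℂ) + v.im • Complex.I := by
      apply Complex.ext <;> simp
    conv_lhs => rw [this, map_add, map_smul, map_smul]
    simp
  have h4 : A d = d.re * A 1 + d.im * A Complex.I := h3 d
  have h5 : A (Complex.I * d) = -d.im * A 1 + d.re * A Complex.I := by
    rw [h3]; simp
  have h6 : (starRingEnd ℂ) d = d.re - d.im * Complex.I := by
    apply Complex.ext <;> simp
  simp only [dbar, h2, ContinuousLinearMap.comp_apply, ContinuousLinearMap.coe_restrictScalars',
    ContinuousLinearMap.toSpanSingleton_apply, smul_eq_mul, one_mul, h4, h5, h6, ← hA]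
  linear_combination ((1 / 2 : ℂ) * d.im * A Complex.I) * Complex.I_sq

theorem dbar_pullC (hm : 1 ≤ m) {G : ℂ → ℂ} (hG : ContDiff ℝ ∞ G) {w : ℂ} (hw : 0 < w.re) :
    dbar (pullC c m G) w =
      dbar G (specInvC c m w) * (starRingEnd ℂ) (deriv (specInvC c m) w) := by
  rw [← dbar_comp (hG.differentiable (by simp) _) (differentiableAt_specInvC hm hw)]
  simp only [dbar, (pullC_eventuallyEq G hw).fderiv_eq]

/-- Flatness survives because |Im ψ(w)| ≤ p |Im w| on the compact image of the support. -/
theorem IsExtension.pullC (hm : 1 ≤ m) {f : ℝ → ℂ} {N : ℕ} {G : ℂ → ℂ} (h : IsExtension f N G)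
    (hG : tsupport G ⊆ sector c m) :
    IsExtension (pullFun c m (fun _ => 1) f) N (pullC c m G) where
  smooth := contDiff_pullC hm h.smooth h.compact hG
  compact := (isCompact_image_specMapC h.compact hG).of_isClosed_subset (isClosed_tsupport _)
    (tsupport_pullC_subset hm h.compact hG)
  eq x := by
    rw [SSF.pullC, pullFun, Complex.ofReal_re]
    split_ifs with h0
    · rw [specInvC_ofReal h0, one_mul, h.eq]
      rfl
    · rfl
  flat := by
    obtain ⟨C, hC⟩ := h.flat
    obtain ⟨p, hp0, hp⟩ := exists_abs_im_specInvC_le (c := c) hm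
      (isCompact_image_specMapC h.compact hG) (image_specMapC_subset hm hG)
    refine ⟨|C| * p ^ N * p, fun w => ?_⟩
    by_cases hw : w ∈ tsupport (SSF.pullC c m G)
    · have hwS := tsupport_pullC_subset hm h.compact hG hw
      rw [dbar_pullC hm h.smooth (image_specMapC_subset hm hG w hwS), norm_mul, RCLike.norm_conj]
      calc ‖dbar G (specInvC c m w)‖ * ‖deriv (specInvC c m) w‖
          ≤ (|C| * (p * |w.im|) ^ N) * p := by
            gcongr
            · refine (hC _).trans ?_
              gcongr
              · exact le_abs_self C
              · exact (hp w hwS).1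
            · exact (hp w hwS).2
        _ = |C| * p ^ N * p * |w.im| ^ N := by rw [mul_pow]; ring
    · rw [dbar_eq_zero_of_notMem_tsupport hw, norm_zero]
      positivity

/-- The real Jacobian of a holomorphic map is |ψ'|². It is written as a product because one factor
will come from `dbar_pullC` and the other from the resolvent of the power. -/
theorem integral_specInvC {F : Type*} [NormedAddCommGroup F] [NormedSpace ℂ F] (hm : 1 ≤ m)
    {g : ℂ → F} (hg : ∀ z ∉ sector c m, g z = 0) :
    ∫ z, g z = ∫ w in {w : ℂ | 0 < w.re},
      ((starRingEnd ℂ) (deriv (specInvC c m) w) * deriv (specInvC c m) w) •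
        g (specInvC c m w) := by
  have himg : specInvC c m '' {w | 0 < w.re} ⊇ sector c m := fun z hz =>
    ⟨specMapC c m z, specMapC_re_pos hm (Complex.slitPlane_ne_zero hz.1) hz.2,
      specInvC_specMapC hm hz.2⟩
  have hinj : InjOn (specInvC c m) {w | 0 < w.re} := fun w _ v _ h => by
    rw [← specMapC_specInvC (c := c) hm w, h, specMapC_specInvC hm]
  have hd : ∀ w ∈ {w : ℂ | 0 < w.re}, HasFDerivWithinAt (specInvC c m)
      ((ContinuousLinearMap.toSpanSingleton ℂ (deriv (specInvC c m) w)).restrictScalars ℝ)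
      {w | 0 < w.re} w := fun w hw =>
    ((differentiableAt_specInvC hm hw).hasDerivAt.hasFDerivAt.restrictScalars ℝ).hasFDerivWithinAt
  rw [← setIntegral_eq_integral_of_forall_compl_eq_zero (s := specInvC c m '' {w | 0 < w.re})
    fun z hz => hg z fun h => hz (himg h),
    integral_image_eq_integral_abs_det_fderiv_smul volume isOpen_re_pos.measurableSet hd hinj]
  refine setIntegral_congr_fun isOpen_re_pos.measurableSet fun w _ => ?_
  have hdet : ∀ d : ℂ, ((ContinuousLinearMap.toSpanSingleton ℂ d).restrictScalars ℝ).det =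
      ‖d‖ ^ 2 := fun d => by
    have h1 : (((ContinuousLinearMap.toSpanSingleton ℂ d).restrictScalars ℝ : ℂ →L[ℝ] ℂ) :
        ℂ →ₗ[ℝ] ℂ) = LinearMap.mulLeft ℝ d := by
      ext
      simp [mul_comm]
    rw [ContinuousLinearMap.det, h1]
    change Algebra.norm ℝ d = _
    rw [Algebra.norm_complex_apply, Complex.normSq_eq_norm_sq]
  change |_| • g (specInvC c m w) = _
  rw [hdet, abs_of_nonneg (sq_nonneg _), Complex.conj_mul', ← Complex.ofReal_pow,
    Complex.coe_smul]

variable {E : Type*} [NormedAddCommGroup E] [NormedSpace ℂ E] [CompleteSpace E] {L : E →ₗ.[ℂ] E}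

/-- Invariance of the functional calculus: `f(L) = (f ∘ ψ)((L + c) ^ (-m))`. -/
theorem funCalc_negPow (hL : IsPowerAdmissible L c m) {f : ℝ → ℂ} (hf : ContDiff ℝ ∞ f)
    (hfc : HasCompactSupport f) (hfI : tsupport f ⊆ Ioi (-c)) {n : ℕ}
    (h : StripBound L n (tsupport f))
    (hX : StripBound (ofBounded (negPow L c m)) n (tsupport (pullFun c m (fun _ => 1) f))) :
    funCalc (ofBounded (negPow L c m)) (pullFun c m (fun _ => 1) f) = funCalc L f := by
  have hm := hL.one_le
  obtain ⟨δ, hδ, h1⟩ := h.exists_cutoff_avoiding hfc.isCompact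
  obtain ⟨ε, hε, hεs⟩ :=
    (hfc.isCompact.image Complex.continuous_ofReal).exists_cthickening_subset_open
    (isOpen_sector c m) (by
      rintro _ ⟨x, hx, rfl⟩
      exact ofReal_mem_sector hm (hfI hx))
  obtain ⟨b, hb1, hb⟩ := exists_bound_japaneseBracket hfc.isCompact
  have hb0 : 0 < b := one_pos.trans_le hb1
  -- Width δ avoids the non-real spectrum of `L`; width ε/b, with ⟨x⟩ ≤ b, keeps the support of the
  -- extension inside the sector.
  obtain ⟨τ, h2, h3, h4, h5⟩ := exists_cutoff (lt_min hδ (div_pos hε hb0))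
  have hτ : IsAdmissibleCutoff L f τ := isAdmissibleCutoff_of_subset subset_rfl h1 h2 h3 h4
    (h5.trans (Icc_subset_Icc (neg_le_neg (min_le_left _ _)) (min_le_left _ _)))
  set N := n + 2
  set G := almostAnalyticExtension f N τ with hGd
  have hG : IsExtension f N G := hτ.isExtension hf hfc N
  have hGs : tsupport G ⊆ sector c m := fun z hz => by
    obtain ⟨hz1, hz2⟩ := tsupport_almostAnalyticExtension_subset f N τ hz
    refine hεs (Metric.mem_cthickening_of_dist_le z (z.re : ℝ) ε _ (mem_image_of_mem _ hz1) ?_)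
    rw [Complex.dist_of_re_eq (by simp), Complex.ofReal_im, Real.dist_eq, sub_zero]
    have h6 : |z.im / japaneseBracket z.re| ≤ ε / b :=
      (abs_le.2 (h5 hz2)).trans (min_le_right _ _)
    have h7 := japaneseBracket_pos z.re
    rw [abs_div, abs_of_pos h7, div_le_iff₀ h7] at h6
    refine h6.trans ?_
    rw [div_mul_eq_mul_div, div_le_iff₀ hb0]
    gcongr
    exact hb _ hz1
  have hA := hτ.isTempered hfc h N
  have hE := hG.pullC hm hGs
  set S := specMapC c m '' tsupport G with hS
  have hSc : IsCompact S := isCompact_image_specMapC hG.compact hGs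
  have hS0 : ∀ w ∈ S, 0 < w.re := image_specMapC_subset hm hGs
  have hSi : specInvC c m '' S = tsupport G := image_specInvC_image hm hGs
  have hsub : tsupport (pullC c m G) ⊆ S := tsupport_pullC_subset hm hG.compact hGs
  have hSL : ∀ w ∈ S, w.im ≠ 0 → specInvC c m w ∈ resolventSet L := fun w hw hi => by
    obtain ⟨h6, h7⟩ := tsupport_almostAnalyticExtension_subset f N τ
      (hSi ▸ mem_image_of_mem (specInvC c m) hw : specInvC c m w ∈ tsupport G)
    exact hτ.avoids _ (specInvC_im_ne_zero hm (hS0 w hw) hi) h6 h7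
  obtain ⟨-, hAX⟩ := isTempered_resolvent_negPow hL hSc hS0 hSL (by rwa [hSi])
  replace hAX := hAX.mono hsub
  obtain ⟨D, hD, hXD⟩ := exists_resolvent_negPow_eq hL
  have hAD : IsTempered D 0 (tsupport (pullC c m G)) :=
    { differentiableAt := fun w hw _ => hD w (hS0 w (hsub hw))
      bound := by
        obtain ⟨d, hd⟩ := hSc.exists_bound_of_continuousOn (f := D) fun w hw =>
          (hD w (hS0 w hw)).continuousAt.continuousWithinAt
        exact ⟨d, fun w hw _ => by simpa using hd w (hsub hw)⟩ }
  rw [(hτ.isFunCalc hf hfc h le_rfl).funCalc_eq,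
    (isFunCalc_of_isExtension (contDiff_pullFun hm contDiffOn_const hf hfc hfI)
      ((hfc.isCompact.image_of_continuousOn (continuousOn_specMap.mono hfI)).of_isClosed_subset
        (isClosed_tsupport _) (tsupport_pullFun_subset hm _ subset_rfl hfc hfI))
      hX hE le_rfl hAX).funCalc_eq]
  congr 1
  -- By Green's formula the holomorphic term `D` may be added at no cost. The integrand then becomes
  -- the pulled-back integrand for `L` times the Jacobian.
  calc ∫ w, dbar (pullC c m G) w • resolvent (ofBounded (negPow L c m)) w
      = ∫ w, (dbar (pullC c m G) w • resolvent (ofBounded (negPow L c m)) w +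
          dbar (pullC c m G) w • D w) := by
        rw [integral_add (hE.integrable hAX (by omega)) (hE.integrable hAD (Nat.zero_le _)),
          integral_dbar_smul_eq_zero_of_differentiableAt hE.smooth hE.compact
            fun w hw => hD w (hS0 w (hsub hw)), add_zero]
    _ = ∫ w in {w : ℂ | 0 < w.re}, (dbar (pullC c m G) w •
          resolvent (ofBounded (negPow L c m)) w + dbar (pullC c m G) w • D w) := by
        refine (setIntegral_eq_integral_of_forall_compl_eq_zero fun w hw => ?_).symm
        rw [dbar_eq_zero_of_notMem_tsupport fun h6 => hw (hS0 w (hsub h6)), zero_smul, zero_smul,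
          add_zero]
    _ = ∫ w in {w : ℂ | 0 < w.re},
          ((starRingEnd ℂ) (deriv (specInvC c m) w) * deriv (specInvC c m) w) •
            dbar G (specInvC c m w) • resolvent L (specInvC c m w) := by
        refine setIntegral_congr_ae isOpen_re_pos.measurableSet ?_
        filter_upwards [ae_im_ne_zero] with w hi hw
        by_cases hwG : w ∈ tsupport (pullC c m G)
        · rw [(hXD w hw (hSL w (hsub hwG) hi)).2, ← smul_add, sub_add_cancel,
            dbar_pullC hm hG.smooth hw, smul_smul, smul_smul]
          congr 1
          ring
        · have h6 := dbar_eq_zero_of_notMem_tsupport hwG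
          rw [h6, zero_smul, zero_smul, add_zero]
          rw [dbar_pullC hm hG.smooth hw] at h6
          rw [smul_smul]
          rw [show (starRingEnd ℂ) (deriv (specInvC c m) w) * deriv (specInvC c m) w *
            dbar G (specInvC c m w) = dbar G (specInvC c m w) *
              (starRingEnd ℂ) (deriv (specInvC c m) w) * deriv (specInvC c m) w by ring, h6,
            zero_mul, zero_smul]
    _ = ∫ z, dbar G z • resolvent L z := by
        refine (integral_specInvC (g := fun z => dbar G z • resolvent L z) hm fun z hz => ?_).symm
        rw [dbar_eq_zero_of_notMem_tsupport fun h6 => hz (hGs h6), zero_smul]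

end Pullback

end SSF

namespace SSF

/-! ### Linearity of the functional calculus -/

section Linear

theorem IsExtension.add {f g : ℝ → ℂ} {N : ℕ} {G₁ G₂ : ℂ → ℂ} (h₁ : IsExtension f N G₁)
    (h₂ : IsExtension g N G₂) : IsExtension (fun x => f x + g x) N (fun z => G₁ z + G₂ z) where
  smooth := h₁.smooth.add h₂.smooth
  compact := h₁.compact.add h₂.compact
  eq x := by rw [h₁.eq, h₂.eq]
  flat := by
    obtain ⟨C, hC⟩ := h₁.flat
    obtain ⟨D, hD⟩ := h₂.flat
    refine ⟨C + D, fun z => ?_⟩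
    rw [dbar_add (h₁.smooth.differentiable (by simp) z) (h₂.smooth.differentiable (by simp) z),
      add_mul]
    exact (norm_add_le _ _).trans (add_le_add (hC z) (hD z))

theorem IsExtension.const_mul {f : ℝ → ℂ} {N : ℕ} {G : ℂ → ℂ} (h : IsExtension f N G) (a : ℂ) :
    IsExtension (fun x => a * f x) N (fun z => a * G z) where
  smooth := contDiff_const.mul h.smooth
  compact := h.compact.mul_left
  eq x := by rw [h.eq]
  flat := by
    obtain ⟨C, hC⟩ := h.flat
    refine ⟨‖a‖ * C, fun z => ?_⟩
    rw [dbar_const_mul (h.smooth.differentiable (by simp) z), norm_mul, mul_assoc]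
    exact mul_le_mul_of_nonneg_left (hC z) (norm_nonneg a)

theorem tsupport_fun_add_subset {α : Type*} [TopologicalSpace α] (f g : α → ℂ) :
    tsupport (fun z => f z + g z) ⊆ tsupport f ∪ tsupport g :=
  tsupport_add f g

theorem tsupport_const_mul_subset {α : Type*} [TopologicalSpace α] (a : ℂ) (f : α → ℂ) :
    tsupport (fun z => a * f z) ⊆ tsupport f :=
  closure_mono fun z hz h => hz (by simp [h])

variable {E : Type*} [NormedAddCommGroup E] [NormedSpace ℂ E] [CompleteSpace E] {L : E →ₗ.[ℂ] E}
  {f g : ℝ → ℂ} {n : ℕ} {K : Set ℝ}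

theorem StripBound.exists_isAdmissibleCutoff (hK : IsCompact K) (h : StripBound L n K) :
    ∃ δ > (0 : ℝ), ∀ τ : ℝ → ℂ, ContDiff ℝ ∞ τ → HasCompactSupport τ →
      (∀ᶠ s in 𝓝 (0 : ℝ), τ s = 1) → tsupport τ ⊆ Icc (-δ) δ →
      ∀ f : ℝ → ℂ, tsupport f ⊆ K → IsAdmissibleCutoff L f τ := by
  obtain ⟨δ, hδ, h1⟩ := h.exists_cutoff_avoiding hK
  exact ⟨δ, hδ, fun τ h2 h3 h4 h5 f hf => isAdmissibleCutoff_of_subset hf h1 h2 h3 h4 h5⟩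

theorem funCalc_add (hK : IsCompact K) (h : StripBound L n K) (hf : ContDiff ℝ ∞ f)
    (hg : ContDiff ℝ ∞ g) (hfK : tsupport f ⊆ K) (hgK : tsupport g ⊆ K) :
    funCalc L (fun x => f x + g x) = funCalc L f + funCalc L g := by
  obtain ⟨δ, hδ, h1⟩ := h.exists_isAdmissibleCutoff hK
  obtain ⟨τ, h2, h3, h4, h5⟩ := exists_cutoff hδ
  have hfc : HasCompactSupport f := hK.of_isClosed_subset (isClosed_tsupport f) hfK
  have hgc : HasCompactSupport g := hK.of_isClosed_subset (isClosed_tsupport g) hgK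
  have hτf := h1 τ h2 h3 h4 h5 f hfK
  have hτg := h1 τ h2 h3 h4 h5 g hgK
  have hGf := hτf.isExtension hf hfc (n + 2)
  have hGg := hτg.isExtension hg hgc (n + 2)
  have hAf := hτf.isTempered hfc (h.mono hfK) (n + 2)
  have hAg := hτg.isTempered hgc (h.mono hgK) (n + 2)
  rw [(hτf.isFunCalc hf hfc (h.mono hfK) le_rfl).funCalc_eq,
    (hτg.isFunCalc hg hgc (h.mono hgK) le_rfl).funCalc_eq,
    (isFunCalc_of_isExtension (hf.add hg) (hfc.add hgc)
      (h.mono ((tsupport_fun_add_subset f g).trans (union_subset hfK hgK))) (hGf.add hGg) le_rfl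
      ((hAf.union hAg).mono (tsupport_fun_add_subset _ _))).funCalc_eq,
    ← smul_add, ← integral_add (hGf.integrable hAf (by omega)) (hGg.integrable hAg (by omega))]
  simp only [dbar_add (hGf.smooth.differentiable (by simp) _)
    (hGg.smooth.differentiable (by simp) _), add_smul]

theorem funCalc_const_mul (hK : IsCompact K) (h : StripBound L n K) (hf : ContDiff ℝ ∞ f)
    (hfK : tsupport f ⊆ K) (a : ℂ) : funCalc L (fun x => a * f x) = a • funCalc L f := by
  obtain ⟨δ, hδ, h1⟩ := h.exists_isAdmissibleCutoff hK
  obtain ⟨τ, h2, h3, h4, h5⟩ := exists_cutoff hδ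
  have hfc : HasCompactSupport f := hK.of_isClosed_subset (isClosed_tsupport f) hfK
  have hτf := h1 τ h2 h3 h4 h5 f hfK
  have hGf := hτf.isExtension hf hfc (n + 2)
  have hAf := hτf.isTempered hfc (h.mono hfK) (n + 2)
  rw [(hτf.isFunCalc hf hfc (h.mono hfK) le_rfl).funCalc_eq,
    (isFunCalc_of_isExtension (contDiff_const.mul hf) hfc.mul_left
      (h.mono ((tsupport_const_mul_subset a f).trans hfK)) (hGf.const_mul a) le_rfl
      (hAf.mono (tsupport_const_mul_subset a _))).funCalc_eq, smul_comm a]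
  congr 1
  rw [← integral_smul]
  simp only [dbar_const_mul (hGf.smooth.differentiable (by simp) _), mul_smul]

end Linear

/-! ### Trace-class differences -/

section TraceDifference

variable {E : Type*} [NormedAddCommGroup E] [InnerProductSpace ℂ E] [CompleteSpace E]
  {X X₀ : E →L[ℂ] E}

theorem trace_add {S T : E →L[ℂ] E} {M M' : ℝ} (hS : NuclearBound S M) (hT : NuclearBound T M') :
    trace (S + T) = trace S + trace T := by
  have h : ∀ {T : E →L[ℂ] E} {M : ℝ}, NuclearBound T M →
      Summable fun i => inner ℂ (basis E i) (T (basis E i)) := fun h =>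
    (summable_of_sum_le (fun i => norm_nonneg _) h.sum_le).of_norm
  simp only [trace, add_apply, inner_add_right]
  exact (h hS).tsum_add (h hT)

theorem NuclearBound.mono {T : E →L[ℂ] E} {M M' : ℝ} (h : NuclearBound T M) (hM : M ≤ M') :
    NuclearBound T M' := fun W hW F => (h W hW F).trans hM

theorem nuclearBound_zero {M : ℝ} (hM : 0 ≤ M) : NuclearBound (0 : E →L[ℂ] E) M := fun W hW F => by
  simpa using hM

theorem resolvent_ofBounded_sub {E : Type*} [NormedAddCommGroup E] [NormedSpace ℂ E]
    {X X₀ : E →L[ℂ] E} {z : ℂ} (h : z ∈ resolventSet (ofBounded X))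
    (h₀ : z ∈ resolventSet (ofBounded X₀)) :
    resolvent (ofBounded X) z - resolvent (ofBounded X₀) z =
      -resolvent (ofBounded X) z * (X - X₀) * resolvent (ofBounded X₀) z := by
  ext u
  obtain ⟨h1, h2⟩ := (isResolventAt_resolvent h₀).1 u
  have h3 := (isResolventAt_resolvent h).2 ⟨resolvent (ofBounded X₀) z u, Submodule.mem_top⟩
  set R := resolvent (ofBounded X) z
  set R₀ := resolvent (ofBounded X₀) z
  change X₀ (R₀ u) - z • R₀ u = u at h2
  change R (X (R₀ u) - z • R₀ u) = R₀ u at h3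
  change R u - R₀ u = -R ((X - X₀) (R₀ u))
  have h4 : X (R₀ u) - z • R₀ u = u + (X - X₀) (R₀ u) := by
    rw [sub_apply]
    nth_rw 3 [← h2]
    abel
  rw [h4, map_add] at h3
  rw [sub_eq_iff_eq_add, neg_add_eq_sub, eq_sub_iff_add_eq]
  exact h3

/-- The second resolvent identity bounds the trace norm of the difference of resolvents by M ‖(X -
z)⁻¹‖ ‖(X₀ - z)⁻¹‖. The cut-off is fixed before `f`, so the bound depends on `f` only through `K`
and `B`. -/
theorem exists_nuclearBound_funCalc (hT : IsTraceClass (X - X₀)) {n : ℕ} {K : Set ℝ}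
    (hK : IsCompact K) (h : StripBound (ofBounded X) n K) (h₀ : StripBound (ofBounded X₀) n K) :
    ∃ (N : ℕ) (C : ℝ), 0 ≤ C ∧ ∀ f : ℝ → ℂ, ContDiff ℝ ∞ f → tsupport f ⊆ K → ∀ B,
      (∀ k ≤ N, ∀ x, ‖iteratedDeriv k f x‖ ≤ B) →
      NuclearBound (funCalc (ofBounded X) f - funCalc (ofBounded X₀) f) (C * B) := by
  obtain ⟨δ, hδ, h1⟩ := h.exists_isAdmissibleCutoff hK
  obtain ⟨δ₀, hδ₀, h1₀⟩ := h₀.exists_isAdmissibleCutoff hK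
  obtain ⟨a, ha, h2⟩ := h.exists_cutoff_avoiding hK
  obtain ⟨a₀, ha₀, h2₀⟩ := h₀.exists_cutoff_avoiding hK
  obtain ⟨τ, h3, h4, h5, h6⟩ := exists_cutoff (lt_min (lt_min hδ hδ₀) (lt_min ha ha₀))
  have hle : ∀ ε, min (min δ δ₀) (min a a₀) ≤ ε → tsupport τ ⊆ Icc (-ε) ε := fun ε hε =>
    h6.trans (Icc_subset_Icc (neg_le_neg hε) hε)
  replace h1 := h1 τ h3 h4 h5 (hle δ (by simp))
  replace h1₀ := h1₀ τ h3 h4 h5 (hle δ₀ (by simp))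
  obtain ⟨S, hS, hKS⟩ := exists_compact_cutoff hK h4
  set T : Set ℂ := {z | z.re ∈ K ∧ z.im / japaneseBracket z.re ∈ tsupport τ} with hTd
  have hTS : T ⊆ S := fun z hz => hKS z hz.1 hz.2
  have hTc : IsCompact T := by
    have hc : Continuous fun z : ℂ => z.im / japaneseBracket z.re :=
      Complex.continuous_im.div₀ (contDiff_japaneseBracket.continuous.comp Complex.continuous_re)
        fun z => (japaneseBracket_pos z.re).ne'
    exact hS.of_isClosed_subset ((hK.isClosed.preimage Complex.continuous_re).inter
      ((isClosed_tsupport τ).preimage hc)) hTS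
  have hTL : ∀ z ∈ T, z.im ≠ 0 → z ∈ resolventSet (ofBounded X) := fun z hz hi =>
    h2 z hi hz.1 (abs_le.2 (hle a (by simp) hz.2))
  have hTL₀ : ∀ z ∈ T, z.im ≠ 0 → z ∈ resolventSet (ofBounded X₀) := fun z hz hi =>
    h2₀ z hi hz.1 (abs_le.2 (hle a₀ (by simp) hz.2))
  obtain ⟨B₁, hB₁⟩ := (h.isTempered hTc (fun z hz => hz.1) hTL).bound
  obtain ⟨B₂, hB₂⟩ := (h₀.isTempered hTc (fun z hz => hz.1) hTL₀).bound
  obtain ⟨t, ht⟩ := hTc.exists_bound_of_continuousOn Complex.continuous_im.continuousOn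
  obtain ⟨M, hM0, hM⟩ := hT.exists_nuclearBound
  obtain ⟨C, hC0, hC⟩ := exists_dbar_bound hK (2 * n + 2) h3 h4 h5
  -- Of the 2n + 2 powers of |y|, each resolvent consumes n; the other two are bounded by t². An
  -- extension of order 2n + 2 involves one more derivative of `f`.
  set Q : ℝ := C * (|B₁| * |B₂| * M * t ^ 2) with hQ
  refine ⟨2 * n + 2 + 1, ‖(Real.pi : ℂ)⁻¹‖ * (volume.real T * Q), by positivity,
    fun f hf hfK B hB => ?_⟩
  have hfc : HasCompactSupport f := hK.of_isClosed_subset (isClosed_tsupport f) hfK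
  have hB0 : 0 ≤ B := (norm_nonneg _).trans (hB 0 (Nat.zero_le _) 0)
  set G := almostAnalyticExtension f (2 * n + 2) τ with hG
  have hGT : tsupport G ⊆ T := fun z hz => by
    obtain ⟨h7, h8⟩ := tsupport_almostAnalyticExtension_subset f (2 * n + 2) τ hz
    exact ⟨hfK h7, h8⟩
  have hi := ((h1 f hfK).isExtension hf hfc (2 * n + 2)).integrable
    ((h1 f hfK).isTempered hfc (h.mono hfK) _) (by omega)
  have hi₀ := ((h1₀ f hfK).isExtension hf hfc (2 * n + 2)).integrable
    ((h1₀ f hfK).isTempered hfc (h₀.mono hfK) _) (by omega)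
  rw [((h1 f hfK).isFunCalc hf hfc (h.mono hfK) (N := 2 * n + 2) (by omega)).funCalc_eq,
    ((h1₀ f hfK).isFunCalc hf hfc (h₀.mono hfK) (N := 2 * n + 2) (by omega)).funCalc_eq,
    ← smul_sub, ← integral_sub hi hi₀, mul_assoc]
  refine NuclearBound.smul ?_ _
  have hmeas : ∫ z, T.indicator (fun _ => Q * B) z = volume.real T * Q * B := by
    rw [integral_indicator hTc.isClosed.measurableSet, setIntegral_const, smul_eq_mul]
    ring
  rw [← hmeas]
  refine nuclearBound_integral (hi.sub hi₀)
    ((integrable_indicator_iff hTc.isClosed.measurableSet).2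
      (integrableOn_const hTc.measure_lt_top.ne)) ?_
  filter_upwards [ae_im_ne_zero] with z hz
  by_cases hzT : z ∈ T
  · rw [indicator_of_mem hzT, ← smul_sub, resolvent_ofBounded_sub (hTL z hzT hz) (hTL₀ z hzT hz)]
    refine ((hM _ _).smul _).mono ?_
    rw [norm_neg]
    calc ‖dbar G z‖ * (‖resolvent (ofBounded X) z‖ * ‖resolvent (ofBounded X₀) z‖ * M)
        ≤ C * B * |z.im| ^ (2 * n + 2) *
          (‖resolvent (ofBounded X) z‖ * ‖resolvent (ofBounded X₀) z‖ * M) := by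
          gcongr
          exact hC f hf hfK B hB z
      _ = C * B * ((‖resolvent (ofBounded X) z‖ * |z.im| ^ n) *
          (‖resolvent (ofBounded X₀) z‖ * |z.im| ^ n) * M * |z.im| ^ 2) := by ring
      _ ≤ C * B * (|B₁| * |B₂| * M * t ^ 2) := by
          gcongr
          · exact (hB₁ z hzT hz).trans (le_abs_self _)
          · exact (hB₂ z hzT hz).trans (le_abs_self _)
          · exact ht z hzT
      _ = Q * B := by rw [hQ]; ring
  · rw [indicator_of_notMem hzT, dbar_eq_zero_of_notMem_tsupport fun h7 => hzT (hGT h7),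
      zero_smul, zero_smul, sub_zero]
    exact nuclearBound_zero le_rfl

/-- The spectral shift function of a pair of bounded operators with trace-class difference. -/
theorem exists_isSSF (hT : IsTraceClass (X - X₀)) {Ω : Opens ℝ} (hΩ : (Ω : Set ℝ).OrdConnected)
    (h : ∀ K : Set ℝ, IsCompact K → K ⊆ Ω →
      ∃ n, StripBound (ofBounded X) n K ∧ StripBound (ofBounded X₀) n K) :
    ∃ η, IsSSF X X₀ Ω η := by
  set A : (ℝ → ℂ) → E →L[ℂ] E := fun f =>
    funCalc (ofBounded X) f - funCalc (ofBounded X₀) f with hA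
  have hnuc : ∀ f : 𝓓(Ω, ℂ), ∃ M, NuclearBound (A f) M := fun f => by
    obtain ⟨n, h1, h2⟩ := h _ f.hasCompactSupport f.tsupport_subset
    obtain ⟨N, C, -, hC⟩ := exists_nuclearBound_funCalc hT f.hasCompactSupport h1 h2
    obtain ⟨B, hB⟩ := exists_bound_iteratedDeriv (contDiff_testFunction f) f.hasCompactSupport N
    exact ⟨_, hC f (contDiff_testFunction f) subset_rfl B hB⟩
  obtain ⟨T, hTr⟩ := exists_distr_of_hasTestBounds (T := fun f : 𝓓(Ω, ℂ) => trace (A f))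
    (fun f g => by
      have hK : IsCompact (tsupport f ∪ tsupport g) :=
        f.hasCompactSupport.isCompact.union g.hasCompactSupport
      obtain ⟨n, h1, h2⟩ := h _ hK (union_subset f.tsupport_subset g.tsupport_subset)
      obtain ⟨M, hM⟩ := hnuc f
      obtain ⟨M', hM'⟩ := hnuc g
      rw [← trace_add hM hM']
      congr 1
      have e : ∀ {L : E →ₗ.[ℂ] E}, StripBound L n (tsupport f ∪ tsupport g) →
          funCalc L (f + g : 𝓓(Ω, ℂ)) = funCalc L f + funCalc L g := fun hL =>
        funCalc_add hK hL (contDiff_testFunction f) (contDiff_testFunction g)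
          subset_union_left subset_union_right
      simp only [hA, e h1, e h2]
      abel)
    (fun a f => by
      obtain ⟨n, h1, h2⟩ := h _ f.hasCompactSupport f.tsupport_subset
      rw [smul_eq_mul, ← trace_smul]
      congr 1
      have e : ∀ {L : E →ₗ.[ℂ] E}, StripBound L n (tsupport f) →
          funCalc L (a • f : 𝓓(Ω, ℂ)) = a • funCalc L f := fun hL =>
        funCalc_const_mul f.hasCompactSupport hL (contDiff_testFunction f) subset_rfl a
      simp only [hA, e h1, e h2, smul_sub])
    (fun K hK hKΩ => by
      obtain ⟨n, h1, h2⟩ := h K hK hKΩ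
      obtain ⟨N, C, hC0, hC⟩ := exists_nuclearBound_funCalc hT hK h1 h2
      exact ⟨N, C, hC0, fun f hf B hB =>
        (hC f (contDiff_testFunction f) hf B hB).norm_trace_le⟩)
  -- The sign compensates ⟨η', f⟩ = -⟨η, f'⟩.
  obtain ⟨η, hη⟩ := exists_distr_primitive hΩ (-T)
  refine ⟨η, fun f => ⟨?_, ?_⟩⟩
  · obtain ⟨n, h1, h2⟩ := h _ f.hasCompactSupport f.tsupport_subset
    obtain ⟨M, hM⟩ := hnuc f
    exact ⟨h1.funCalcDefined (contDiff_testFunction f) f.hasCompactSupport,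
      h2.funCalcDefined (contDiff_testFunction f) f.hasCompactSupport, hM.isTraceClass⟩
  · change -η (testDeriv f) = _
    rw [hη]
    change - -T f = _
    rw [neg_neg, hTr]

end TraceDifference

end SSF

namespace SSF

/-! ### Admissible pairs -/

section Admissible

variable {E : Type*} [NormedAddCommGroup E] [InnerProductSpace ℂ E] [CompleteSpace E]
  {H H₀ : E →ₗ.[ℂ] E} {I : Opens ℝ} {c : ℝ} {m : ℕ}

theorem neg_mem_resolventSet {E : Type*} [NormedAddCommGroup E] [NormedSpace ℂ E]
    {L : E →ₗ.[ℂ] E} (h : ∀ z ∈ spectrum L, z + c ≠ 0) :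
    -(c : ℂ) ∈ resolventSet L := by
  by_contra hc
  exact h _ hc (neg_add_cancel _)

theorem eq_of_pow_eq_of_abs_arg_lt (hm : 1 ≤ m) {x y : ℂ} (hx : |x.arg| < Real.pi / (2 * m))
    (hy : |y.arg| < Real.pi / (2 * m)) (h : x ^ m = y ^ m) : x = y := by
  have hm' : (0 : ℝ) < m := by exact_mod_cast hm
  have h1 : Real.pi / (2 * m) < Real.pi / m := by
    have := Real.pi_pos
    gcongr
    linarith
  rw [← Complex.pow_cpow_nat_inv (n := m) (by omega) (abs_lt.1 (hx.trans h1)).1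
    (abs_lt.1 (hx.trans h1)).2.le, h, Complex.pow_cpow_nat_inv (by omega)
    (abs_lt.1 (hy.trans h1)).1 (abs_lt.1 (hy.trans h1)).2.le]

theorem IsAdmissiblePair.isPowerAdmissible (h : IsAdmissiblePair H H₀ I c m) :
    IsPowerAdmissible H c m where
  one_le := h.one_le
  neg_mem := neg_mem_resolventSet fun z hz => (h.spectrum_perturbed z hz).1
  eq_of_pow_eq l hl _ _ hz hlz := add_right_cancel
    (eq_of_pow_eq_of_abs_arg_lt h.one_le (h.spectrum_perturbed l hl).2 hz hlz)

/-- The spectrum of `H₀` is real, so it suffices that l + c > 0. For even m this is assumed; for odd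
m it follows because (l + c)^m equals an m-th power from the sector, which has positive real part.
-/
theorem IsAdmissiblePair.isPowerAdmissible_unperturbed (h : IsAdmissiblePair H H₀ I c m)
    (hH₀ : IsSelfAdjoint H₀) : IsPowerAdmissible H₀ c m where
  one_le := h.one_le
  neg_mem := neg_mem_resolventSet fun z hz => (h.spectrum_unperturbed z hz).1
  eq_of_pow_eq l hl z hz0 hz hlz := by
    have hm := h.one_le
    have hm' : (0 : ℝ) < m := by exact_mod_cast hm
    obtain ⟨h1, h2⟩ := h.spectrum_unperturbed l hl
    have him : l.im = 0 := by
      by_contra hi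
      exact hl (mem_resolventSet_of_im_ne_zero hH₀ hi)
    have hlr : l + c = ((l.re + c : ℝ) : ℂ) := by
      apply Complex.ext <;> simp [him]
    have hpos : 0 < l.re + c := by
      rcases m.even_or_odd with he | ho
      · linarith [h2 he]
      · have h3 := re_pow_pos hm hz0 hz
        rw [← hlz, hlr, ← Complex.ofReal_pow, Complex.ofReal_re] at h3
        exact ho.pow_pos_iff.1 h3
    refine add_right_cancel (eq_of_pow_eq_of_abs_arg_lt hm ?_ hz hlz)
    rw [hlr, Complex.arg_ofReal_of_nonneg hpos.le, abs_zero]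
    positivity

end Admissible

/-! ### Additive constants -/

section Constants

variable {Ω : Opens ℝ}

theorem eqUpToConstant_of_testDeriv_eq (hΩ : (Ω : Set ℝ).OrdConnected) {ξ η : Distr Ω}
    (h : ∀ f, ξ (testDeriv f) = η (testDeriv f)) : EqUpToConstant ξ η := by
  obtain ⟨k, hk⟩ := exists_const_of_deriv_eq_zero (ξ := η - ξ) Ω.isOpen hΩ subset_rfl fun f _ => by
    change η (testDeriv f) - ξ (testDeriv f) = 0
    rw [h, sub_self]
  refine ⟨k, fun f => ?_⟩
  rw [← hk f f.tsupport_subset]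
  change η f = ξ f + (η f - ξ f)
  ring

theorem EqUpToConstant.testDeriv_eq {ξ η : Distr Ω} (h : EqUpToConstant ξ η) (f : 𝓓(Ω, ℂ)) :
    η (testDeriv f) = ξ (testDeriv f) := by
  obtain ⟨k, hk⟩ := h
  rw [hk, integral_testDeriv, mul_zero, add_zero]

theorem exists_add_const (ξ : Distr Ω) (k : ℂ) :
    ∃ η : Distr Ω, ∀ f : 𝓓(Ω, ℂ), η f = ξ f + k * ∫ x, f x := by
  refine exists_distr_of_hasTestBounds (fun f g => ?_) (fun a f => ?_) fun K hK hKΩ => ?_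
  · have : ∫ x, (f + g : 𝓓(Ω, ℂ)) x = (∫ x, f x) + ∫ x, g x :=
      integral_add (integrable_testFunction f) (integrable_testFunction g)
    rw [map_add, this]
    ring
  · have : ∫ x, (a • f : 𝓓(Ω, ℂ)) x = a * ∫ x, f x := integral_const_mul a f
    rw [map_smul, this, smul_eq_mul, smul_eq_mul]
    ring
  · obtain ⟨N, C, hC0, hC⟩ := hasTestBounds ξ K hK hKΩ
    refine ⟨N, C + ‖k‖ * volume.real K, by positivity, fun f hf B hB => ?_⟩
    rw [add_mul, mul_assoc]
    refine (norm_add_le _ _).trans (add_le_add (hC f hf B hB) ?_)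
    rw [norm_mul, ← setIntegral_eq_integral_of_forall_compl_eq_zero (s := K)
      fun x hx => image_eq_zero_of_notMem_tsupport fun h => hx (hf h), mul_comm (volume.real K)]
    gcongr
    exact norm_setIntegral_le_of_norm_le_const hK.measure_lt_top fun x _ => by
      simpa using hB 0 (Nat.zero_le _) x

/-- Constants, seen as distributions, are preserved by the composition; this matches the additive
constants on `I` and on its image. -/
theorem integral_eq_of_comp {c : ℝ} {m : ℕ} {I : Opens ℝ} (hm : 1 ≤ m)
    (hI : (I : Set ℝ) ⊆ Ioi (-c)) (g : 𝓓(I, ℂ)) (h : 𝓓(specImage c m I, ℂ))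
    (hgh : ∀ x ∈ I, g x = ((|deriv (specMap c m) x| : ℝ) : ℂ) * h (specMap c m x)) :
    ∫ x, g x = ∫ x, h x := by
  have hinj : InjOn (specMap c m) I := fun x hx y hy hxy => by
    rw [← specInv_specMap hm (hI hx), hxy, specInv_specMap hm (hI hy)]
  rw [← setIntegral_eq_integral_of_forall_compl_eq_zero (s := (specImage c m I : Set ℝ))
      fun x hx => image_eq_zero_of_notMem_tsupport fun h1 => hx (h.tsupport_subset h1),
    ← setIntegral_eq_integral_of_forall_compl_eq_zero (s := (I : Set ℝ))
      fun x hx => image_eq_zero_of_notMem_tsupport fun h1 => hx (g.tsupport_subset h1),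
    coe_specImage hm hI, integral_image_eq_integral_abs_deriv_smul I.isOpen.measurableSet
      (fun x hx => (hasDerivAt_specMap (hI hx)).hasDerivWithinAt) hinj]
  refine setIntegral_congr_fun I.isOpen.measurableSet fun x hx => ?_
  rw [hgh x hx, (hasDerivAt_specMap (hI hx)).deriv, Complex.real_smul]

end Constants

/-! ### The spectral shift function -/

section Main

variable {E : Type*} [NormedAddCommGroup E] [InnerProductSpace ℂ E] [CompleteSpace E]
  {H H₀ : E →ₗ.[ℂ] E} {I : Opens ℝ} {c : ℝ} {m : ℕ}

theorem IsSSF.iff_eqUpToConstant {X X₀ : E →L[ℂ] E} {Ω : Opens ℝ}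
    (hΩ : (Ω : Set ℝ).OrdConnected) {η η' : Distr Ω} (h : IsSSF X X₀ Ω η) :
    IsSSF X X₀ Ω η' ↔ EqUpToConstant η η' := by
  refine ⟨fun h' => eqUpToConstant_of_testDeriv_eq hΩ fun f => neg_injective ?_,
    fun h' f => ⟨(h f).1, ?_⟩⟩
  · exact (h f).2.trans (h' f).2.symm
  · rw [← (h f).2]
    exact congrArg Neg.neg (h'.testDeriv_eq f)

theorem TraceFormula.iff_eqUpToConstant (hI : (I : Set ℝ).OrdConnected) {ξ ξ' : Distr I}
    (h : TraceFormula H H₀ I ξ) : TraceFormula H H₀ I ξ' ↔ EqUpToConstant ξ ξ' := by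
  refine ⟨fun h' => eqUpToConstant_of_testDeriv_eq hI fun f => ?_, fun h' f => ⟨(h f).1, ?_⟩⟩
  · exact (h f).2.symm.trans (h' f).2
  · rw [h'.testDeriv_eq, (h f).2]

theorem IsRelativeSSF.of_eqUpToConstant (hm : 1 ≤ m) (hI : (I : Set ℝ) ⊆ Ioi (-c))
    (hIc : (I : Set ℝ).OrdConnected) {ξ ξ' : Distr I} (h : IsRelativeSSF H H₀ I c m ξ)
    (h' : EqUpToConstant ξ ξ') : IsRelativeSSF H H₀ I c m ξ' := by
  obtain ⟨η, hη, hξ⟩ := h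
  obtain ⟨k, hk⟩ := h'
  obtain ⟨η', hη'⟩ := exists_add_const η k
  refine ⟨η', (hη.iff_eqUpToConstant (ordConnected_specImage hm hI hIc)).2 ⟨k, hη'⟩,
    fun g h hgh => ?_⟩
  rw [hk, hη', hξ g h hgh, integral_eq_of_comp hm hI g h hgh]

theorem exists_stripBound_pair {L L₀ : E →ₗ.[ℂ] E} {K : Set ℝ} (h : ∃ n, StripBound L n K)
    (h₀ : ∃ n, StripBound L₀ n K) : ∃ n, StripBound L n K ∧ StripBound L₀ n K := by
  obtain ⟨n, hn⟩ := h
  obtain ⟨n₀, hn₀⟩ := h₀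
  exact ⟨max n n₀, hn.mono_exponent (le_max_left _ _), hn₀.mono_exponent (le_max_right _ _)⟩

theorem funCalc_pushTest {L : E →ₗ.[ℂ] E} (hL : IsPowerAdmissible L c m)
    (hI : (I : Set ℝ) ⊆ Ioi (-c)) (h : PolynomialResolventBound L I) (f : 𝓓(I, ℂ)) :
    funCalc (ofBounded (negPow L c m)) (pushTest hL.one_le hI f) = funCalc L f := by
  obtain ⟨n, hn⟩ := h.exists_stripBound f.hasCompactSupport f.tsupport_subset
  obtain ⟨n', hn'⟩ := h.exists_stripBound_negPow hL
    (pushTest hL.one_le hI f).hasCompactSupport (pushTest hL.one_le hI f).tsupport_subset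
  exact funCalc_negPow hL (contDiff_testFunction f) f.hasCompactSupport
    (f.tsupport_subset.trans hI) (hn.mono_exponent (le_max_left n n'))
    (hn'.mono_exponent (le_max_right n n'))

theorem IsAdmissiblePair.exists_isSSF (h : IsAdmissiblePair H H₀ I c m) (hH₀ : IsSelfAdjoint H₀)
    (hI : (I : Set ℝ).OrdConnected) (hH : PolynomialResolventBound H I) :
    ∃ η, IsSSF (negPow H c m) (negPow H₀ c m) (specImage c m I) η :=
  SSF.exists_isSSF h.traceClass (ordConnected_specImage h.one_le h.subset_Ioi hI)
    fun _ hK hKI => exists_stripBound_pair (hH.exists_stripBound_negPow h.isPowerAdmissible hK hKI)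
      ((polynomialResolventBound_of_isSelfAdjoint hH₀ I).exists_stripBound_negPow
        (h.isPowerAdmissible_unperturbed hH₀) hK hKI)

/-- The formula for the bounded pair is applied to f ∘ φ⁻¹. Invariance of the calculus turns its
operators into f(H) and f(H₀), and the chain rule turns its right side into ξ(f'). -/
theorem IsRelativeSSF.traceFormula (h : IsAdmissiblePair H H₀ I c m) (hH₀ : IsSelfAdjoint H₀)
    (hH : PolynomialResolventBound H I) {ξ : Distr I} (hξ : IsRelativeSSF H H₀ I c m ξ) :
    TraceFormula H H₀ I ξ := by
  intro f
  obtain ⟨η, hη, hξη⟩ := hξ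
  have hb₀ := polynomialResolventBound_of_isSelfAdjoint hH₀ (I : Set ℝ)
  obtain ⟨⟨-, -, h1⟩, h2⟩ := hη (pushTest h.one_le h.subset_Ioi f)
  rw [funCalc_pushTest h.isPowerAdmissible h.subset_Ioi hH,
    funCalc_pushTest (h.isPowerAdmissible_unperturbed hH₀) h.subset_Ioi hb₀] at h1 h2
  obtain ⟨n, hn⟩ := hH.exists_stripBound f.hasCompactSupport f.tsupport_subset
  obtain ⟨n₀, hn₀⟩ := hb₀.exists_stripBound f.hasCompactSupport f.tsupport_subset
  refine ⟨⟨hn.funCalcDefined (contDiff_testFunction f) f.hasCompactSupport,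
    hn₀.funCalcDefined (contDiff_testFunction f) f.hasCompactSupport, h1⟩, ?_⟩
  rw [← h2, hξη.testDeriv_eq h.one_le h.subset_Ioi]

theorem IsAdmissiblePair.exists_isRelativeSSF (h : IsAdmissiblePair H H₀ I c m)
    (hH₀ : IsSelfAdjoint H₀) (hI : (I : Set ℝ).OrdConnected) (hH : PolynomialResolventBound H I) :
    ∃ ξ, IsRelativeSSF H H₀ I c m ξ := by
  obtain ⟨η, hη⟩ := h.exists_isSSF hH₀ hI hH
  obtain ⟨ξ, hξ, -⟩ := existsUnique_isComposition h.one_le h.subset_Ioi η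
  exact ⟨ξ, η, hη, hξ⟩

/-- The trace formula does not involve (c, m), so this equivalence contains the independence of the
pair. For the converse direction, two solutions differ by a constant, which can be moved to the
image interval. -/
theorem IsAdmissiblePair.isRelativeSSF_iff_traceFormula (h : IsAdmissiblePair H H₀ I c m)
    (hH₀ : IsSelfAdjoint H₀) (hI : (I : Set ℝ).OrdConnected) (hH : PolynomialResolventBound H I)
    {ξ : Distr I} : IsRelativeSSF H H₀ I c m ξ ↔ TraceFormula H H₀ I ξ := by
  refine ⟨fun hξ => hξ.traceFormula h hH₀ hH, fun hξ => ?_⟩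
  obtain ⟨ξ₀, hξ₀⟩ := h.exists_isRelativeSSF hH₀ hI hH
  exact hξ₀.of_eqUpToConstant h.one_le h.subset_Ioi hI
    (((hξ₀.traceFormula h hH₀ hH).iff_eqUpToConstant hI).1 hξ)

/-- Over a gap both resolvents are holomorphic across the axis, so Green's formula gives f(H) =
f(H₀) = 0. -/
theorem TraceFormula.testDeriv_eq_zero {G : Set ℝ} (hG : IsSpectralGap H H₀ I G)
    (hH₀ : IsSelfAdjoint H₀) (hH : PolynomialResolventBound H I) {ξ : Distr I}
    (hξ : TraceFormula H H₀ I ξ) {f : 𝓓(I, ℂ)} (hf : tsupport f ⊆ G) : ξ (testDeriv f) = 0 := by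
  obtain ⟨n, hn⟩ := hH.exists_stripBound f.hasCompactSupport f.tsupport_subset
  obtain ⟨n₀, hn₀⟩ := (polynomialResolventBound_of_isSelfAdjoint hH₀ (I : Set ℝ)).exists_stripBound
    f.hasCompactSupport f.tsupport_subset
  rw [← (hξ f).2, funCalc_eq_zero (contDiff_testFunction f) f.hasCompactSupport hn
      fun x hx => (hG.resolvent x (hf hx)).1,
    funCalc_eq_zero (contDiff_testFunction f) f.hasCompactSupport hn₀
      fun x hx => (hG.resolvent x (hf hx)).2, sub_zero]
  simp [trace]

theorem TraceFormula.existsUnique_isVanishingOn {G : Set ℝ} (hG : IsSpectralGap H H₀ I G)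
    (hI : (I : Set ℝ).OrdConnected) (hH₀ : IsSelfAdjoint H₀) (hH : PolynomialResolventBound H I)
    {ξ : Distr I} (hξ : TraceFormula H H₀ I ξ) :
    ∃ ξ₁, TraceFormula H H₀ I ξ₁ ∧ Distribution.IsVanishingOn ξ₁ G ∧
      ∀ ξ', TraceFormula H H₀ I ξ' → Distribution.IsVanishingOn ξ' G → ξ' = ξ₁ := by
  obtain ⟨k, hk⟩ := exists_const_of_deriv_eq_zero (ξ := ξ) hG.isOpen hG.ordConnected hG.subset
    fun f hf => hξ.testDeriv_eq_zero hG hH₀ hH hf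
  obtain ⟨ξ₁, hξ₁⟩ := exists_add_const ξ (-k)
  have h₁ : TraceFormula H H₀ I ξ₁ := (hξ.iff_eqUpToConstant hI).2 ⟨-k, hξ₁⟩
  have hv : Distribution.IsVanishingOn ξ₁ G := fun f hf => by
    rw [hξ₁, hk f hf]
    ring
  refine ⟨ξ₁, h₁, hv, fun ξ' h' hv' => ?_⟩
  obtain ⟨k', hk'⟩ := (h₁.iff_eqUpToConstant hI).1 h'
  -- Two solutions differ by a constant; testing against `χ`, supported in the gap with integral 1,
  -- shows that it is 0.
  obtain ⟨χ, hχG, hχ⟩ := exists_testFunction_integral_one hG.isOpen hG.subset hG.nonempty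
  have h0 := hk' χ
  rw [hv χ hχG, hv' χ hχG, hχ, zero_add, mul_one] at h0
  ext f
  rw [hk', ← h0, zero_mul, add_zero]

end Main

end SSF

/-! ### The main theorem -/

theorem mainTheorem2 {E : Type*} [NormedAddCommGroup E] [InnerProductSpace ℂ E] [CompleteSpace E]
    [TopologicalSpace.SeparableSpace E]
    (H₀ : E →ₗ.[ℂ] E) (hH₀ : IsSelfAdjoint H₀)
    (hbelow : ∃ γ : ℝ, ∀ u : H₀.domain, γ * ‖(u : E)‖ ^ 2 ≤ (inner ℂ (u : E) (H₀ u)).re)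
    (V : E →L[ℂ] E) (H : E →ₗ.[ℂ] E) (hH : H = V.toLinearMap +ᵥ H₀)
    (I : TopologicalSpace.Opens ℝ) (hI : (I : Set ℝ).OrdConnected)
    (hyp1 : SSF.FinitelyManyNonrealEigenvalues H I)
    (hyp2 : SSF.PolynomialResolventBound H I)
    (c : ℝ) (m : ℕ) (hyp3 : SSF.IsAdmissiblePair H H₀ I c m) :
    -- the spectral shift function of `((H + c)^(-m), (H₀ + c)^(-m))` on the image of `I` exists
    -- and is unique up to an additive constant
    (∃ η, SSF.IsSSF (SSF.negPow H c m) (SSF.negPow H₀ c m) (SSF.specImage c m I) η) ∧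
    (∀ η, SSF.IsSSF (SSF.negPow H c m) (SSF.negPow H₀ c m) (SSF.specImage c m I) η →
      ∀ η', SSF.IsSSF (SSF.negPow H c m) (SSF.negPow H₀ c m) (SSF.specImage c m I) η' ↔
        SSF.EqUpToConstant η η') ∧
    -- its composition with the change of variables is a well-defined distribution on `I`
    (∀ η : SSF.Distr (SSF.specImage c m I), ∃! ξ : SSF.Distr I, SSF.IsComposition c m ξ η) ∧
    -- it satisfies the trace formula
    (∀ ξ, SSF.IsRelativeSSF H H₀ I c m ξ → SSF.TraceFormula H H₀ I ξ) ∧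
    -- it is unique up to an additive constant and does not depend on `(c, m)`
    (∀ ξ, SSF.IsRelativeSSF H H₀ I c m ξ →
      ∀ ξ', SSF.IsRelativeSSF H H₀ I c m ξ' ↔ SSF.EqUpToConstant ξ ξ') ∧
    (∀ (c' : ℝ) (m' : ℕ), SSF.IsAdmissiblePair H H₀ I c' m' →
      ∀ ξ, SSF.IsRelativeSSF H H₀ I c m ξ ↔ SSF.IsRelativeSSF H H₀ I c' m' ξ) ∧
    -- it is unique once normalized to `0` on a spectral gap
    (∀ G : Set ℝ, SSF.IsSpectralGap H H₀ I G →
      ∃ ξ : SSF.Distr I, SSF.IsRelativeSSF H H₀ I c m ξ ∧ Distribution.IsVanishingOn ξ G ∧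
        ∀ ξ' : SSF.Distr I, SSF.TraceFormula H H₀ I ξ' → Distribution.IsVanishingOn ξ' G →
          ξ' = ξ) := by
  have hΩ := SSF.ordConnected_specImage hyp3.one_le hyp3.subset_Ioi hI
  refine ⟨hyp3.exists_isSSF hH₀ hI hyp2, fun η hη η' => hη.iff_eqUpToConstant hΩ,
    SSF.existsUnique_isComposition hyp3.one_le hyp3.subset_Ioi,
    fun ξ hξ => hξ.traceFormula hyp3 hH₀ hyp2, fun ξ hξ ξ' => ?_, fun c' m' h' ξ => ?_,
    fun G hG => ?_⟩
  · rw [hyp3.isRelativeSSF_iff_traceFormula hH₀ hI hyp2]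
    exact (hξ.traceFormula hyp3 hH₀ hyp2).iff_eqUpToConstant hI
  · rw [hyp3.isRelativeSSF_iff_traceFormula hH₀ hI hyp2,
      h'.isRelativeSSF_iff_traceFormula hH₀ hI hyp2]
  · obtain ⟨ξ, hξ⟩ := hyp3.exists_isRelativeSSF hH₀ hI hyp2
    obtain ⟨ξ₁, h₁, h₂, h₃⟩ :=
      (hξ.traceFormula hyp3 hH₀ hyp2).existsUnique_isVanishingOn hG hI hH₀ hyp2
    exact ⟨ξ₁, (hyp3.isRelativeSSF_iff_traceFormula hH₀ hI hyp2).2 h₁, h₂, h₃⟩
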